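/- Let $\lambda>0$ and $\delta>0$ be fixed, and let $f_0\ge 0$ be a probability density on $\mathbb R$ that vanishes for $v<0$ and satisfies $\int v f_0(v)\,dv=1$ and $\int |v|^{1+\delta}f_0(v)\,dv<\infty$. For mixing parameters $p>q>0$ with $(p-1)^2/q=\lambda$, a weak solution $f(v,t)$ of the kinetic wealth model with initial density $f_0$ is a family of probability densities $f(\cdot,t)$, $t>0$, vanishing for $v<0$ and with finite moment of order $1+\delta$, such that for every $\phi\in C^\infty(\mathbb R)$ with $|\phi(v)|\le C(1+|v|^{1+\delta})$ the map $t\mapsto\int\phi(v) f(v,t)\,dv$ is $C^1$ on $(0,\infty)$, $$\frac{d}{dt}\int \phi(v) f(v,t)\,dv=\iint f(v,t)f(w,t)\big(\phi(pv+qw)-\phi(v)\big)\,dv\,dw\quad (t>0),$$ and $\int\phi(v) f(v,t)\,dv\to\int\phi(v) f_0(v)\,dv$ as $t\to0^+$. With $m(t)=\int v f(v,t)\,dv$ set $g(v,t)=m(t)\,f(m(t)v,t)$ and $h(v,\tau)=g(v,t)$, where $\tau=qt$. For $s=k+\beta$ with $k\ge 0$ an integer and $0<\beta\le1$, let $\mathcal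 F_s(\mathbb R)$ be the class of $\phi\in C^k(\mathbb R)$ whose $k$-th derivative is globally Hölder continuous of order $\beta$. **Theorem.** (i) For all $p>q>0$ with $(p-1)^2/q=\lambda$ such a weak solution exists. (ii) Let $q_n\to0$, $p_n>q_n>0$, $(p_n-1)^2/q_n=\lambda$, and let $h_n(v,\tau)$ be the rescaled density obtained from a weak solution for $(p_n,q_n)$ with initial density $f_0$. Then there are a subsequence $(n_j)$ and probability densities $h(\cdot,\tau)$, $\tau>0$, vanishing for $v<0$ and with finite moment of order $1+\delta$, such that $$\int\phi(v) h_{n_j}(v,\tau)\,dv\to\int\phi(v) h(v,\tau)\,dv\qquad\text{for all }\phi\in\mathcal F_{1+\delta}(\mathbb R)\text{ and all }\tau>0,$$ and $h$ is a weak solution, with initial density $f_0$, of the Fokker–Planck equation $$\partial_\tau h=\frac{\lambda}{2}\,\partial_v^2(v^2h)+\partial_v\big((v-1)h\big).$$ That is, for every $\phi\in\mathcal F_{1+\delta}(\mathbb R)\cap C^2(\mathbb R)$ with $|v^2\phi''(v)|\le C(1+|v|^{1+\delta})$ (for $\delta>1$: for every $\phi\in\mathcal F_{1+\delta}(\mathbb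 R)$), the map $\tau\mapsto\int\phi(v) h(v,\tau)\,dv$ is $C^1$ on $(0,\infty)$, $$\frac{d}{d\tau}\int\phi(v) h(v,\tau)\,dv=\frac\lambda2\int v^2\phi''(v)h(v,\tau)\,dv-\int(v-1)\phi'(v)h(v,\tau)\,dv\quad(\tau>0),$$ and $\int\phi(v) h(v,\tau)\,dv\to\int\phi(v) f_0(v)\,dv$ as $\tau\to0^+$. (iii) With $\mu=1+2/\lambda$, the function $M_\lambda(v)=\frac{(\mu-1)^\mu}{\Gamma(\mu)}\,v^{-1-\mu}e^{-(\mu-1)/v}$ for $v>0$, $M_\lambda(v)=0$ for $v\le0$, is, up to equality almost everywhere, the unique probability density $M$ vanishing for $v<0$ that is a stationary state of this equation, i.e. $\frac\lambda2\int v^2\phi''M\,dv-\int(v-1)\phi' M\,dv=0$ for all $\phi\in C_c^\infty(\mathbb R)$. It has a Pareto tail: $v^{1+\mu}M_\lambda(v)\to\frac{(\mu-1)^\mu}{\Gamma(\mu)}>0$ as $v\to\infty$. -/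

import Mathlib

open MeasureTheory Filter Topology

namespace WealthModel

noncomputable section

/-- `f` is a probability density of the wealth `v ≥ 0`, extended by zero to `v < 0`. -/
structure IsProbDensity (f : ℝ → ℝ) : Prop where
  nonneg : ∀ v, 0 ≤ f v
  eq_zero_of_neg : ∀ v, v < 0 → f v = 0
  integrable : Integrable f
  integral_eq_one : ∫ v, f v = 1

/-- `f` is a probability density with finite moment of order `α`. -/
structure IsDensityWithMoment (α : ℝ) (f : ℝ → ℝ) : Prop extends IsProbDensity f where
  moment : Integrable (fun v => |v| ^ α * f v)

/-- The class `F_s(ℝ)`: writing `s = m + β` with `m` an integer and `0 < β ≤ 1`, the `m`-th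
derivative of `φ` is (globally) Hölder continuous of order `β`. -/
def HolderClass (s : ℝ) (φ : ℝ → ℝ) : Prop :=
  ∃ (m : ℕ) (β : ℝ), 0 < β ∧ β ≤ 1 ∧ (m : ℝ) + β = s ∧ ContDiff ℝ m φ ∧
    ∃ C : ℝ, ∀ v w : ℝ, |iteratedDeriv m φ v - iteratedDeriv m φ w| ≤ C * |v - w| ^ β

/-- Smooth test functions that can be integrated against densities with finite moment of order
`α`: they grow at most like `1 + |v| ^ α`. -/
def SmoothTest (α : ℝ) (φ : ℝ → ℝ) : Prop :=
  ContDiff ℝ (⊤ : ℕ∞) φ ∧ ∃ C : ℝ, ∀ v : ℝ, |φ v| ≤ C * (1 + |v| ^ α)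

/-- Weak form of the collision operator of the trade `v* = p v + q w`, `w* = q v + p w`. -/
def collision (p q : ℝ) (φ f : ℝ → ℝ) : ℝ :=
  ∫ z : ℝ × ℝ, f z.1 * f z.2 * (φ (p * z.1 + q * z.2) - φ z.1)

/-- Weak solution `f t v`, with moments of order `α`, of the kinetic wealth model with initial
density `f₀`. -/
structure IsBoltzmannSolution (p q α : ℝ) (f₀ : ℝ → ℝ) (f : ℝ → ℝ → ℝ) : Prop where
  density : ∀ t, 0 < t → IsDensityWithMoment α (f t)
  contDiffOn : ∀ φ, SmoothTest α φ →
    ContDiffOn ℝ 1 (fun t => ∫ v, φ v * f t v) (Set.Ioi 0)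
  hasDerivAt : ∀ φ, SmoothTest α φ → ∀ t, 0 < t →
    HasDerivAt (fun t => ∫ v, φ v * f t v) (collision p q φ (f t)) t
  initial : ∀ φ, SmoothTest α φ →
    Tendsto (fun t => ∫ v, φ v * f t v) (𝓝[>] 0) (𝓝 (∫ v, φ v * f₀ v))

/-- The mean wealth `m(t) = ∫ v f(v,t) dv`. -/
def meanWealth (f : ℝ → ℝ → ℝ) (t : ℝ) : ℝ := ∫ v, v * f t v

/-- The self-similar scaling `g(v,t) = m(t) f(m(t) v, t)`. -/
def selfSimilar (f : ℝ → ℝ → ℝ) (t v : ℝ) : ℝ := meanWealth f t * f t (meanWealth f t * v)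

/-- The rescaled density `h(v,τ) = g(v,t)`, where `τ = q t`. -/
def rescaled (q : ℝ) (f : ℝ → ℝ → ℝ) (τ v : ℝ) : ℝ := selfSimilar f (τ / q) v

/-- Weak form of `(lam / 2) ∂²_v (v² h) + ∂_v ((v - 1) h)`, tested against `φ`. -/
def fokkerPlanck (lam : ℝ) (φ h : ℝ → ℝ) : ℝ :=
  lam / 2 * (∫ v, v ^ 2 * iteratedDeriv 2 φ v * h v) - ∫ v, (v - 1) * deriv φ v * h v

/-- Test functions for the Fokker-Planck equation: the `φ ∈ F_s(ℝ)` for which the second-order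
term makes sense, that is, `φ` is `C²` and `v² φ''(v)` is controlled by the moment of order `s`.
For `s > 2` these two conditions hold for every `φ ∈ F_s(ℝ)`, and for `s = 2` the second one
follows from the first. -/
def FokkerPlanckTest (s : ℝ) (φ : ℝ → ℝ) : Prop :=
  HolderClass s φ ∧ ContDiff ℝ 2 φ ∧
    ∃ C : ℝ, ∀ v : ℝ, |v ^ 2 * iteratedDeriv 2 φ v| ≤ C * (1 + |v| ^ s)

/-- Weak solution `h τ v`, with moments of order `s`, of
`∂_τ h = (lam / 2) ∂²_v (v² h) + ∂_v ((v - 1) h)` with initial density `h₀`. -/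
structure IsFokkerPlanckSolution (lam s : ℝ) (h₀ : ℝ → ℝ) (h : ℝ → ℝ → ℝ) : Prop where
  density : ∀ τ, 0 < τ → IsDensityWithMoment s (h τ)
  contDiffOn : ∀ φ, FokkerPlanckTest s φ →
    ContDiffOn ℝ 1 (fun τ => ∫ v, φ v * h τ v) (Set.Ioi 0)
  hasDerivAt : ∀ φ, FokkerPlanckTest s φ → ∀ τ, 0 < τ →
    HasDerivAt (fun τ => ∫ v, φ v * h τ v) (fokkerPlanck lam φ (h τ)) τ
  initial : ∀ φ, FokkerPlanckTest s φ →
    Tendsto (fun τ => ∫ v, φ v * h τ v) (𝓝[>] 0) (𝓝 (∫ v, φ v * h₀ v))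

/-- A stationary state of unit mass of the Fokker-Planck equation, in the distributional sense
on the whole line (no moment is required). -/
def IsStationaryState (lam : ℝ) (M : ℝ → ℝ) : Prop :=
  IsProbDensity M ∧
    ∀ φ : ℝ → ℝ, ContDiff ℝ (⊤ : ℕ∞) φ → HasCompactSupport φ → fokkerPlanck lam φ M = 0

/-- The exponent `μ = 1 + 2 / lam`. -/
def paretoExponent (lam : ℝ) : ℝ := 1 + 2 / lam

/-- The (inverse) Gamma distribution
`M(v) = (μ - 1) ^ μ / Γ(μ) * exp (-(μ - 1) / v) / v ^ (1 + μ)` on `v > 0`. -/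
def equilibrium (lam : ℝ) (v : ℝ) : ℝ :=
  if 0 < v then
    (paretoExponent lam - 1) ^ paretoExponent lam / Real.Gamma (paretoExponent lam) *
      (Real.exp (-((paretoExponent lam - 1) / v)) / v ^ (1 + paretoExponent lam))
  else 0

end

end WealthModel

/-! Existence rests on Wild's formula. Put `x = 1 - exp (-t)` and let `wild` be the measures
obtained by averaging all trades between earlier terms. Then `exp (-t) * ∑ x ^ n * ∫ φ ∂(wild n)`
solves the weak equation, because the recursion for `wild` is the Cauchy-product form of the
quadratic gain term (`integral_trade_wildSum`, `hasDerivAt_integral_wildSum`). The moments of order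
`α = 1 + δ` of the terms grow at most polynomially in `n`, so every series has radius of convergence
at least one (`summableOnUnit_wild_weight`). A trade with `p ≠ 0` preserves absolute continuity, so
the sum has a density.

The limit concerns arbitrary weak solutions, so every estimate is derived from the weak formulation
alone. The mean is exactly `exp ((p + q - 1) * t)`; dividing by it and running time at speed `1 / q`
gives laws of mean one with generator `tradeGenerator`. Since `(p - 1) ^ 2 = lam * q`, Taylor
expansion gives `lam / 2 * v ^ 2 * φ'' - v * φ' + w * φ'` up to a vanishing error, and averaging
over the second agent, of mean one, turns `w` into `1`: this is the adjoint Fokker-Planck operator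
(`exists_abs_integral_tradeGenerator_sub_le`).

Three uniform bounds make the passage to the limit possible. Tails: a family of smooth weights
`tailWeight α R` satisfies a Grönwall inequality whose constant does not depend on `R`, so smallness
of the initial tail of order exactly `α` propagates (`IsRescaledFlow.integral_tailWeight_le`). Time:
integrals of test functions are Lipschitz (`IsGrazingSequence.lipschitz`). Concentration: the bound
`∫ φ ∂ν₀ ≤ a + b * ∫ φ`, for `0 ≤ φ ≤ 1`, is propagated with `b` multiplied by a controlled
exponential (`IsBoltzmannFlow.integral_le_of_initial`). The second, with Prokhorov's theorem at
rational times, gives a subsequence; the first upgrades vague convergence to convergence against all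
continuous functions of growth `α`; the third shows that the limit has a density. The equation,
first known for smooth compactly supported tests, extends to the full class by approximating `φ` and
its image under the operator uniformly up to tails (`exists_fokkerPlanckOp_approx`).

For stationary states, testing with primitives integrates the equation once, to `(v ^ 2 * M)' = -(2
/ lam) * (v - 1) * M` in the distributional sense. The integration constant disappears by sending a
compensating bump to infinity, which uses only the finite mass of `M`
(`IsStationaryState.integral_first_order`). On the positive half-line this first-order equation has
a one-dimensional solution space spanned by the inverse Gamma density, and unit mass fixes the
factor. -/

namespace WealthModel

/-! ### The adjoint operator and compactly supported primitives. -/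

/-- The operator adjoint to the Fokker-Planck operator. -/
noncomputable def fokkerPlanckOp (lam : ℝ) (φ : ℝ → ℝ) (v : ℝ) : ℝ :=
  lam / 2 * (v ^ 2 * deriv (deriv φ) v) - (v - 1) * deriv φ v

theorem iteratedDeriv_two (φ : ℝ → ℝ) : iteratedDeriv 2 φ = deriv (deriv φ) := by
  rw [iteratedDeriv_succ, iteratedDeriv_one]

theorem contDiff_deriv_infty {φ : ℝ → ℝ} (h : ContDiff ℝ (⊤ : ℕ∞) φ) :
    ContDiff ℝ (⊤ : ℕ∞) (deriv φ) := (contDiff_infty_iff_deriv.1 h).2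

/-- The primitive based at `a` is constant on each side of the support; the vanishing total integral
is what makes the right-hand constant zero. -/
theorem exists_primitive {g : ℝ → ℝ} (hg : ContDiff ℝ (⊤ : ℕ∞) g) {a b : ℝ}
    (hsupp : ∀ x, x ∉ Set.Icc a b → g x = 0) (hint : ∫ x, g x = 0) :
    ∃ φ : ℝ → ℝ, ContDiff ℝ (⊤ : ℕ∞) φ ∧ (∀ x, x ∉ Set.Icc a b → φ x = 0) ∧
      ∀ x, HasDerivAt φ (g x) x := by
  have hd : ∀ x, HasDerivAt (fun v => ∫ y in a..v, g y) (g x) x := fun x =>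
    intervalIntegral.integral_hasDerivAt_right (hg.continuous.intervalIntegrable _ _)
      (hg.continuous.stronglyMeasurableAtFilter _ _) hg.continuous.continuousAt
  refine ⟨fun v => ∫ y in a..v, g y, ?_, ?_, hd⟩
  · rw [contDiff_infty_iff_deriv]
    refine ⟨fun x => (hd x).differentiableAt, ?_⟩
    rwa [show deriv (fun v => ∫ y in a..v, g y) = g from funext fun x => (hd x).deriv]
  · intro x hx
    rcases lt_or_ge x a with h | h
    · simp only
      rw [intervalIntegral.integral_symm, intervalIntegral.integral_of_le h.le, neg_eq_zero]
      -- The endpoint `a`, where `g` is not known to vanish, is moved out of the interval.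
      rw [← integral_Ico_eq_integral_Ioc]
      refine setIntegral_eq_zero_of_forall_eq_zero fun y hy => hsupp y fun hy' => ?_
      exact absurd hy.2 (not_lt.2 hy'.1)
    · have hb : b < x := by
        by_contra hb
        exact hx ⟨h, not_lt.1 hb⟩
      simp only
      rw [intervalIntegral.integral_of_le h, ← integral_Icc_eq_integral_Ioc,
        setIntegral_eq_integral_of_forall_compl_eq_zero, hint]
      intro y hy
      exact hsupp y fun hy' => hy ⟨hy'.1, hy'.2.trans hb.le⟩

theorem hasCompactSupport_of_Icc {g : ℝ → ℝ} {a b : ℝ}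
    (hsupp : ∀ x, x ∉ Set.Icc a b → g x = 0) : HasCompactSupport g :=
  HasCompactSupport.intro isCompact_Icc hsupp

theorem continuous_fokkerPlanckOp {lam : ℝ} {φ : ℝ → ℝ} (h : ContDiff ℝ 2 φ) :
    Continuous (fokkerPlanckOp lam φ) := by
  have h1 : Continuous (deriv φ) := h.continuous_deriv (by norm_num)
  have h2 : Continuous (deriv (deriv φ)) := by
    rw [← iteratedDeriv_two]; exact h.continuous_iteratedDeriv 2 (by norm_num)
  unfold fokkerPlanckOp
  fun_prop

theorem bounded_of_hasCompactSupport {g : ℝ → ℝ} (hg : Continuous g) (hs : HasCompactSupport g) :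
    ∃ C : ℝ, 0 ≤ C ∧ ∀ x, |g x| ≤ C := by
  obtain ⟨C, hC⟩ := hg.bounded_above_of_compact_support hs
  exact ⟨C, (norm_nonneg _).trans (hC 0), hC⟩

theorem integrable_mul_of_bounded {g M : ℝ → ℝ} (hg : Continuous g) (hs : HasCompactSupport g)
    (hM : Integrable M) : Integrable (fun v => g v * M v) := by
  obtain ⟨C, -, hC⟩ := bounded_of_hasCompactSupport hg hs
  exact hM.bdd_mul hg.aestronglyMeasurable (Eventually.of_forall hC)

theorem fokkerPlanck_eq_integral {lam : ℝ} {φ M : ℝ → ℝ} (hφ : ContDiff ℝ (⊤ : ℕ∞) φ)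
    (hs : HasCompactSupport φ) (hM : Integrable M) :
    fokkerPlanck lam φ M = ∫ v, fokkerPlanckOp lam φ v * M v := by
  have h1 : ContDiff ℝ (⊤ : ℕ∞) (deriv φ) := contDiff_deriv_infty hφ
  have h2 : ContDiff ℝ (⊤ : ℕ∞) (deriv (deriv φ)) := contDiff_deriv_infty h1
  have i1 : Integrable fun v => v ^ 2 * deriv (deriv φ) v * M v :=
    integrable_mul_of_bounded ((continuous_pow 2).mul h2.continuous) hs.deriv.deriv.mul_left hM
  have i2 : Integrable fun v => (v - 1) * deriv φ v * M v :=
    integrable_mul_of_bounded ((continuous_id.sub continuous_const).mul h1.continuous)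
      hs.deriv.mul_left hM
  rw [fokkerPlanck, ← integral_const_mul, iteratedDeriv_two, ← integral_sub (i1.const_mul _) i2]
  refine integral_congr_ae (Eventually.of_forall fun v => ?_)
  simp only [fokkerPlanckOp]
  ring

/-! ### The inverse Gamma density: mass, stationarity, tail. -/

section Equilibrium

variable {lam : ℝ}

theorem equilibrium_of_pos {v : ℝ} (hv : 0 < v) :
    equilibrium lam v = (2 / lam) ^ (1 + 2 / lam) / Real.Gamma (1 + 2 / lam) *
      (Real.exp (-(2 / lam / v)) * v ^ (-(2 / lam) - 2)) := by
  rw [equilibrium, if_pos hv, paretoExponent, add_sub_cancel_left,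
    show (-(2 / lam) - 2 : ℝ) = -(1 + (1 + 2 / lam)) by ring, Real.rpow_neg hv.le, ← div_eq_mul_inv]

theorem equilibrium_of_nonpos {v : ℝ} (hv : v ≤ 0) : equilibrium lam v = 0 :=
  if_neg (not_lt.2 hv)

theorem equilibrium_const_pos (hlam : 0 < lam) :
    0 < (2 / lam) ^ (1 + 2 / lam) / Real.Gamma (1 + 2 / lam) :=
  div_pos (Real.rpow_pos_of_pos (by positivity) _) (Real.Gamma_pos_of_pos (by positivity))

theorem equilibrium_pos (hlam : 0 < lam) {v : ℝ} (hv : 0 < v) : 0 < equilibrium lam v := by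
  rw [equilibrium_of_pos hv]
  exact mul_pos (equilibrium_const_pos hlam) (mul_pos (Real.exp_pos _) (Real.rpow_pos_of_pos hv _))

theorem equilibrium_nonneg (hlam : 0 < lam) (v : ℝ) : 0 ≤ equilibrium lam v := by
  rcases lt_or_ge 0 v with h | h
  · exact (equilibrium_pos hlam h).le
  · exact (equilibrium_of_nonpos h).ge

/-- The substitution `u = 1 / v` reduces integrability and total mass to the Gamma integral. -/
theorem equilibrium_comp_rpow {v : ℝ} (hv : v ∈ Set.Ioi (0 : ℝ)) :
    equilibrium lam v = (2 / lam) ^ (1 + 2 / lam) / Real.Gamma (1 + 2 / lam) *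
      ((|(-1 : ℝ)| * v ^ (-1 - 1 : ℝ)) • (fun u : ℝ => u ^ (1 + 2 / lam - 1) *
        Real.exp (-(2 / lam * u))) (v ^ (-1 : ℝ))) := by
  have hv : 0 < v := hv
  rw [equilibrium_of_pos hv]
  simp only [smul_eq_mul]
  rw [← Real.rpow_mul hv.le, Real.rpow_neg_one, abs_neg, abs_one, one_mul,
    ← mul_assoc (v ^ (-1 - 1 : ℝ)), ← Real.rpow_add hv, div_eq_mul_inv (2 / lam) v,
    mul_comm (Real.exp _)]
  congr 3
  ring

theorem integrableOn_gamma (hlam : 0 < lam) :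
    IntegrableOn (fun u : ℝ => u ^ (1 + 2 / lam - 1) * Real.exp (-(2 / lam * u))) (Set.Ioi 0) := by
  have h := integrableOn_rpow_mul_exp_neg_mul_rpow (p := 1) (s := 1 + 2 / lam - 1) (b := 2 / lam)
    (by have : 0 < 2 / lam := by positivity
        linarith) one_pos (by positivity)
  refine h.congr_fun (fun x _ => ?_) measurableSet_Ioi
  simp

theorem integrable_equilibrium (hlam : 0 < lam) : Integrable (equilibrium lam) := by
  have h : IntegrableOn (equilibrium lam) (Set.Ioi 0) := by
    refine IntegrableOn.congr_fun ?_ (fun v hv => (equilibrium_comp_rpow hv).symm) measurableSet_Ioi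
    exact ((integrableOn_Ioi_comp_rpow_iff _ (by norm_num)).2 (integrableOn_gamma hlam)).const_mul _
  refine (integrableOn_iff_integrable_of_support_subset fun v hv => ?_).1 h
  by_contra hv'
  exact hv (equilibrium_of_nonpos (not_lt.1 hv'))

theorem integral_equilibrium (hlam : 0 < lam) : ∫ v, equilibrium lam v = 1 := by
  rw [← setIntegral_eq_integral_of_forall_compl_eq_zero (s := Set.Ioi 0)
    (fun v hv => equilibrium_of_nonpos (not_lt.1 hv)),
    setIntegral_congr_fun measurableSet_Ioi (fun v hv => equilibrium_comp_rpow hv),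
    integral_const_mul, integral_comp_rpow_Ioi (fun u : ℝ => u ^ (1 + 2 / lam - 1) *
      Real.exp (-(2 / lam * u))) (p := -1) (by norm_num),
    Real.integral_rpow_mul_exp_neg_mul_Ioi (by positivity) (by positivity),
    Real.div_rpow one_pos.le (by positivity), Real.one_rpow]
  have h1 : (2 / lam : ℝ) ^ (1 + 2 / lam) ≠ 0 := (Real.rpow_pos_of_pos (by positivity) _).ne'
  have h2 : Real.Gamma (1 + 2 / lam) ≠ 0 := (Real.Gamma_pos_of_pos (by positivity)).ne'
  field_simp

theorem isProbDensity_equilibrium (hlam : 0 < lam) : IsProbDensity (equilibrium lam) where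
  nonneg := equilibrium_nonneg hlam
  eq_zero_of_neg _ hv := equilibrium_of_nonpos hv.le
  integrable := integrable_equilibrium hlam
  integral_eq_one := integral_equilibrium hlam

theorem contDiffAt_equilibrium {v : ℝ} (hv : 0 < v) :
    ContDiffAt ℝ (⊤ : ℕ∞) (equilibrium lam) v := by
  have : ContDiffAt ℝ (⊤ : ℕ∞) (fun v : ℝ => (2 / lam) ^ (1 + 2 / lam) /
      Real.Gamma (1 + 2 / lam) * (Real.exp (-(2 / lam / v)) * v ^ (-(2 / lam) - 2))) v := by
    refine contDiffAt_const.mul (ContDiffAt.mul (ContDiffAt.exp ?_) ?_)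
    · exact (contDiffAt_const.div contDiffAt_id hv.ne').neg
    · exact Real.contDiffAt_rpow_const_of_ne hv.ne'
  refine this.congr_of_eventuallyEq ?_
  filter_upwards [lt_mem_nhds hv] with w hw using equilibrium_of_pos hw

/-- The stationary equation integrated once, with zero flux. Stationarity and uniqueness both use
this first-order identity. -/
theorem hasDerivAt_sq_mul_equilibrium {v : ℝ} (hv : 0 < v) :
    HasDerivAt (fun v => v ^ 2 * equilibrium lam v)
      (-(2 / lam) * ((v - 1) * equilibrium lam v)) v := by
  set K := (2 / lam) ^ (1 + 2 / lam) / Real.Gamma (1 + 2 / lam) with hK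
  have h1 : HasDerivAt (fun v : ℝ => Real.exp (-(2 / lam / v)))
      (Real.exp (-(2 / lam / v)) * (2 / lam / v ^ 2)) v := by
    refine HasDerivAt.exp ?_
    have := ((hasDerivAt_inv hv.ne').const_mul (2 / lam)).neg
    refine (this.congr_of_eventuallyEq (Eventually.of_forall fun w => ?_)).congr_deriv ?_
    · simp [div_eq_mul_inv]
    · ring
  have h2 : HasDerivAt (fun v : ℝ => v ^ (-(2 / lam) : ℝ))
      (-(2 / lam) * v ^ (-(2 / lam) - 1)) v := by
    simpa using Real.hasDerivAt_rpow_const (p := -(2 / lam)) (Or.inl hv.ne')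
  have h3 := (h1.mul h2).const_mul K
  refine (h3.congr_of_eventuallyEq ?_).congr_deriv ?_
  · filter_upwards [lt_mem_nhds hv] with w hw
    have hw : 0 < w := hw
    rw [equilibrium_of_pos hw, Real.rpow_sub hw, Real.rpow_two, ← hK]
    simp only [Pi.mul_apply]
    field_simp
  · rw [equilibrium_of_pos hv, Real.rpow_sub hv, Real.rpow_sub hv, Real.rpow_two, Real.rpow_one,
      ← hK]
    field_simp
    ring

/-- Near the origin `exp (-(2 / lam) / v)` beats every power of `1 / v`; this removes the boundary
term at `0`. -/
theorem tendsto_sq_mul_equilibrium (hlam : 0 < lam) :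
    Tendsto (fun v => v ^ 2 * equilibrium lam v) (𝓝[>] 0) (𝓝 0) := by
  have h := (tendsto_rpow_mul_exp_neg_mul_atTop_nhds_zero (2 / lam) (2 / lam)
    (by positivity)).comp tendsto_inv_nhdsGT_zero
  have h' := h.const_mul ((2 / lam) ^ (1 + 2 / lam) / Real.Gamma (1 + 2 / lam))
  rw [mul_zero] at h'
  refine h'.congr' ?_
  filter_upwards [self_mem_nhdsWithin] with v hv
  have hv : 0 < v := hv
  rw [equilibrium_of_pos hv, Real.rpow_sub hv, Real.rpow_two, Real.rpow_neg hv.le]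
  simp only [Function.comp]
  rw [Real.inv_rpow hv.le, div_eq_mul_inv (2 / lam) v, neg_mul]
  field_simp

theorem fokkerPlanck_equilibrium (hlam : 0 < lam) {φ : ℝ → ℝ} (hφ : ContDiff ℝ (⊤ : ℕ∞) φ)
    (hs : HasCompactSupport φ) : fokkerPlanck lam φ (equilibrium lam) = 0 := by
  have h1 : ContDiff ℝ (⊤ : ℕ∞) (deriv φ) := contDiff_deriv_infty hφ
  have hI : Integrable fun v => fokkerPlanckOp lam φ v * equilibrium lam v := by
    refine integrable_mul_of_bounded (continuous_fokkerPlanckOp (contDiff_infty.1 hφ 2))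
      ?_ (integrable_equilibrium hlam)
    exact (hs.deriv.deriv.mul_left.mul_left).sub hs.deriv.mul_left
  rw [fokkerPlanck_eq_integral hφ hs (integrable_equilibrium hlam),
    ← setIntegral_eq_integral_of_forall_compl_eq_zero (s := Set.Ioi 0)
    (fun v hv => by rw [equilibrium_of_nonpos (not_lt.1 hv), mul_zero])]
  -- By the first-order identity the integrand is the exact derivative of `lam / 2 * v ^ 2 * M *
  -- φ'`, which vanishes at both ends.
  have key := integral_Ioi_of_hasDerivAt_of_tendsto (a := 0) (m := 0)
    (f := fun v => lam / 2 * (v ^ 2 * equilibrium lam v * deriv φ v))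
    (f' := fun v => fokkerPlanckOp lam φ v * equilibrium lam v) ?_ ?_ hI.integrableOn ?_
  · rw [key]; simp
  · rw [← continuousWithinAt_Ioi_iff_Ici, ContinuousWithinAt]
    have := ((tendsto_sq_mul_equilibrium hlam).mul
      (h1.continuous.continuousWithinAt (x := 0) (s := Set.Ioi 0)).tendsto).const_mul (lam / 2)
    simpa using this
  · intro v hv
    have hd : HasDerivAt (deriv φ) (deriv (deriv φ) v) v :=
      (h1.differentiable (by simp)).differentiableAt.hasDerivAt
    refine (((hasDerivAt_sq_mul_equilibrium (lam := lam) hv).mul hd).const_mul _).congr_deriv ?_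
    simp only [fokkerPlanckOp]
    field_simp
    ring
  · refine tendsto_const_nhds.congr' ?_
    have := hs.deriv.isCompact.isBounded.subset_closedBall 0
    obtain ⟨r, hr⟩ := this
    filter_upwards [eventually_gt_atTop r, eventually_gt_atTop 0] with v hv hv0
    have : deriv φ v = 0 := by
      by_contra hne
      have := hr (subset_tsupport _ hne)
      rw [mem_closedBall_zero_iff, Real.norm_eq_abs, abs_of_pos hv0] at this
      linarith
    simp [this]

theorem tendsto_rpow_mul_equilibrium :
    Tendsto (fun v : ℝ => v ^ (1 + paretoExponent lam) * equilibrium lam v) atTop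
      (𝓝 ((paretoExponent lam - 1) ^ paretoExponent lam /
        Real.Gamma (paretoExponent lam))) := by
  have h : Tendsto (fun v : ℝ => (paretoExponent lam - 1) ^ paretoExponent lam /
      Real.Gamma (paretoExponent lam) * Real.exp (-((paretoExponent lam - 1) / v))) atTop
      (𝓝 ((paretoExponent lam - 1) ^ paretoExponent lam /
        Real.Gamma (paretoExponent lam) * Real.exp (-0))) := by
    refine Tendsto.const_mul _ ((Real.continuous_exp.tendsto _).comp (Tendsto.neg ?_))
    exact tendsto_const_nhds.div_atTop tendsto_id
  rw [neg_zero, Real.exp_zero, mul_one] at h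
  refine h.congr' ?_
  filter_upwards [eventually_gt_atTop 0] with v hv
  rw [equilibrium, if_pos hv]
  have : v ^ (1 + paretoExponent lam) ≠ 0 := (Real.rpow_pos_of_pos hv _).ne'
  field_simp

end Equilibrium

/-! ### Uniqueness of the stationary state. -/

section Uniqueness

variable {lam : ℝ} {M : ℝ → ℝ}

theorem IsStationaryState.integral_primitive (hM : IsStationaryState lam M) {χ : ℝ → ℝ}
    (hχ : ContDiff ℝ (⊤ : ℕ∞) χ) {a b : ℝ} (hs : ∀ x, x ∉ Set.Icc a b → χ x = 0)
    (h0 : ∫ x, χ x = 0) :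
    ∫ v, (lam / 2 * (v ^ 2 * deriv χ v) - (v - 1) * χ v) * M v = 0 := by
  obtain ⟨φ, h1, h2, h3⟩ := exists_primitive hχ hs h0
  have hd : deriv φ = χ := funext fun x => (h3 x).deriv
  have := hM.2 φ h1 (hasCompactSupport_of_Icc h2)
  rwa [fokkerPlanck_eq_integral h1 (hasCompactSupport_of_Icc h2) hM.1.integrable,
    show fokkerPlanckOp lam φ = fun v => lam / 2 * (v ^ 2 * deriv χ v) - (v - 1) * χ v by
      rw [← hd]; rfl] at this

/-- Zero-mean `χ` are handled by their primitives. In general one subtracts `c` times a unit bump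
spread over `[n + 1, 3 * (n + 1)]`. Since `v ^ 2 ∂_v` and multiplication by `v` act boundedly on
such rescaled bumps, and the support escapes to infinity, the correction tends to zero by dominated
convergence against the integrable `M`; no moment is needed. -/
theorem IsStationaryState.integral_first_order (hM : IsStationaryState lam M) {χ : ℝ → ℝ}
    (hχ : ContDiff ℝ (⊤ : ℕ∞) χ) {a b : ℝ} (hs : ∀ x, x ∉ Set.Icc a b → χ x = 0) :
    ∫ v, (lam / 2 * (v ^ 2 * deriv χ v) - (v - 1) * χ v) * M v = 0 := by
  -- Centre `2` and radius `1` keep the support inside `[1, 3]`, away from zero, so that each fixed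
  -- `v` eventually leaves the support of the dilated bump.
  let B : ContDiffBump (2 : ℝ) := ⟨1 / 2, 1, by norm_num, by norm_num⟩
  let θ : ℝ → ℝ := B.normed volume
  have hθ : ContDiff ℝ (⊤ : ℕ∞) θ := B.contDiff_normed
  have hθs : ∀ x, x ∉ Set.Icc (1 : ℝ) 3 → θ x = 0 := by
    intro x hx
    by_contra hne
    have : x ∈ Function.support (B.normed volume) := hne
    rw [B.support_normed_eq, Metric.mem_ball, Real.dist_eq] at this
    have h1 : B.rOut = 1 := rfl
    rw [h1] at this
    have := abs_lt.1 this
    exact hx ⟨by linarith, by linarith⟩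
  have hθc : HasCompactSupport θ := hasCompactSupport_of_Icc hθs
  have hθ1 : ∫ x, θ x = 1 := B.integral_normed
  have hθd : Continuous (deriv θ) := (contDiff_deriv_infty hθ).continuous
  set c := ∫ x, χ x with hc
  obtain ⟨C1, hC1, hb1⟩ := bounded_of_hasCompactSupport ((continuous_pow 2).mul hθd)
    hθc.deriv.mul_left
  obtain ⟨C2, hC2, hb2⟩ := bounded_of_hasCompactSupport (continuous_id.mul hθ.continuous)
    hθc.mul_left
  obtain ⟨C3, hC3, hb3⟩ := bounded_of_hasCompactSupport hθ.continuous hθc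
  -- The first-order operator applied to `θ (v / (n + 1)) / (n + 1)`, written in the variable `v /
  -- (n + 1)`.
  let ℓ : ℕ → ℝ → ℝ := fun n v => lam / 2 * ((v / (n + 1)) ^ 2 * deriv θ (v / (n + 1))) -
    (v / (n + 1)) * θ (v / (n + 1)) + 1 / ((n : ℝ) + 1) * θ (v / (n + 1))
  have hℓb : ∀ n v, |ℓ n v| ≤ |lam / 2| * C1 + C2 + C3 := by
    intro n v
    refine (abs_add_le _ _).trans (add_le_add ((abs_sub _ _).trans (add_le_add ?_ (hb2 _))) ?_)
    · rw [abs_mul]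
      exact mul_le_mul_of_nonneg_left (hb1 _) (abs_nonneg _)
    · rw [abs_mul]
      refine (mul_le_of_le_one_left (abs_nonneg _) ?_).trans (hb3 _)
      rw [abs_of_nonneg (by positivity)]
      exact (div_le_one (by positivity)).2 (by linarith [n.cast_nonneg (α := ℝ)])
  have hℓc : ∀ n, Continuous (ℓ n) := by
    intro n
    have := hθ.continuous
    fun_prop
  -- The left-hand side does not depend on `n`, so it equals the limit of the right-hand side.
  have key : ∀ n : ℕ, ∫ v, (lam / 2 * (v ^ 2 * deriv χ v) - (v - 1) * χ v) * M v =
      c * ∫ v, ℓ n v * M v := by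
    intro n
    have hn : (0 : ℝ) < n + 1 := by positivity
    let χ' : ℝ → ℝ := fun v => χ v - c * (θ (v / (n + 1)) * (1 / (n + 1)))
    have hθn : ContDiff ℝ (⊤ : ℕ∞) (fun v : ℝ => θ (v / (n + 1))) :=
      hθ.comp (contDiff_id.div_const _)
    have hsm : ContDiff ℝ (⊤ : ℕ∞) χ' := hχ.sub (contDiff_const.mul (hθn.mul contDiff_const))
    have hsθ : ∀ x, x ∉ Set.Icc ((n : ℝ) + 1) (3 * (n + 1)) → θ (x / (n + 1)) = 0 := by
      intro x hx
      refine hθs _ fun h => hx ⟨?_, ?_⟩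
      · simpa using (le_div_iff₀ hn).1 h.1
      · exact (div_le_iff₀ hn).1 h.2
    have hi1 : Integrable χ := hχ.continuous.integrable_of_hasCompactSupport
      (hasCompactSupport_of_Icc hs)
    have hi2 : Integrable fun x : ℝ => c * (θ (x / (n + 1)) * (1 / (n + 1))) := by
      refine ((hθn.continuous.integrable_of_hasCompactSupport
        (hasCompactSupport_of_Icc hsθ)).mul_const _).const_mul _
    have h0 := hM.integral_primitive hsm (a := min a (n + 1)) (b := max b (3 * (n + 1)))
      (fun x hx => ?_) ?_
    · have hi3 : Integrable fun v => (lam / 2 * (v ^ 2 * deriv χ v) - (v - 1) * χ v) * M v := by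
        have h1 := (contDiff_deriv_infty hχ).continuous
        have h2 := hχ.continuous
        refine integrable_mul_of_bounded (by fun_prop) ?_ hM.1.integrable
        have h3 : HasCompactSupport χ := hasCompactSupport_of_Icc hs
        exact (h3.deriv.mul_left.mul_left).sub h3.mul_left
      have hi4 : Integrable fun v => ℓ n v * M v :=
        hM.1.integrable.bdd_mul (hℓc n).aestronglyMeasurable (Eventually.of_forall (hℓb n))
      rw [← integral_const_mul, ← sub_eq_zero, ← integral_sub hi3 (hi4.const_mul _), ← h0]
      refine integral_congr_ae (Eventually.of_forall fun v => ?_)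
      have hd : deriv χ' v = deriv χ v - c * (deriv θ (v / (n + 1)) * (1 / (n + 1)) * (1 / (n + 1))) := by
        have d1 : HasDerivAt χ (deriv χ v) v :=
          (hχ.differentiable (by simp)).differentiableAt.hasDerivAt
        have d2 : HasDerivAt θ (deriv θ (v / (n + 1))) (v / (n + 1)) :=
          (hθ.differentiable (by simp)).differentiableAt.hasDerivAt
        exact (d1.sub (((d2.comp v ((hasDerivAt_id v).div_const _)).mul_const _).const_mul _)).deriv
      simp only [hd, χ', ℓ]
      field_simp
      ring
    · have h1 : χ x = 0 := hs x fun h => hx ⟨(min_le_left _ _).trans h.1, h.2.trans (le_max_left _ _)⟩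
      have h2 : θ (x / (n + 1)) = 0 :=
        hsθ x fun h => hx ⟨(min_le_right _ _).trans h.1, h.2.trans (le_max_right _ _)⟩
      simp [χ', h1, h2]
    · simp only [χ']
      rw [integral_sub hi1 hi2, integral_const_mul, integral_mul_const,
        Measure.integral_comp_div (fun x => θ x), hθ1, abs_of_pos hn, ← hc, smul_eq_mul]
      field_simp
      ring
  have hlim : Tendsto (fun n => ∫ v, ℓ n v * M v) atTop (𝓝 (∫ _ : ℝ, (0 : ℝ))) := by
    refine tendsto_integral_of_dominated_convergence
      (fun v => (|lam / 2| * C1 + C2 + C3) * M v) ?_ (hM.1.integrable.const_mul _) ?_ ?_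
    · intro n
      exact (hℓc n).aestronglyMeasurable.mul hM.1.integrable.aestronglyMeasurable
    · intro n
      refine Eventually.of_forall fun v => ?_
      rw [norm_mul, Real.norm_eq_abs, Real.norm_eq_abs, abs_of_nonneg (hM.1.nonneg v)]
      exact mul_le_mul_of_nonneg_right (hℓb n v) (hM.1.nonneg v)
    · refine Eventually.of_forall fun v => ?_
      have h1 : Tendsto (fun n : ℕ => v / ((n : ℝ) + 1)) atTop (𝓝 0) :=
        tendsto_const_div_atTop_nhds_zero_nat v |>.comp (tendsto_add_atTop_nat 1) |>.congr
          fun n => by simp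
      have hU : Set.Iio (1 : ℝ) ∈ 𝓝 (0 : ℝ) := Iio_mem_nhds one_pos
      refine tendsto_const_nhds.congr' ?_
      filter_upwards [h1.eventually hU] with n hn
      have e1 : θ (v / (n + 1)) = 0 := hθs _ fun h => absurd hn (not_lt.2 h.1)
      have e2 : deriv θ (v / (n + 1)) = 0 := by
        have : θ =ᶠ[𝓝 (v / ((n : ℝ) + 1))] fun _ => 0 := by
          filter_upwards [Iio_mem_nhds hn] with w hw using hθs _ fun h => absurd hw (not_lt.2 h.1)
        rw [this.deriv_eq, deriv_const]
      simp [ℓ, e1, e2]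
  have hlim' := hlim.const_mul c
  simp only [← key, integral_zero, mul_zero] at hlim'
  exact tendsto_nhds_unique tendsto_const_nhds hlim'

theorem exists_Icc_of_tsupport_subset_Ioi {ψ : ℝ → ℝ} (hs : HasCompactSupport ψ)
    (hp : tsupport ψ ⊆ Set.Ioi 0) :
    ∃ a b : ℝ, 0 < a ∧ ∀ x, x ∉ Set.Icc a b → ψ x = 0 := by
  rcases (tsupport ψ).eq_empty_or_nonempty with h | h
  · exact ⟨1, 1, one_pos, fun x _ => image_eq_zero_of_notMem_tsupport (by simp [h])⟩
  · obtain ⟨a, ha, hal⟩ := hs.isCompact.exists_isLeast h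
    obtain ⟨b, hb, hbl⟩ := hs.isCompact.exists_isGreatest h
    exact ⟨a, b, hp ha, fun x hx => image_eq_zero_of_notMem_tsupport
      fun hx' => hx ⟨hal hx', hbl hx'⟩⟩

theorem contDiff_of_contDiffAt_pos {g : ℝ → ℝ} {a : ℝ} (ha : 0 < a)
    (h0 : ∀ x, x < a → g x = 0) (h : ∀ x, 0 < x → ContDiffAt ℝ (⊤ : ℕ∞) g x) :
    ContDiff ℝ (⊤ : ℕ∞) g := by
  rw [contDiff_iff_contDiffAt]
  intro x
  rcases lt_or_ge 0 x with hx | hx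
  · exact h x hx
  · refine (contDiffAt_const (c := (0 : ℝ))).congr_of_eventuallyEq ?_
    filter_upwards [Iio_mem_nhds (hx.trans_lt ha)] with y hy using h0 y hy

/-- A Fredholm alternative in dimension one: the first-order adjoint equation with right-hand side
`ψ` has a compactly supported solution as soon as `ψ` is orthogonal to the equilibrium. -/
theorem IsStationaryState.integral_of_orthogonal (hlam : 0 < lam) (hM : IsStationaryState lam M)
    {ψ : ℝ → ℝ} (hψ : ContDiff ℝ (⊤ : ℕ∞) ψ) {a b : ℝ} (ha : 0 < a)
    (hs : ∀ x, x ∉ Set.Icc a b → ψ x = 0) (h0 : ∫ v, ψ v * equilibrium lam v = 0) :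
    ∫ v, ψ v * M v = 0 := by
  have hW : ContDiff ℝ (⊤ : ℕ∞) fun v => ψ v * equilibrium lam v :=
    contDiff_of_contDiffAt_pos ha (fun x hx => by
        rw [hs x fun h => absurd hx (not_lt.2 h.1), zero_mul])
      fun x hx => hψ.contDiffAt.mul (contDiffAt_equilibrium hx)
  obtain ⟨P, hP1, hP2, hP3⟩ := exists_primitive hW (a := a) (b := b)
    (fun x hx => by rw [hs x hx, zero_mul]) h0
  -- Variation of constants: `v ^ 2 * equilibrium` is an integrating factor, and `P` is compactly
  -- supported thanks to `h0`.
  let χ : ℝ → ℝ := fun v => 2 / lam * (P v / (v ^ 2 * equilibrium lam v))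
  have hχ0 : ∀ x, x ∉ Set.Icc a b → χ x = 0 := fun x hx => by simp [χ, hP2 x hx]
  have hχ : ContDiff ℝ (⊤ : ℕ∞) χ :=
    contDiff_of_contDiffAt_pos ha (fun x hx => hχ0 x fun h => absurd hx (not_lt.2 h.1))
      fun x hx => contDiffAt_const.mul (hP1.contDiffAt.div
        ((contDiffAt_id.pow 2).mul (contDiffAt_equilibrium hx))
        (mul_pos (pow_pos hx 2) (equilibrium_pos hlam hx)).ne')
  rw [← hM.integral_first_order hχ hχ0]
  refine integral_congr_ae (Eventually.of_forall fun v => ?_)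
  simp only
  congr 1
  by_cases hv : 0 < v
  · have hE := equilibrium_pos hlam hv
    have hd := ((hP3 v).div (hasDerivAt_sq_mul_equilibrium (lam := lam) hv)
      (mul_pos (pow_pos hv 2) hE).ne').const_mul (2 / lam)
    have hd' : deriv χ v = _ := hd.deriv
    rw [hd']
    simp only [χ]
    field_simp
    ring
  · have hv' : v < a := (not_lt.1 hv).trans_lt ha
    have e2 : deriv χ v = 0 := by
      have : χ =ᶠ[𝓝 v] fun _ => 0 := by
        filter_upwards [Iio_mem_nhds hv'] with w hw using hχ0 _ fun h => absurd hw (not_lt.2 h.1)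
      rw [this.deriv_eq, deriv_const]
    rw [hs v fun h => absurd hv' (not_lt.2 h.1), hχ0 v fun h => absurd hv' (not_lt.2 h.1), e2]
    simp

/-- As functionals on tests supported in `(0, ∞)`, the kernel of the equilibrium is contained in
that of `M`, so `M` is a multiple `k` of it; both masses being one, `k = 1`. -/
theorem IsStationaryState.ae_eq_equilibrium (hlam : 0 < lam) (hM : IsStationaryState lam M) :
    M =ᵐ[volume] equilibrium lam := by
  have hE := integrable_equilibrium hlam
  -- a test function of integral one against the equilibrium
  obtain ⟨ψ₀, hψ₀, a₀, b₀, ha₀, hs₀, h1⟩ : ∃ ψ₀ : ℝ → ℝ, ContDiff ℝ (⊤ : ℕ∞) ψ₀ ∧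
      ∃ a b : ℝ, 0 < a ∧ (∀ x, x ∉ Set.Icc a b → ψ₀ x = 0) ∧
        ∫ v, ψ₀ v * equilibrium lam v = 1 := by
    by_contra! hcon
    have : ∀ᵐ x ∂volume, x ∈ Set.Ioi (0 : ℝ) → equilibrium lam x = 0 := by
      refine isOpen_Ioi.ae_eq_zero_of_integral_contDiff_smul_eq_zero
        (hE.locallyIntegrable.locallyIntegrableOn _) fun g hg hgs hgp => ?_
      obtain ⟨a, b, ha, hab⟩ := exists_Icc_of_tsupport_subset_Ioi hgs hgp
      simp only [smul_eq_mul]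
      by_contra hne
      refine hcon (fun v => (∫ x, g x * equilibrium lam x)⁻¹ * g v) (contDiff_const.mul hg) a b ha
        (fun x hx => by simp [hab x hx]) ?_
      simp_rw [mul_assoc]
      rw [integral_const_mul, inv_mul_cancel₀ hne]
    have h0 : equilibrium lam =ᵐ[volume] 0 := by
      filter_upwards [this] with x hx
      rcases lt_or_ge 0 x with h | h
      · exact hx h
      · exact equilibrium_of_nonpos h
    have := integral_congr_ae h0
    rw [integral_equilibrium hlam] at this
    simp at this
  set k := ∫ v, ψ₀ v * M v with hk
  have hint : ∀ {N : ℝ → ℝ}, Integrable N → ∀ {g : ℝ → ℝ}, ContDiff ℝ (⊤ : ℕ∞) g → ∀ {a b : ℝ},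
      (∀ x, x ∉ Set.Icc a b → g x = 0) → Integrable fun v => g v * N v :=
    fun hN _ hg _ _ hgs => integrable_mul_of_bounded hg.continuous (hasCompactSupport_of_Icc hgs) hN
  have h2 : ∀ᵐ x ∂volume, x ∈ Set.Ioi (0 : ℝ) → M x - k * equilibrium lam x = 0 := by
    refine isOpen_Ioi.ae_eq_zero_of_integral_contDiff_smul_eq_zero
      ((hM.1.integrable.sub (hE.const_mul k)).locallyIntegrable.locallyIntegrableOn _)
      fun g hg hgs hgp => ?_
    obtain ⟨a, b, ha, hab⟩ := exists_Icc_of_tsupport_subset_Ioi hgs hgp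
    set c := ∫ v, g v * equilibrium lam v with hc
    -- Subtracting the right multiple of `ψ₀` makes an arbitrary `g` orthogonal to the equilibrium.
    have := hM.integral_of_orthogonal hlam (ψ := fun v => g v - c * ψ₀ v)
      (hg.sub (contDiff_const.mul hψ₀)) (a := min a a₀) (b := max b b₀) (lt_min ha ha₀)
      (fun x hx => by
        rw [hab x fun h => hx ⟨(min_le_left _ _).trans h.1, h.2.trans (le_max_left _ _)⟩,
          hs₀ x fun h => hx ⟨(min_le_right _ _).trans h.1, h.2.trans (le_max_right _ _)⟩]
        simp) ?_
    · simp only [sub_mul, mul_assoc] at this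
      rw [integral_sub (hint hM.1.integrable hg hab)
        ((hint hM.1.integrable hψ₀ hs₀).const_mul c), integral_const_mul, ← hk] at this
      simp only [smul_eq_mul, mul_sub]
      have e : ∀ v, g v * (k * equilibrium lam v) = k * (g v * equilibrium lam v) :=
        fun v => by ring
      simp only [e]
      rw [integral_sub (hint hM.1.integrable hg hab) ((hint hE hg hab).const_mul k),
        integral_const_mul, ← hc, mul_comm k, this]
    · simp only [sub_mul, mul_assoc]
      rw [integral_sub (hint hE hg hab) ((hint hE hψ₀ hs₀).const_mul c), integral_const_mul, h1,
        mul_one, ← hc, sub_self]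
  have hne : ∀ᵐ x : ℝ ∂volume, x ≠ 0 := by simp [ae_iff, measure_singleton]
  have h3 : M =ᵐ[volume] fun x => k * equilibrium lam x := by
    filter_upwards [h2, hne] with x hx hx0
    rcases lt_trichotomy x 0 with h | h | h
    · rw [hM.1.eq_zero_of_neg x h, equilibrium_of_nonpos h.le, mul_zero]
    · exact absurd h hx0
    · exact sub_eq_zero.1 (hx h)
  have hk1 : k = 1 := by
    have := integral_congr_ae h3
    rwa [integral_const_mul, integral_equilibrium hlam, hM.1.integral_eq_one, mul_one, eq_comm]
      at this
  simpa [hk1] using h3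

end Uniqueness

/-! ### Wealth laws and functions of polynomial growth. -/

/-- A probability measure on `[0, ∞)` with finite moment of order `α`. -/
structure IsWealthLaw (α : ℝ) (ν : Measure ℝ) : Prop where
  prob : IsProbabilityMeasure ν
  supp : ν (Set.Iio 0) = 0
  moment : Integrable (fun v => |v| ^ α) ν

/-- The measure with density `f`. -/
noncomputable def densityMeasure (f : ℝ → ℝ) : Measure ℝ :=
  volume.withDensity fun v => ENNReal.ofReal (f v)

/-- Polynomial growth of order `α`. -/
def HasGrowth (α : ℝ) (φ : ℝ → ℝ) : Prop := ∃ C : ℝ, ∀ v : ℝ, |φ v| ≤ C * (1 + |v| ^ α)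

section Growth

variable {α : ℝ}

theorem one_add_rpow_pos (v : ℝ) : 0 < 1 + |v| ^ α := by positivity

theorem HasGrowth.exists_nonneg {φ : ℝ → ℝ} (h : HasGrowth α φ) :
    ∃ C : ℝ, 0 ≤ C ∧ ∀ v : ℝ, |φ v| ≤ C * (1 + |v| ^ α) := by
  obtain ⟨C, hC⟩ := h
  refine ⟨|C|, abs_nonneg _, fun v => (hC v).trans ?_⟩
  exact mul_le_mul_of_nonneg_right (le_abs_self _) (one_add_rpow_pos v).le

theorem HasGrowth.add {φ ψ : ℝ → ℝ} (h : HasGrowth α φ) (h' : HasGrowth α ψ) :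
    HasGrowth α fun v => φ v + ψ v := by
  obtain ⟨C, hC⟩ := h
  obtain ⟨C', hC'⟩ := h'
  refine ⟨C + C', fun v => (abs_add_le _ _).trans ?_⟩
  rw [add_mul]
  exact add_le_add (hC v) (hC' v)

theorem HasGrowth.const_mul {φ : ℝ → ℝ} (h : HasGrowth α φ) (c : ℝ) :
    HasGrowth α fun v => c * φ v := by
  obtain ⟨C, hC⟩ := h
  refine ⟨|c| * C, fun v => ?_⟩
  rw [abs_mul, mul_assoc]
  exact mul_le_mul_of_nonneg_left (hC v) (abs_nonneg _)

theorem HasGrowth.sub {φ ψ : ℝ → ℝ} (h : HasGrowth α φ) (h' : HasGrowth α ψ) :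
    HasGrowth α fun v => φ v - ψ v := by
  have := h.add (h'.const_mul (-1))
  simpa [sub_eq_add_neg] using this

theorem HasGrowth.of_bounded {φ : ℝ → ℝ} {C : ℝ} (h : ∀ v, |φ v| ≤ C) : HasGrowth α φ := by
  refine ⟨C, fun v => (h v).trans ?_⟩
  have hC : 0 ≤ C := (abs_nonneg _).trans (h 0)
  exact le_mul_of_one_le_right hC (by have : 0 ≤ |v| ^ α := by positivity
                                      linarith)

theorem HasGrowth.of_hasCompactSupport {φ : ℝ → ℝ} (h : Continuous φ) (hs : HasCompactSupport φ) :
    HasGrowth α φ := by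
  obtain ⟨C, -, hC⟩ := bounded_of_hasCompactSupport h hs
  exact .of_bounded hC

theorem rpow_le_one_add_rpow {x s : ℝ} (hx : 0 ≤ x) (hs : 0 ≤ s) (h : s ≤ α) :
    x ^ s ≤ 1 + x ^ α := by
  rcases le_total x 1 with h1 | h1
  · have := Real.rpow_le_one hx h1 hs
    have : 0 ≤ x ^ α := by positivity
    linarith
  · have := Real.rpow_le_rpow_of_exponent_le h1 h
    linarith

theorem HasGrowth.id (hα : 1 ≤ α) : HasGrowth α fun v => v := by
  refine ⟨1, fun v => ?_⟩
  have := rpow_le_one_add_rpow (abs_nonneg v) zero_le_one hα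
  rw [Real.rpow_one] at this
  linarith

theorem HasGrowth.mono {φ : ℝ → ℝ} {s : ℝ} (hs : 0 ≤ s) (h : s ≤ α) (hφ : HasGrowth s φ) :
    HasGrowth α φ := by
  obtain ⟨C, hC0, hC⟩ := hφ.exists_nonneg
  refine ⟨2 * C, fun v => (hC v).trans ?_⟩
  have := rpow_le_one_add_rpow (abs_nonneg v) hs h
  have h0 : 0 ≤ |v| ^ α := by positivity
  nlinarith

theorem IsWealthLaw.ae_nonneg {ν : Measure ℝ} (h : IsWealthLaw α ν) : ∀ᵐ v ∂ν, 0 ≤ v := by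
  rw [ae_iff]
  convert h.supp using 2
  ext v
  simp

theorem IsWealthLaw.integrable_weight {ν : Measure ℝ} (h : IsWealthLaw α ν) :
    Integrable (fun v => 1 + |v| ^ α) ν :=
  have := h.prob
  (integrable_const _).add h.moment

theorem IsWealthLaw.integrable_of_aestronglyMeasurable {ν : Measure ℝ} (h : IsWealthLaw α ν)
    {φ : ℝ → ℝ} (hφ : AEStronglyMeasurable φ ν) (hg : HasGrowth α φ) : Integrable φ ν := by
  obtain ⟨C, hC⟩ := hg
  exact (h.integrable_weight.const_mul C).mono' hφ (Eventually.of_forall hC)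

theorem IsWealthLaw.integrable {ν : Measure ℝ} (h : IsWealthLaw α ν) {φ : ℝ → ℝ}
    (hφ : Continuous φ) (hg : HasGrowth α φ) : Integrable φ ν :=
  h.integrable_of_aestronglyMeasurable hφ.aestronglyMeasurable hg

theorem SmoothTest.continuous {φ : ℝ → ℝ} (h : SmoothTest α φ) : Continuous φ := h.1.continuous

theorem SmoothTest.hasGrowth {φ : ℝ → ℝ} (h : SmoothTest α φ) : HasGrowth α φ := h.2

/-- Bounding the sum by twice the maximum avoids convexity, so that exponents below one are allowed.
-/
theorem add_rpow_le_two_rpow {x y s : ℝ} (hx : 0 ≤ x) (hy : 0 ≤ y) (hs : 0 ≤ s) :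
    (x + y) ^ s ≤ 2 ^ s * (x ^ s + y ^ s) := by
  have h1 : x + y ≤ 2 * max x y := by
    linarith [le_max_left x y, le_max_right x y]
  have h2 : max x y ^ s ≤ x ^ s + y ^ s := by
    have := Real.rpow_nonneg hx s
    have := Real.rpow_nonneg hy s
    rcases max_cases x y with ⟨h, -⟩ | ⟨h, -⟩ <;> rw [h] <;> linarith
  calc (x + y) ^ s ≤ (2 * max x y) ^ s := Real.rpow_le_rpow (add_nonneg hx hy) h1 hs
    _ = 2 ^ s * max x y ^ s := Real.mul_rpow (by norm_num) (le_max_of_le_left hx)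
    _ ≤ _ := mul_le_mul_of_nonneg_left h2 (by positivity)

/-- The growth weight of a trade is controlled by the growth weights of the two agents. -/
theorem exists_weight_trade_le (hα : 0 ≤ α) (p q : ℝ) :
    ∃ K : ℝ, 0 ≤ K ∧ ∀ v w : ℝ,
      1 + |p * v + q * w| ^ α ≤ K * ((1 + |v| ^ α) + (1 + |w| ^ α)) := by
  refine ⟨1 + 2 ^ α * (|p| ^ α + |q| ^ α), by positivity, fun v w => ?_⟩
  have h1 : |p * v + q * w| ^ α ≤ 2 ^ α * (|p| ^ α * |v| ^ α + |q| ^ α * |w| ^ α) := by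
    calc |p * v + q * w| ^ α ≤ (|p * v| + |q * w|) ^ α :=
          Real.rpow_le_rpow (abs_nonneg _) (abs_add_le _ _) hα
      _ ≤ _ := add_rpow_le_two_rpow (abs_nonneg _) (abs_nonneg _) hα
      _ = _ := by rw [abs_mul, abs_mul, Real.mul_rpow (abs_nonneg _) (abs_nonneg _),
        Real.mul_rpow (abs_nonneg _) (abs_nonneg _)]
  have hv : 0 ≤ |v| ^ α := by positivity
  have hw : 0 ≤ |w| ^ α := by positivity
  have hp : 0 ≤ (2 : ℝ) ^ α * |p| ^ α := by positivity
  have hq : 0 ≤ (2 : ℝ) ^ α * |q| ^ α := by positivity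
  nlinarith [mul_nonneg hp hw, mul_nonneg hq hv]

theorem IsWealthLaw.integrable_prod {μ ν : Measure ℝ} (hμ : IsWealthLaw α μ)
    (hν : IsWealthLaw α ν) {Φ : ℝ × ℝ → ℝ} (hc : Continuous Φ) {C : ℝ}
    (hb : ∀ z, |Φ z| ≤ C * ((1 + |z.1| ^ α) + (1 + |z.2| ^ α))) : Integrable Φ (μ.prod ν) := by
  have := hμ.prob
  have := hν.prob
  refine Integrable.mono' (g := fun z : ℝ × ℝ => C * ((1 + |z.1| ^ α) + (1 + |z.2| ^ α))) ?_
    hc.aestronglyMeasurable (Eventually.of_forall hb)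
  exact ((hμ.integrable_weight.comp_fst ν).add (hν.integrable_weight.comp_snd μ)).const_mul C

theorem HasGrowth.trade (hα : 0 ≤ α) {φ : ℝ → ℝ} (h : HasGrowth α φ) (p q : ℝ) :
    ∃ C : ℝ, 0 ≤ C ∧ ∀ v w : ℝ,
      |φ (p * v + q * w)| ≤ C * ((1 + |v| ^ α) + (1 + |w| ^ α)) := by
  obtain ⟨C, hC0, hC⟩ := h.exists_nonneg
  obtain ⟨K, hK0, hK⟩ := exists_weight_trade_le hα p q
  refine ⟨C * K, by positivity, fun v w => (hC _).trans ?_⟩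
  rw [mul_assoc]
  exact mul_le_mul_of_nonneg_left (hK v w) hC0

theorem IsWealthLaw.integrable_trade (hα : 0 ≤ α) {μ ν : Measure ℝ} (hμ : IsWealthLaw α μ)
    (hν : IsWealthLaw α ν) {φ : ℝ → ℝ} (hc : Continuous φ) (hg : HasGrowth α φ) (p q : ℝ) :
    Integrable (fun z : ℝ × ℝ => φ (p * z.1 + q * z.2)) (μ.prod ν) := by
  obtain ⟨C, -, hC⟩ := hg.trade hα p q
  exact hμ.integrable_prod hν (by fun_prop) fun z => hC z.1 z.2

theorem IsWealthLaw.integrable_comp_fst {μ ν : Measure ℝ} (hμ : IsWealthLaw α μ)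
    (hν : IsWealthLaw α ν) {φ : ℝ → ℝ} (hc : Continuous φ) (hg : HasGrowth α φ) :
    Integrable (fun z : ℝ × ℝ => φ z.1) (μ.prod ν) :=
  have := hν.prob
  (hμ.integrable hc hg).comp_fst ν

theorem IsWealthLaw.integral_fst {μ ν : Measure ℝ} [SFinite μ] (hν : IsWealthLaw α ν) (φ : ℝ → ℝ) :
    ∫ z, φ z.1 ∂(μ.prod ν) = ∫ v, φ v ∂μ := by
  have := hν.prob
  rw [integral_fun_fst]
  simp

theorem IsWealthLaw.integral_snd {μ ν : Measure ℝ} [SFinite ν] (hμ : IsWealthLaw α μ) (φ : ℝ → ℝ) :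
    ∫ z, φ z.2 ∂(μ.prod ν) = ∫ v, φ v ∂ν := by
  have := hμ.prob
  rw [integral_fun_snd]
  simp

end Growth

/-! ### Passing between densities and measures. -/

section Density

variable {α : ℝ} {f : ℝ → ℝ}

theorem integral_densityMeasure (hf : Integrable f) (h0 : ∀ v, 0 ≤ f v) (φ : ℝ → ℝ) :
    ∫ v, φ v ∂(densityMeasure f) = ∫ v, φ v * f v := by
  rw [densityMeasure, integral_withDensity_eq_integral_toReal_smul₀
    hf.aestronglyMeasurable.aemeasurable.ennreal_ofReal
    (Eventually.of_forall fun v => ENNReal.ofReal_lt_top)]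
  refine integral_congr_ae (Eventually.of_forall fun v => ?_)
  simp [ENNReal.toReal_ofReal (h0 v), mul_comm]

theorem integrable_densityMeasure_iff (hf : Integrable f) (h0 : ∀ v, 0 ≤ f v) {φ : ℝ → ℝ} :
    Integrable φ (densityMeasure f) ↔ Integrable fun v => φ v * f v := by
  rw [densityMeasure, integrable_withDensity_iff_integrable_smul₀'
    hf.aestronglyMeasurable.aemeasurable.ennreal_ofReal
    (Eventually.of_forall fun v => ENNReal.ofReal_lt_top)]
  refine integrable_congr (Eventually.of_forall fun v => ?_)
  simp [ENNReal.toReal_ofReal (h0 v), mul_comm]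

theorem IsDensityWithMoment.isWealthLaw (hf : IsDensityWithMoment α f) :
    IsWealthLaw α (densityMeasure f) where
  prob := by
    refine ⟨?_⟩
    rw [densityMeasure, withDensity_apply _ MeasurableSet.univ, Measure.restrict_univ,
      ← ofReal_integral_eq_lintegral_ofReal hf.integrable (Eventually.of_forall hf.nonneg),
      hf.integral_eq_one, ENNReal.ofReal_one]
  supp := by
    rw [densityMeasure, withDensity_apply _ measurableSet_Iio,
      setLIntegral_congr_fun (g := fun _ => 0) measurableSet_Iio, lintegral_zero]
    intro v hv
    simp [hf.eq_zero_of_neg v hv]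
  moment := (integrable_densityMeasure_iff hf.integrable hf.nonneg).2 hf.moment

theorem collision_eq_integral_prod (hf : IsDensityWithMoment α f) (p q : ℝ) (φ : ℝ → ℝ) :
    collision p q φ f = ∫ z : ℝ × ℝ, (φ (p * z.1 + q * z.2) - φ z.1)
      ∂((densityMeasure f).prod (densityMeasure f)) := by
  have hm := hf.integrable.aestronglyMeasurable.aemeasurable.ennreal_ofReal
  have : SFinite (volume.withDensity fun v => ENNReal.ofReal (f v)) := inferInstance
  rw [densityMeasure, prod_withDensity₀ hm hm, integral_withDensity_eq_integral_toReal_smul₀]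
  · rw [collision, Measure.volume_eq_prod]
    refine integral_congr_ae (Eventually.of_forall fun z => ?_)
    simp [ENNReal.toReal_mul, ENNReal.toReal_ofReal (hf.nonneg _)]
  · exact (hm.comp_quasiMeasurePreserving Measure.quasiMeasurePreserving_fst).mul
      (hm.comp_quasiMeasurePreserving Measure.quasiMeasurePreserving_snd)
  · exact Eventually.of_forall fun z =>
      ENNReal.mul_lt_top ENNReal.ofReal_lt_top ENNReal.ofReal_lt_top

theorem IsWealthLaw.exists_density {ν : Measure ℝ} (h : IsWealthLaw α ν) (hac : ν ≪ volume) :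
    ∃ f, IsDensityWithMoment α f ∧ densityMeasure f = ν := by
  have := h.prob
  -- The Radon-Nikodym derivative is determined only almost everywhere, whereas a density must
  -- vanish at every negative point; hence the explicit truncation.
  let f : ℝ → ℝ := fun v => if v < 0 then 0 else (ν.rnDeriv volume v).toReal
  have h0 : ∀ v, 0 ≤ f v := fun v => by
    simp only [f]
    split_ifs
    exacts [le_rfl, ENNReal.toReal_nonneg]
  have hneg : ∀ᵐ v ∂volume, v < 0 → ν.rnDeriv volume v = 0 := by
    have h1 : ∫⁻ v in Set.Iio 0, ν.rnDeriv volume v = 0 := by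
      rw [Measure.setLIntegral_rnDeriv hac, h.supp]
    rw [lintegral_eq_zero_iff (Measure.measurable_rnDeriv _ _)] at h1
    exact (ae_restrict_iff' measurableSet_Iio).1 h1
  have hae : (fun v => ENNReal.ofReal (f v)) =ᵐ[volume] ν.rnDeriv volume := by
    filter_upwards [hneg, Measure.rnDeriv_lt_top ν volume] with v hv hv'
    simp only [f]
    split_ifs with hlt
    · rw [hv hlt, ENNReal.ofReal_zero]
    · exact ENNReal.ofReal_toReal hv'.ne
  have hν : densityMeasure f = ν := by
    rw [densityMeasure, withDensity_congr_ae hae, Measure.withDensity_rnDeriv_eq _ _ hac]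
  have hmeas : Measurable f :=
    Measurable.ite measurableSet_Iio measurable_const (Measure.measurable_rnDeriv _ _).ennreal_toReal
  have hlint : ∫⁻ v, ENNReal.ofReal (f v) = 1 := by
    have : densityMeasure f Set.univ = 1 := by rw [hν]; exact measure_univ
    rwa [densityMeasure, withDensity_apply _ MeasurableSet.univ, Measure.restrict_univ] at this
  have hint : Integrable f := by
    refine ⟨hmeas.aestronglyMeasurable, ?_⟩
    rw [hasFiniteIntegral_iff_ofReal (Eventually.of_forall h0), hlint]
    exact ENNReal.one_lt_top
  refine ⟨f, ⟨⟨h0, fun v hv => if_pos hv, hint, ?_⟩, ?_⟩, hν⟩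
  · rw [integral_eq_lintegral_of_nonneg_ae (Eventually.of_forall h0) hmeas.aestronglyMeasurable,
      hlint, ENNReal.toReal_one]
  · rw [← integrable_densityMeasure_iff hint h0, hν]
    exact h.moment

end Density

/-! ### The kinetic equation for measures. -/

/-- The measure-valued form of the kinetic wealth model. -/
structure IsBoltzmannFlow (p q α : ℝ) (ν₀ : Measure ℝ) (ν : ℝ → Measure ℝ) : Prop where
  law : ∀ t, 0 < t → IsWealthLaw α (ν t)
  hasDerivAt : ∀ φ, SmoothTest α φ → ∀ t, 0 < t →
    HasDerivAt (fun t => ∫ v, φ v ∂(ν t))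
      (∫ z : ℝ × ℝ, (φ (p * z.1 + q * z.2) - φ z.1) ∂((ν t).prod (ν t))) t
  initial : ∀ φ, SmoothTest α φ →
    Tendsto (fun t => ∫ v, φ v ∂(ν t)) (𝓝[>] 0) (𝓝 (∫ v, φ v ∂ν₀))

theorem IsBoltzmannSolution.isBoltzmannFlow {p q α : ℝ} {f₀ : ℝ → ℝ} {f : ℝ → ℝ → ℝ}
    (hf₀ : IsDensityWithMoment α f₀) (h : IsBoltzmannSolution p q α f₀ f) :
    IsBoltzmannFlow p q α (densityMeasure f₀) fun t => densityMeasure (f t) where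
  law t ht := (h.density t ht).isWealthLaw
  hasDerivAt φ hφ t ht := by
    rw [← collision_eq_integral_prod (h.density t ht)]
    refine (h.hasDerivAt φ hφ t ht).congr_of_eventuallyEq ?_
    filter_upwards [lt_mem_nhds ht] with s hs
    exact integral_densityMeasure (h.density s hs).integrable (h.density s hs).nonneg φ
  initial φ hφ := by
    rw [integral_densityMeasure hf₀.integrable hf₀.nonneg]
    refine (h.initial φ hφ).congr' ?_
    filter_upwards [self_mem_nhdsWithin] with s hs
    exact (integral_densityMeasure (h.density s hs).integrable (h.density s hs).nonneg φ).symm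

/-! ### Power series converging on the unit interval. -/

section PowerSeries

/-- The power series with coefficients `c` converges absolutely on the open unit interval. -/
def SummableOnUnit (c : ℕ → ℝ) : Prop := ∀ r : ℝ, 0 ≤ r → r < 1 → Summable fun n => |c n| * r ^ n

theorem SummableOnUnit.of_abs_le {c d : ℕ → ℝ} (h : SummableOnUnit c) {C : ℝ}
    (hd : ∀ n, |d n| ≤ C * |c n|) : SummableOnUnit d := by
  intro r h0 h1
  refine ((h r h0 h1).mul_left C).of_nonneg_of_le (fun n => by positivity) fun n => ?_
  rw [← mul_assoc]
  exact mul_le_mul_of_nonneg_right (hd n) (by positivity)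

theorem SummableOnUnit.summable {c : ℕ → ℝ} (h : SummableOnUnit c) {x : ℝ} (hx : |x| < 1) :
    Summable fun n => c n * x ^ n := by
  refine Summable.of_norm ((h |x| (abs_nonneg _) hx).congr fun n => ?_)
  rw [norm_mul, norm_pow, Real.norm_eq_abs, Real.norm_eq_abs]

/-- For `r < s < 1` the terms at `s` are bounded, so the differentiated terms at `r` are at most a
constant times `(n + 1) * (r / s) ^ n`. -/
theorem SummableOnUnit.deriv {c : ℕ → ℝ} (h : SummableOnUnit c) :
    SummableOnUnit fun n => ((n : ℝ) + 1) * c (n + 1) := by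
  intro r h0 h1
  obtain ⟨s, hrs, hs1⟩ := exists_between h1
  have hs0 : 0 < s := h0.trans_lt hrs
  have hsum := h s hs0.le hs1
  obtain ⟨B, hB⟩ := hsum.tendsto_atTop_zero.bddAbove_range
  have hB' : ∀ n, |c n| * s ^ n ≤ B := fun n => hB ⟨n, rfl⟩
  have hq : |r / s| < 1 := by
    rw [abs_of_nonneg (by positivity)]
    exact (div_lt_one hs0).2 hrs
  have hg := (summable_pow_mul_geometric_of_norm_lt_one (R := ℝ) 1 hq).add
    (summable_pow_mul_geometric_of_norm_lt_one (R := ℝ) 0 hq)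
  refine (hg.mul_left (B / s)).of_nonneg_of_le (fun n => by positivity) fun n => ?_
  have h2 : |c (n + 1)| ≤ B / s ^ (n + 1) := (le_div_iff₀ (by positivity)).2 (hB' _)
  rw [abs_mul, abs_of_nonneg n.cast_add_one_pos.le]
  calc ((n : ℝ) + 1) * |c (n + 1)| * r ^ n ≤ ((n : ℝ) + 1) * (B / s ^ (n + 1)) * r ^ n :=
        mul_le_mul_of_nonneg_right (mul_le_mul_of_nonneg_left h2 (by positivity)) (by positivity)
    _ = B / s * ((n : ℝ) ^ 1 * (r / s) ^ n + (n : ℝ) ^ 0 * (r / s) ^ n) := by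
      rw [pow_succ, div_pow]
      field_simp

theorem SummableOnUnit.hasDerivAt {c : ℕ → ℝ} (h : SummableOnUnit c) {x : ℝ} (hx : |x| < 1) :
    HasDerivAt (fun x => ∑' n, c n * x ^ n) (∑' n : ℕ, ((n : ℝ) + 1) * c (n + 1) * x ^ n) x := by
  obtain ⟨r, hxr, hr1⟩ := exists_between hx
  have hr0 : 0 ≤ r := (abs_nonneg x).trans hxr.le
  have hu : Summable fun n : ℕ => |c n| * (n * r ^ (n - 1)) := by
    rw [← summable_nat_add_iff 1]
    refine (h.deriv r hr0 hr1).congr fun n => ?_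
    rw [abs_mul, abs_of_nonneg (by positivity : (0 : ℝ) ≤ (n : ℝ) + 1), Nat.add_sub_cancel]
    push_cast
    ring
  have key := hasDerivAt_tsum_of_isPreconnected (t := Set.Ioo (-r) r) (y₀ := x) (y := x)
    (g := fun n x => c n * x ^ n) (g' := fun n x => c n * (n * x ^ (n - 1))) hu isOpen_Ioo
    isPreconnected_Ioo (fun n y _ => (hasDerivAt_pow n y).const_mul _) ?_ (abs_lt.1 hxr)
    (h.summable hx) (abs_lt.1 hxr)
  · refine key.congr_deriv ?_
    have hs : Summable fun n : ℕ => c n * (n * x ^ (n - 1)) := by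
      refine Summable.of_norm_bounded hu fun n => ?_
      rw [norm_mul, norm_mul, norm_pow, Real.norm_eq_abs, Real.norm_natCast, Real.norm_eq_abs]
      gcongr
    rw [hs.tsum_eq_zero_add]
    simp only [Nat.cast_zero, zero_mul, mul_zero, zero_add, Nat.add_sub_cancel]
    refine tsum_congr fun n => ?_
    push_cast
    ring
  · intro n y hy
    rw [norm_mul, norm_mul, norm_pow, Real.norm_eq_abs, Real.norm_natCast, Real.norm_eq_abs]
    have : |y| ≤ r := abs_le.2 ⟨hy.1.le, hy.2.le⟩
    gcongr

end PowerSeries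

/-! ### The terms of Wild's expansion. -/

section Wild

open scoped ENNReal

variable {α p q : ℝ} {ν₀ : Measure ℝ}

/-- The law of `p V + q W` for independent `V`, `W`. -/
noncomputable def tradeLaw (p q : ℝ) (μ ν : Measure ℝ) : Measure ℝ :=
  (μ.prod ν).map fun z => p * z.1 + q * z.2

theorem integral_tradeLaw {μ ν : Measure ℝ} {φ : ℝ → ℝ} (hφ : Continuous φ) :
    ∫ v, φ v ∂(tradeLaw p q μ ν) = ∫ z, φ (p * z.1 + q * z.2) ∂(μ.prod ν) :=
  integral_map (by fun_prop) hφ.aestronglyMeasurable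

theorem IsWealthLaw.tradeLaw (hα : 0 ≤ α) (hp : 0 ≤ p) (hq : 0 ≤ q) {μ ν : Measure ℝ}
    (hμ : IsWealthLaw α μ) (hν : IsWealthLaw α ν) : IsWealthLaw α (tradeLaw p q μ ν) where
  prob := by
    have := hμ.prob
    have := hν.prob
    exact Measure.isProbabilityMeasure_map (by fun_prop)
  supp := by
    have := hμ.prob
    have := hν.prob
    rw [WealthModel.tradeLaw, Measure.map_apply (by fun_prop) measurableSet_Iio]
    have h1 : ∀ᵐ z ∂(μ.prod ν), 0 ≤ z.1 :=
      (Measure.quasiMeasurePreserving_fst (μ := μ) (ν := ν)).ae hμ.ae_nonneg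
    have h2 : ∀ᵐ z ∂(μ.prod ν), 0 ≤ z.2 :=
      (Measure.quasiMeasurePreserving_snd (μ := μ) (ν := ν)).ae hν.ae_nonneg
    have h3 : ∀ᵐ z ∂(μ.prod ν), ¬ (p * z.1 + q * z.2 < 0) := by
      filter_upwards [h1, h2] with z hz1 hz2
      exact not_lt.2 (by positivity)
    rw [ae_iff] at h3
    simpa [Set.preimage, Set.Iio] using h3
  moment := by
    have hc : Continuous fun v : ℝ => |v| ^ α := by
      exact continuous_abs.rpow_const fun _ => Or.inr hα
    rw [WealthModel.tradeLaw, integrable_map_measure hc.aestronglyMeasurable (by fun_prop)]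
    exact hμ.integrable_trade hα hν hc ⟨1, fun v => by
      rw [abs_of_nonneg (by positivity)]; linarith⟩ p q

/-- For each frozen `w` the map `v ↦ p * v + q * w` is an affine bijection, which pulls null sets
back to null sets; Fubini does the rest, so only the first law needs a density. -/
theorem tradeLaw_absolutelyContinuous (hp : p ≠ 0) {μ ν : Measure ℝ} [SFinite μ] [SFinite ν]
    (hμ : μ ≪ volume) : tradeLaw p q μ ν ≪ volume := by
  refine Measure.AbsolutelyContinuous.mk fun s hs h0 => ?_
  have hm : Measurable fun z : ℝ × ℝ => p * z.1 + q * z.2 := by fun_prop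
  rw [tradeLaw, Measure.map_apply hm hs, Measure.prod_apply_symm (hm hs)]
  refine (lintegral_congr fun w => ?_).trans lintegral_zero
  refine hμ ?_
  have e : (fun v => (v, w)) ⁻¹' ((fun z : ℝ × ℝ => p * z.1 + q * z.2) ⁻¹' s) =
      (fun v => p * v) ⁻¹' ((fun v => v + q * w) ⁻¹' s) := rfl
  rw [e, Real.volume_preimage_mul_left hp, measure_preimage_add_right, h0, mul_zero]

/-- The coefficients of the Wild sum of the kinetic model. -/
noncomputable def wild (p q : ℝ) (ν₀ : Measure ℝ) : ℕ → Measure ℝ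
  | 0 => ν₀
  | n + 1 => ((n + 1 : ℕ) : ℝ≥0∞)⁻¹ •
      ∑ k : Fin (n + 1), tradeLaw p q (wild p q ν₀ k) (wild p q ν₀ (n - k))
decreasing_by all_goals omega

theorem wild_zero : wild p q ν₀ 0 = ν₀ := by rw [wild]

theorem wild_succ (n : ℕ) : wild p q ν₀ (n + 1) = ((n + 1 : ℕ) : ℝ≥0∞)⁻¹ •
    ∑ ij ∈ Finset.HasAntidiagonal.antidiagonal n, tradeLaw p q (wild p q ν₀ ij.1) (wild p q ν₀ ij.2) := by
  rw [wild, Finset.Nat.sum_antidiagonal_eq_sum_range_succ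
    (fun i j => tradeLaw p q (wild p q ν₀ i) (wild p q ν₀ j)),
    ← Fin.sum_univ_eq_sum_range
      (fun k => tradeLaw p q (wild p q ν₀ k) (wild p q ν₀ (n - k)))]

theorem isWealthLaw_wild (hα : 0 ≤ α) (hp : 0 ≤ p) (hq : 0 ≤ q) (h : IsWealthLaw α ν₀) (n : ℕ) :
    IsWealthLaw α (wild p q ν₀ n) := by
  induction n using Nat.strong_induction_on with
  | _ n ih =>
    cases n with
    | zero => rwa [wild_zero]
    | succ n =>
      have ht : ∀ ij ∈ Finset.HasAntidiagonal.antidiagonal n,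
          IsWealthLaw α (tradeLaw p q (wild p q ν₀ ij.1) (wild p q ν₀ ij.2)) := by
        intro ij hij
        have := Finset.HasAntidiagonal.mem_antidiagonal.1 hij
        exact (ih _ (by omega)).tradeLaw hα hp hq (ih _ (by omega))
      rw [wild_succ]
      refine ⟨⟨?_⟩, ?_, ?_⟩
      · rw [Measure.smul_apply, Measure.finsetSum_apply]
        rw [Finset.sum_congr rfl fun ij hij => (ht ij hij).prob.measure_univ]
        simp only [Finset.sum_const, Finset.Nat.card_antidiagonal, nsmul_eq_mul, mul_one,
          smul_eq_mul]
        exact ENNReal.inv_mul_cancel (by simp) (ENNReal.natCast_ne_top _)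
      · rw [Measure.smul_apply, Measure.finsetSum_apply,
          Finset.sum_congr rfl fun ij hij => (ht ij hij).supp]
        simp
      · refine Integrable.smul_measure (integrable_finsetSum_measure.2 fun ij hij =>
          (ht ij hij).moment) (by simp)

theorem wild_absolutelyContinuous (hα : 0 ≤ α) (hp : 0 < p) (hq : 0 ≤ q) (h : IsWealthLaw α ν₀)
    (hac : ν₀ ≪ volume) (n : ℕ) : wild p q ν₀ n ≪ volume := by
  induction n using Nat.strong_induction_on with
  | _ n ih =>
    cases n with
    | zero => rwa [wild_zero]
    | succ n =>
      rw [wild_succ]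
      refine Measure.AbsolutelyContinuous.mk fun s hs h0 => ?_
      rw [Measure.smul_apply, Measure.finsetSum_apply, Finset.sum_eq_zero, smul_zero]
      intro ij hij
      have := Finset.HasAntidiagonal.mem_antidiagonal.1 hij
      have := (isWealthLaw_wild hα hp.le hq h ij.1).prob
      have := (isWealthLaw_wild hα hp.le hq h ij.2).prob
      exact tradeLaw_absolutelyContinuous hp.ne' (ih _ (by omega)) h0

/-- In terms of generating functions: the derivative of `∑ x ^ n * wild n` is the trade law of that
series with itself. -/
theorem integral_wild_succ (hα : 0 ≤ α) (hp : 0 ≤ p) (hq : 0 ≤ q) (h : IsWealthLaw α ν₀)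
    {φ : ℝ → ℝ} (hφ : Continuous φ) (hg : HasGrowth α φ) (n : ℕ) :
    ((n : ℝ) + 1) * ∫ v, φ v ∂(wild p q ν₀ (n + 1)) = ∑ ij ∈ Finset.HasAntidiagonal.antidiagonal n,
      ∫ z, φ (p * z.1 + q * z.2) ∂((wild p q ν₀ ij.1).prod (wild p q ν₀ ij.2)) := by
  have hw := isWealthLaw_wild hα hp hq h
  rw [wild_succ, integral_smul_measure, integral_finsetSum_measure fun ij _ =>
    ((hw ij.1).tradeLaw hα hp hq (hw ij.2)).integrable hφ hg]
  simp only [integral_tradeLaw hφ, ENNReal.toReal_inv, ENNReal.toReal_natCast, smul_eq_mul]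
  rw [← mul_assoc]
  push_cast
  rw [mul_inv_cancel₀ (by positivity), one_mul]

end Wild

/-! ### Wild's sum and existence of weak solutions. -/

section WildSum

open scoped ENNReal

variable {α p q : ℝ} {ν₀ : Measure ℝ}

theorem summableOnUnit_of_ratio {A : ℕ → ℝ} (hA : ∀ n, 0 < A n) {L : ℝ}
    (h : ∀ n, A (n + 1) = A n * (1 + L / (n + 1))) : SummableOnUnit A := by
  intro r h0 h1
  obtain ⟨s, hrs, hs1⟩ := exists_between h1
  have hs0 : 0 < s := h0.trans_lt hrs
  have hs : Summable fun n => A n * s ^ n := by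
    refine summable_of_ratio_test_tendsto_lt_one hs1
      (Eventually.of_forall fun n => (mul_pos (hA n) (pow_pos hs0 n)).ne') ?_
    have hlim : Tendsto (fun n : ℕ => (1 + L / ((n : ℝ) + 1)) * s) atTop (𝓝 ((1 + 0) * s)) := by
      refine (tendsto_const_nhds.add ?_).mul_const s
      exact (tendsto_const_div_atTop_nhds_zero_nat L).comp (tendsto_add_atTop_nat 1) |>.congr
        fun n => by simp
    rw [add_zero, one_mul] at hlim
    refine hlim.congr fun n => ?_
    have h2 := hA n
    rw [Real.norm_of_nonneg (mul_pos (hA _) (pow_pos hs0 _)).le,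
      Real.norm_of_nonneg (mul_pos (hA _) (pow_pos hs0 _)).le, h n, pow_succ]
    field_simp
  refine hs.of_nonneg_of_le (fun n => by positivity) fun n => ?_
  rw [abs_of_pos (hA n)]
  have := (hA n).le
  gcongr

/-- A trade multiplies the weight by at most `K`, so `(n + 1) * a (n + 1)` is at most `2 * K` times
the partial sum up to `n`. The partial sums are then dominated by the solution `A` of the
corresponding equality, whose ratio tends to one. -/
theorem summableOnUnit_wild_weight (hα : 0 ≤ α) (hp : 0 ≤ p) (hq : 0 ≤ q)
    (h : IsWealthLaw α ν₀) :
    SummableOnUnit fun n => ∫ v, (1 + |v| ^ α) ∂(wild p q ν₀ n) := by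
  have hw := isWealthLaw_wild hα hp hq h
  set a : ℕ → ℝ := fun n => ∫ v, (1 + |v| ^ α) ∂(wild p q ν₀ n) with ha
  have hc : Continuous fun v : ℝ => 1 + |v| ^ α :=
    continuous_const.add (continuous_abs.rpow_const fun _ => Or.inr hα)
  have hg : HasGrowth α fun v : ℝ => 1 + |v| ^ α :=
    ⟨1, fun v => by rw [abs_of_pos (one_add_rpow_pos v), one_mul]⟩
  have ha0 : ∀ n, 0 ≤ a n := fun n => integral_nonneg fun v => (one_add_rpow_pos v).le
  have ha1 : 0 < a 0 := by
    have := (hw 0).prob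
    have : (∫ _, (1 : ℝ) ∂(wild p q ν₀ 0)) ≤ a 0 :=
      integral_mono (integrable_const _) (hw 0).integrable_weight fun v => by
        have : 0 ≤ |v| ^ α := by positivity
        simp only
        linarith
    simp at this
    linarith
  obtain ⟨K, hK0, hK⟩ := exists_weight_trade_le hα p q
  have hrec : ∀ n : ℕ, ((n : ℝ) + 1) * a (n + 1) ≤ 2 * K * ∑ k ∈ Finset.range (n + 1), a k := by
    intro n
    simp only [ha]
    rw [integral_wild_succ hα hp hq h hc hg]
    have hb : ∀ i j, ∫ z : ℝ × ℝ, (1 + |p * z.1 + q * z.2| ^ α)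
        ∂((wild p q ν₀ i).prod (wild p q ν₀ j)) ≤ K * (a i + a j) := by
      intro i j
      have := (hw i).prob
      have := (hw j).prob
      have i1 := (hw i).integrable_comp_fst (hw j) hc hg
      have i2 : Integrable (fun z : ℝ × ℝ => 1 + |z.2| ^ α)
        ((wild p q ν₀ i).prod (wild p q ν₀ j)) := (hw j).integrable_weight.comp_snd _
      refine (integral_mono ((hw i).integrable_trade hα (hw j) hc hg p q)
        ((i1.add i2).const_mul K) fun z => hK z.1 z.2).trans_eq ?_
      rw [integral_const_mul]
      simp only [Pi.add_apply]
      rw [integral_add i1 i2, (hw j).integral_fst (fun v => 1 + |v| ^ α),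
        (hw i).integral_snd (fun v => 1 + |v| ^ α)]
    refine (Finset.sum_le_sum fun ij _ => hb ij.1 ij.2).trans_eq ?_
    rw [← Finset.mul_sum, Finset.sum_add_distrib,
      Finset.Nat.sum_antidiagonal_eq_sum_range_succ_mk,
      Finset.Nat.sum_antidiagonal_eq_sum_range_succ_mk]
    have := Finset.sum_range_reflect a (n + 1)
    simp only [Nat.add_sub_cancel] at this
    simp only [ha] at this ⊢
    rw [this]
    ring
  -- If the partial sums are at most `A n`, adding `a (n + 1) ≤ 2 * K * A n / (n + 1)` gives exactly
  -- `A (n + 1)`.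
  let A : ℕ → ℝ := fun n => Nat.rec (a 0) (fun n x => x * (1 + 2 * K / ((n : ℝ) + 1))) n
  have hA : ∀ n, A (n + 1) = A n * (1 + 2 * K / ((n : ℝ) + 1)) := fun n => rfl
  have hApos : ∀ n, 0 < A n := by
    intro n
    induction n with
    | zero => exact ha1
    | succ n ih => rw [hA]; positivity
  have hSA : ∀ n, ∑ k ∈ Finset.range (n + 1), a k ≤ A n := by
    intro n
    induction n with
    | zero => simp [A]
    | succ n ih =>
      rw [Finset.sum_range_succ, hA]
      have hn : (0 : ℝ) < n + 1 := by positivity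
      have h1 : a (n + 1) ≤ 2 * K * A n / (n + 1) := by
        rw [le_div_iff₀ hn, mul_comm]
        exact (hrec n).trans (by gcongr)
      have : A n * (1 + 2 * K / ((n : ℝ) + 1)) = A n + 2 * K * A n / (n + 1) := by ring
      linarith
  refine (summableOnUnit_of_ratio hApos hA).of_abs_le (C := 1) fun n => ?_
  rw [one_mul, abs_of_nonneg (ha0 n), abs_of_pos (hApos n)]
  refine le_trans ?_ (hSA n)
  exact Finset.single_le_sum (f := a) (fun k _ => ha0 k) (Finset.self_mem_range_succ n)

theorem summableOnUnit_wild (hα : 0 ≤ α) (hp : 0 ≤ p) (hq : 0 ≤ q) (h : IsWealthLaw α ν₀)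
    {φ : ℝ → ℝ} (hg : HasGrowth α φ) :
    SummableOnUnit fun n => ∫ v, φ v ∂(wild p q ν₀ n) := by
  have hw := isWealthLaw_wild hα hp hq h
  obtain ⟨C, hC0, hC⟩ := hg.exists_nonneg
  refine (summableOnUnit_wild_weight hα hp hq h).of_abs_le (C := C) fun n => ?_
  rw [abs_of_nonneg (integral_nonneg (f := fun v => 1 + |v| ^ α)
    fun v => (one_add_rpow_pos v).le), ← integral_const_mul]
  rw [← Real.norm_eq_abs]
  exact norm_integral_le_of_norm_le ((hw n).integrable_weight.const_mul C)
    (Eventually.of_forall fun v => hC v)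

/-- Wild's formula for the solution of the kinetic model. -/
noncomputable def wildSum (p q : ℝ) (ν₀ : Measure ℝ) (t : ℝ) : Measure ℝ :=
  Measure.sum fun n => ENNReal.ofReal (Real.exp (-t) * (1 - Real.exp (-t)) ^ n) • wild p q ν₀ n

theorem one_sub_exp_neg_mem {t : ℝ} (ht : 0 < t) :
    0 < 1 - Real.exp (-t) ∧ |1 - Real.exp (-t)| < 1 := by
  have h1 := Real.exp_pos (-t)
  have h2 : Real.exp (-t) < 1 := by
    simpa using ht
  exact ⟨by linarith, abs_lt.2 ⟨by linarith, by linarith⟩⟩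

theorem wild_coeff_nonneg {t : ℝ} (ht : 0 < t) (n : ℕ) :
    0 ≤ Real.exp (-t) * (1 - Real.exp (-t)) ^ n :=
  mul_nonneg (Real.exp_pos _).le (pow_nonneg (one_sub_exp_neg_mem ht).1.le n)

theorem isWealthLaw_wildSum (hα : 0 ≤ α) (hp : 0 ≤ p) (hq : 0 ≤ q) (h : IsWealthLaw α ν₀)
    {t : ℝ} (ht : 0 < t) : IsWealthLaw α (wildSum p q ν₀ t) := by
  have hw := isWealthLaw_wild hα hp hq h
  obtain ⟨hx0, hx1⟩ := one_sub_exp_neg_mem ht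
  have hx1' := (abs_lt.1 hx1).2
  refine ⟨⟨?_⟩, ?_, ?_⟩
  · rw [wildSum, Measure.sum_apply _ MeasurableSet.univ]
    simp only [Measure.smul_apply, (hw _).prob.measure_univ, smul_eq_mul, mul_one]
    rw [← ENNReal.ofReal_tsum_of_nonneg (wild_coeff_nonneg ht)
      ((summable_geometric_of_lt_one hx0.le hx1').mul_left _), tsum_mul_left,
      tsum_geometric_of_lt_one hx0.le hx1', sub_sub_cancel, mul_inv_cancel₀ (Real.exp_pos _).ne',
      ENNReal.ofReal_one]
  · rw [wildSum, Measure.sum_apply _ measurableSet_Iio]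
    simp [(hw _).supp]
  · refine integrable_sum_measure (fun n => (hw n).moment.smul_measure ENNReal.ofReal_ne_top) ?_
    have hg : HasGrowth α fun v : ℝ => ‖|v| ^ α‖ := ⟨1, fun v => by
      simp only
      rw [Real.norm_of_nonneg (by positivity), abs_of_nonneg (by positivity)]; linarith⟩
    refine (((summableOnUnit_wild hα hp hq h hg).summable hx1).mul_left (Real.exp (-t))).congr
      fun n => ?_
    rw [integral_smul_measure, ENNReal.toReal_ofReal (wild_coeff_nonneg ht n), smul_eq_mul]
    ring

theorem wildSum_absolutelyContinuous (hα : 0 ≤ α) (hp : 0 < p) (hq : 0 ≤ q)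
    (h : IsWealthLaw α ν₀) (hac : ν₀ ≪ volume) (t : ℝ) : wildSum p q ν₀ t ≪ volume := by
  refine Measure.AbsolutelyContinuous.mk fun s hs h0 => ?_
  rw [wildSum, Measure.sum_apply _ hs]
  simp [wild_absolutelyContinuous hα hp hq h hac _ h0]

theorem integral_wildSum (hα : 0 ≤ α) (hp : 0 ≤ p) (hq : 0 ≤ q) (h : IsWealthLaw α ν₀)
    {φ : ℝ → ℝ} (hφ : Continuous φ) (hg : HasGrowth α φ) {t : ℝ} (ht : 0 < t) :
    ∫ v, φ v ∂(wildSum p q ν₀ t) = Real.exp (-t) *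
      ∑' n, (∫ v, φ v ∂(wild p q ν₀ n)) * (1 - Real.exp (-t)) ^ n := by
  rw [wildSum, integral_sum_measure ((isWealthLaw_wildSum hα hp hq h ht).integrable hφ hg),
    ← tsum_mul_left]
  refine tsum_congr fun n => ?_
  rw [integral_smul_measure, ENNReal.toReal_ofReal (wild_coeff_nonneg ht n), smul_eq_mul]
  ring

/-- The double sum over pairs of terms is regrouped along antidiagonals; each group is given by the
recursion, and the result is the derivative of the power series for `φ` at `1 - exp (-t)`. -/
theorem integral_trade_wildSum (hα : 0 ≤ α) (hp : 0 ≤ p) (hq : 0 ≤ q) (h : IsWealthLaw α ν₀)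
    {φ : ℝ → ℝ} (hφ : Continuous φ) (hg : HasGrowth α φ) {t : ℝ} (ht : 0 < t) :
    ∫ z : ℝ × ℝ, φ (p * z.1 + q * z.2) ∂((wildSum p q ν₀ t).prod (wildSum p q ν₀ t)) =
      Real.exp (-t) ^ 2 * ∑' n : ℕ, ((n : ℝ) + 1) * (∫ v, φ v ∂(wild p q ν₀ (n + 1))) *
        (1 - Real.exp (-t)) ^ n := by
  have hw := isWealthLaw_wild hα hp hq h
  have hprob := fun n => (hw n).prob
  have hS := isWealthLaw_wildSum hα hp hq h ht
  have hint := hS.integrable_trade hα hS hφ hg p q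
  set x := 1 - Real.exp (-t) with hx
  set e := Real.exp (-t) with he
  have hfin : ∀ n, IsFiniteMeasure (ENNReal.ofReal (e * x ^ n) • wild p q ν₀ n) := fun n =>
    Measure.smul_finite _ ENNReal.ofReal_ne_top
  have hprod : (wildSum p q ν₀ t).prod (wildSum p q ν₀ t) =
      Measure.sum fun ij : ℕ × ℕ => (ENNReal.ofReal (e * x ^ ij.1) • wild p q ν₀ ij.1).prod
        (ENNReal.ofReal (e * x ^ ij.2) • wild p q ν₀ ij.2) := by
    have := hS.prob
    rw [wildSum, ← hx, ← he, Measure.prod_sum]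
  rw [hprod] at hint ⊢
  have hsum := hasSum_integral_measure hint
  have hterm : ∀ i j : ℕ, ∫ z : ℝ × ℝ, φ (p * z.1 + q * z.2)
      ∂((ENNReal.ofReal (e * x ^ i) • wild p q ν₀ i).prod
        (ENNReal.ofReal (e * x ^ j) • wild p q ν₀ j)) =
      e ^ 2 * x ^ (i + j) * ∫ z : ℝ × ℝ, φ (p * z.1 + q * z.2)
        ∂((wild p q ν₀ i).prod (wild p q ν₀ j)) := by
    intro i j
    rw [Measure.prod_smul_left, Measure.prod_smul_right, integral_smul_measure,
      integral_smul_measure, ENNReal.toReal_ofReal (wild_coeff_nonneg ht i),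
      ENNReal.toReal_ofReal (wild_coeff_nonneg ht j), smul_eq_mul, smul_eq_mul, pow_add]
    ring
  simp only [hterm] at hsum
  rw [← Finset.HasAntidiagonal.sigmaAntidiagonalEquivProd.hasSum_iff] at hsum
  have hsig := hsum.sigma fun n => hasSum_fintype _
  rw [← hsig.tsum_eq, ← tsum_mul_left]
  refine tsum_congr fun n => ?_
  rw [integral_wild_succ hα hp hq h hφ hg, Finset.sum_mul, Finset.mul_sum,
    Finset.univ_eq_attach, ← Finset.sum_attach (Finset.HasAntidiagonal.antidiagonal n)]
  refine Finset.sum_congr rfl fun ij _ => ?_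
  have := Finset.HasAntidiagonal.mem_antidiagonal.1 ij.2
  simp only [Function.comp, Finset.HasAntidiagonal.sigmaAntidiagonalEquivProd_apply, this]
  ring

/-- With `F` the power series for `φ`, the derivative of `exp (-t) * F (1 - exp (-t))` is `-exp (-t)
* F + exp (-t) ^ 2 * F'`: the first term is the loss, the second the gain. -/
theorem hasDerivAt_integral_wildSum (hα : 0 ≤ α) (hp : 0 ≤ p) (hq : 0 ≤ q) (h : IsWealthLaw α ν₀)
    {φ : ℝ → ℝ} (hφ : Continuous φ) (hg : HasGrowth α φ) {t : ℝ} (ht : 0 < t) :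
    HasDerivAt (fun t => ∫ v, φ v ∂(wildSum p q ν₀ t))
      (∫ z : ℝ × ℝ, (φ (p * z.1 + q * z.2) - φ z.1)
        ∂((wildSum p q ν₀ t).prod (wildSum p q ν₀ t))) t := by
  have hS := isWealthLaw_wildSum hα hp hq h ht
  have := hS.prob
  rw [integral_sub (hS.integrable_trade hα hS hφ hg p q) (hS.integrable_comp_fst hS hφ hg),
    hS.integral_fst, integral_trade_wildSum hα hp hq h hφ hg ht, integral_wildSum hα hp hq h hφ hg ht]
  have hx : HasDerivAt (fun t => 1 - Real.exp (-t)) (Real.exp (-t)) t := by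
    simpa using ((hasDerivAt_neg t).exp).const_sub 1
  have he : HasDerivAt (fun t => Real.exp (-t)) (-Real.exp (-t)) t := by
    simpa using (hasDerivAt_neg t).exp
  have hF := ((summableOnUnit_wild hα hp hq h hg).hasDerivAt (one_sub_exp_neg_mem ht).2).comp t hx
  refine ((he.mul hF).congr_deriv ?_).congr_of_eventuallyEq ?_
  · simp only [Function.comp]
    ring
  · filter_upwards [lt_mem_nhds ht] with s hs using integral_wildSum hα hp hq h hφ hg hs

theorem continuousOn_collision_wildSum (hα : 0 ≤ α) (hp : 0 ≤ p) (hq : 0 ≤ q)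
    (h : IsWealthLaw α ν₀) {φ : ℝ → ℝ} (hφ : Continuous φ) (hg : HasGrowth α φ) :
    ContinuousOn (fun t => ∫ z : ℝ × ℝ, (φ (p * z.1 + q * z.2) - φ z.1)
        ∂((wildSum p q ν₀ t).prod (wildSum p q ν₀ t))) (Set.Ioi 0) := by
  have hx : Continuous fun t => 1 - Real.exp (-t) := by fun_prop
  have h1 : ContinuousOn (fun t => ∫ v, φ v ∂(wildSum p q ν₀ t)) (Set.Ioi 0) := fun t ht =>
    (hasDerivAt_integral_wildSum hα hp hq h hφ hg ht).continuousAt.continuousWithinAt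
  have h2 : ContinuousOn (fun t => Real.exp (-t) ^ 2 * ∑' n : ℕ, ((n : ℝ) + 1) *
      (∫ v, φ v ∂(wild p q ν₀ (n + 1))) * (1 - Real.exp (-t)) ^ n) (Set.Ioi 0) := by
    refine ContinuousOn.mul (by fun_prop) fun t ht => ?_
    have := ((summableOnUnit_wild hα hp hq h hg).deriv.hasDerivAt
      (one_sub_exp_neg_mem ht).2).continuousAt
    exact (ContinuousAt.comp (f := fun t => 1 - Real.exp (-t)) this
      hx.continuousAt).continuousWithinAt
  refine (h2.sub h1).congr fun t ht => ?_
  have hS := isWealthLaw_wildSum hα hp hq h ht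
  have := hS.prob
  simp only [Pi.sub_apply]
  rw [integral_sub (hS.integrable_trade hα hS hφ hg p q) (hS.integrable_comp_fst hS hφ hg),
    hS.integral_fst, integral_trade_wildSum hα hp hq h hφ hg ht]

theorem tendsto_integral_wildSum (hα : 0 ≤ α) (hp : 0 ≤ p) (hq : 0 ≤ q)
    (h : IsWealthLaw α ν₀) {φ : ℝ → ℝ} (hφ : Continuous φ) (hg : HasGrowth α φ) :
    Tendsto (fun t => ∫ v, φ v ∂(wildSum p q ν₀ t)) (𝓝[>] 0) (𝓝 (∫ v, φ v ∂ν₀)) := by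
  have hF := ((summableOnUnit_wild hα hp hq h hg).hasDerivAt (x := 0) (by simp)).continuousAt
  have hx : Continuous fun t => 1 - Real.exp (-t) := by fun_prop
  have h0 : (fun t => 1 - Real.exp (-t)) 0 = 0 := by simp
  rw [← h0] at hF
  have := ContinuousAt.comp (f := fun t => 1 - Real.exp (-t)) hF hx.continuousAt
  have he : ContinuousAt (fun t => Real.exp (-t)) 0 := by fun_prop
  have hlim : Tendsto (fun t => Real.exp (-t) *
      ∑' n, (∫ v, φ v ∂(wild p q ν₀ n)) * (1 - Real.exp (-t)) ^ n) (𝓝[>] 0)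
      (𝓝 (Real.exp (-0) * ∑' n, (∫ v, φ v ∂(wild p q ν₀ n)) * (1 - Real.exp (-0)) ^ n)) :=
    (he.mul this).tendsto.mono_left nhdsWithin_le_nhds
  rw [neg_zero, Real.exp_zero, sub_self, one_mul, tsum_eq_single 0 (by
    intro n hn; simp [hn])] at hlim
  simp only [pow_zero, mul_one, wild_zero] at hlim
  refine hlim.congr' ?_
  filter_upwards [self_mem_nhdsWithin] with t ht using (integral_wildSum hα hp hq h hφ hg ht).symm

theorem exists_isBoltzmannSolution (hα : 0 ≤ α) (hp : 0 < p) (hq : 0 ≤ q) {f₀ : ℝ → ℝ}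
    (hf₀ : IsDensityWithMoment α f₀) : ∃ f : ℝ → ℝ → ℝ, IsBoltzmannSolution p q α f₀ f := by
  have h := hf₀.isWealthLaw
  have hac : densityMeasure f₀ ≪ volume := withDensity_absolutelyContinuous _ _
  have hex : ∀ t, ∃ f, 0 < t → IsDensityWithMoment α f ∧
      densityMeasure f = wildSum p q (densityMeasure f₀) t := by
    intro t
    by_cases ht : 0 < t
    · obtain ⟨f, hf⟩ := (isWealthLaw_wildSum hα hp.le hq h ht).exists_density
        (wildSum_absolutelyContinuous hα hp hq h hac t)
      exact ⟨f, fun _ => hf⟩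
    · exact ⟨0, fun h => absurd h ht⟩
  choose f hf using hex
  have hint : ∀ φ : ℝ → ℝ, ∀ t, 0 < t → ∫ v, φ v * f t v =
      ∫ v, φ v ∂(wildSum p q (densityMeasure f₀) t) := fun φ t ht => by
    rw [← (hf t ht).2, integral_densityMeasure (hf t ht).1.integrable (hf t ht).1.nonneg]
  have hder : ∀ φ, SmoothTest α φ → ∀ t, 0 < t →
      HasDerivAt (fun t => ∫ v, φ v * f t v) (collision p q φ (f t)) t := by
    intro φ hφ t ht
    rw [collision_eq_integral_prod (hf t ht).1, (hf t ht).2]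
    refine (hasDerivAt_integral_wildSum hα hp.le hq h hφ.continuous hφ.hasGrowth
      ht).congr_of_eventuallyEq ?_
    filter_upwards [lt_mem_nhds ht] with s hs using hint φ s hs
  refine ⟨f, fun t ht => (hf t ht).1, fun φ hφ => ?_, hder, fun φ hφ => ?_⟩
  · rw [show (1 : WithTop ℕ∞) = 0 + 1 by simp, contDiffOn_succ_iff_deriv_of_isOpen isOpen_Ioi]
    refine ⟨fun t ht => (hder φ hφ t ht).differentiableAt.differentiableWithinAt, by simp, ?_⟩
    rw [contDiffOn_zero]
    refine (continuousOn_collision_wildSum hα hp.le hq h hφ.continuous hφ.hasGrowth).congr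
      fun t ht => ?_
    rw [(hder φ hφ t ht).deriv, collision_eq_integral_prod (hf t ht).1, (hf t ht).2]
  · rw [← integral_densityMeasure hf₀.integrable hf₀.nonneg]
    refine (tendsto_integral_wildSum hα hp.le hq h hφ.continuous hφ.hasGrowth).congr' ?_
    filter_upwards [self_mem_nhdsWithin] with t ht using (hint φ t ht).symm

end WildSum

/-! ### Grönwall and Taylor inequalities. -/

section Calculus

theorem le_of_hasDerivAt_nonpos {H H' : ℝ → ℝ} {L : ℝ} (hd : ∀ t, 0 < t → HasDerivAt H (H' t) t)
    (hn : ∀ t, 0 < t → H' t ≤ 0) (h0 : Tendsto H (𝓝[>] 0) (𝓝 L)) {t : ℝ} (ht : 0 < t) :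
    H t ≤ L := by
  have hanti : AntitoneOn H (Set.Ioi 0) := by
    refine antitoneOn_of_deriv_nonpos (convex_Ioi 0)
      (fun s hs => (hd s hs).continuousAt.continuousWithinAt) ?_ ?_ <;>
      rw [interior_Ioi]
    · exact fun s hs => (hd s hs).differentiableAt.differentiableWithinAt
    · exact fun s hs => (hd s hs).deriv ▸ hn s hs
  refine ge_of_tendsto h0 ?_
  filter_upwards [Ioo_mem_nhdsGT ht] with s hs using hanti hs.1 ht hs.2.le

/-- Grönwall's inequality with the initial value taken as a right limit, since solutions are given
only at positive times. -/
theorem le_exp_mul_of_hasDerivAt_le {H H' : ℝ → ℝ} {L K : ℝ}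
    (hd : ∀ t, 0 < t → HasDerivAt H (H' t) t) (hn : ∀ t, 0 < t → H' t ≤ K * H t)
    (h0 : Tendsto H (𝓝[>] 0) (𝓝 L)) {t : ℝ} (ht : 0 < t) : H t ≤ Real.exp (K * t) * L := by
  have he : ∀ t : ℝ, HasDerivAt (fun t => Real.exp (-(K * t))) (Real.exp (-(K * t)) * -K) t :=
    fun t => by simpa using (((hasDerivAt_id t).const_mul K).neg).exp
  have hlim : Tendsto (fun t => Real.exp (-(K * t)) * H t) (𝓝[>] 0) (𝓝 L) := by
    have := ((he 0).continuousAt.tendsto.mono_left (nhdsWithin_le_nhds (s := Set.Ioi 0))).mul h0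
    simpa using this
  have := le_of_hasDerivAt_nonpos (H := fun t => Real.exp (-(K * t)) * H t)
    (fun t ht => (he t).mul (hd t ht)) (fun t ht => ?_) hlim ht
  · rw [Real.exp_neg] at this
    have hp := Real.exp_pos (K * t)
    rwa [inv_mul_le_iff₀ hp] at this
  · have := mul_nonneg (Real.exp_pos (-(K * t))).le (sub_nonneg.2 (hn t ht))
    linarith

variable {g g₁ g₂ g₃ : ℝ → ℝ} {M s t : ℝ}

theorem abs_sub_le_of_hasDerivAt (hg : ∀ r, HasDerivAt g (g₁ r) r)
    (hM : ∀ r ∈ Set.uIcc t s, |g₁ r| ≤ M) : |g s - g t| ≤ M * |s - t| :=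
  (convex_uIcc t s).norm_image_sub_le_of_norm_hasDerivWithin_le
    (fun r _ => (hg r).hasDerivWithinAt) hM Set.left_mem_uIcc Set.right_mem_uIcc

/-- The mean value inequality is applied to `g` minus its tangent; the resulting constant `M`,
instead of `M / 2`, is sufficient. -/
theorem abs_taylor_one_le (hg : ∀ r, HasDerivAt g (g₁ r) r) (hg₁ : ∀ r, HasDerivAt g₁ (g₂ r) r)
    (hM : ∀ r ∈ Set.uIcc t s, |g₂ r| ≤ M) : |g s - g t - (s - t) * g₁ t| ≤ M * (s - t) ^ 2 := by
  have hM0 : 0 ≤ M := (abs_nonneg _).trans (hM t Set.left_mem_uIcc)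
  have key := abs_sub_le_of_hasDerivAt (g := fun r => g r - r * g₁ t) (g₁ := fun r => g₁ r - g₁ t)
    (M := M * |s - t|) (s := s) (t := t)
    (fun r => ((hg r).sub ((hasDerivAt_id r).mul_const (g₁ t))).congr_deriv (by simp)) fun r hr => ?_
  · rw [mul_assoc, ← sq, sq_abs] at key
    convert key using 2
    ring
  · refine (abs_sub_le_of_hasDerivAt hg₁ fun u hu =>
      hM u (Set.uIcc_subset_uIcc_left hr hu)).trans ?_
    exact mul_le_mul_of_nonneg_left (Set.abs_sub_left_of_mem_uIcc hr) hM0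

theorem abs_taylor_two_le (hg : ∀ r, HasDerivAt g (g₁ r) r) (hg₁ : ∀ r, HasDerivAt g₁ (g₂ r) r)
    (hg₂ : ∀ r, HasDerivAt g₂ (g₃ r) r) (hM : ∀ r ∈ Set.uIcc t s, |g₃ r| ≤ M) :
    |g s - g t - (s - t) * g₁ t - (s - t) ^ 2 / 2 * g₂ t| ≤ M * |s - t| ^ 3 := by
  have hM0 : 0 ≤ M := (abs_nonneg _).trans (hM t Set.left_mem_uIcc)
  have key := abs_sub_le_of_hasDerivAt (g := fun r => g r - r * g₁ t - (r - t) ^ 2 / 2 * g₂ t)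
    (g₁ := fun r => g₁ r - g₁ t - (r - t) * g₂ t)
    (M := M * |s - t| ^ 2) (s := s) (t := t) (fun r => ?_) fun r hr => ?_
  · rw [mul_assoc, ← pow_succ] at key
    convert key using 2
    ring
  · have h1 : HasDerivAt (fun r => (r - t) ^ 2 / 2) (r - t) r := by
      have := (((hasDerivAt_id r).sub_const t).pow 2).div_const 2
      simpa using this
    exact (((hg r).sub ((hasDerivAt_id r).mul_const (g₁ t))).sub
      (h1.mul_const (g₂ t))).congr_deriv (by simp)
  · refine (abs_taylor_one_le hg₁ hg₂ fun u hu =>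
      hM u (Set.uIcc_subset_uIcc_left hr hu)).trans ?_
    rw [sq_abs]
    exact mul_le_mul_of_nonneg_left (sq_le_sq.2 (Set.abs_sub_left_of_mem_uIcc hr)) hM0

end Calculus

/-! ### A smooth substitute for the moment weight. -/

section Weight

variable {α : ℝ}

/-- A smooth weight of growth exactly `α`. -/
noncomputable def smoothWeight (α v : ℝ) : ℝ := (1 + v ^ 2) ^ (α / 2)

theorem contDiff_smoothWeight : ContDiff ℝ (⊤ : ℕ∞) (smoothWeight α) :=
  (contDiff_const.add (contDiff_id.pow 2)).rpow_const_of_ne fun v => by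
    have : (0 : ℝ) < 1 + id v ^ 2 := by positivity
    exact this.ne'

theorem smoothWeight_pos (v : ℝ) : 0 < smoothWeight α v := by
  unfold smoothWeight; positivity

/-- With the reverse inequality below, this makes the two weights interchangeable; `|v| ^ α` itself
may fail to be smooth at the origin and so to be a test function. -/
theorem weight_le_smoothWeight (hα : 0 ≤ α) (v : ℝ) : 1 + |v| ^ α ≤ 2 * smoothWeight α v := by
  have h1 : 1 ≤ smoothWeight α v := Real.one_le_rpow (by nlinarith [sq_nonneg v]) (by linarith)
  have h2 : |v| ^ α ≤ smoothWeight α v := by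
    rw [show |v| ^ α = (v ^ 2) ^ (α / 2) by
      rw [← sq_abs, ← Real.rpow_two, ← Real.rpow_mul (abs_nonneg v)]; ring_nf]
    exact Real.rpow_le_rpow (sq_nonneg _) (by linarith) (by linarith)
  linarith

theorem smoothWeight_le (hα : 0 ≤ α) (v : ℝ) : smoothWeight α v ≤ 2 ^ α * (1 + |v| ^ α) := by
  have h1 : smoothWeight α v ≤ (1 + |v|) ^ α := by
    rw [show (1 + |v|) ^ α = ((1 + |v|) ^ 2) ^ (α / 2) by
      rw [← Real.rpow_two, ← Real.rpow_mul (by positivity)]; ring_nf]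
    refine Real.rpow_le_rpow (by positivity) ?_ (by linarith)
    nlinarith [abs_nonneg v, sq_abs v]
  refine h1.trans ?_
  have := add_rpow_le_two_rpow zero_le_one (abs_nonneg v) hα
  rwa [Real.one_rpow] at this

theorem smoothTest_smoothWeight (hα : 0 ≤ α) : SmoothTest α (smoothWeight α) :=
  ⟨contDiff_smoothWeight, 2 ^ α, fun v => by
    rw [abs_of_pos (smoothWeight_pos v)]; exact smoothWeight_le hα v⟩

end Weight

/-! ### Test functions stable under time-dependent dilation. -/

/-- Smooth test functions for which the generator of the rescaled dynamics is controlled by the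
moment of order `α`. -/
structure RegularTest (α : ℝ) (φ : ℝ → ℝ) : Prop where
  smooth : ContDiff ℝ (⊤ : ℕ∞) φ
  growth : HasGrowth α φ
  growth_deriv : HasGrowth α fun v => v * deriv φ v
  growth_deriv₂ : HasGrowth α fun v => v ^ 2 * deriv (deriv φ) v

section Regular

variable {α : ℝ} {φ : ℝ → ℝ}

theorem RegularTest.smoothTest (h : RegularTest α φ) : SmoothTest α φ := ⟨h.smooth, h.growth⟩

theorem hasDerivAt_of_smooth (h : ContDiff ℝ (⊤ : ℕ∞) φ) (v : ℝ) : HasDerivAt φ (deriv φ v) v :=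
  (h.differentiable (by simp)).differentiableAt.hasDerivAt

theorem RegularTest.of_hasCompactSupport (h : ContDiff ℝ (⊤ : ℕ∞) φ) (hs : HasCompactSupport φ) :
    RegularTest α φ where
  smooth := h
  growth := .of_hasCompactSupport h.continuous hs
  growth_deriv := .of_hasCompactSupport
    (continuous_id.mul (contDiff_deriv_infty h).continuous) hs.deriv.mul_left
  growth_deriv₂ := .of_hasCompactSupport
    ((continuous_pow 2).mul (contDiff_deriv_infty (contDiff_deriv_infty h)).continuous)
    hs.deriv.deriv.mul_left

theorem HasGrowth.comp_mul_le (hα : 0 ≤ α) (h : HasGrowth α φ) (A : ℝ) :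
    ∃ C : ℝ, 0 ≤ C ∧ ∀ a v : ℝ, |a| ≤ A → |φ (a * v)| ≤ C * (1 + |v| ^ α) := by
  obtain ⟨C, hC0, hC⟩ := h.exists_nonneg
  refine ⟨C * (1 + |A| ^ α), by positivity, fun a v ha => (hC _).trans ?_⟩
  rw [mul_assoc]
  refine mul_le_mul_of_nonneg_left ?_ hC0
  have h1 : |a * v| ^ α ≤ |A| ^ α * |v| ^ α := by
    rw [abs_mul, Real.mul_rpow (abs_nonneg _) (abs_nonneg _)]
    refine mul_le_mul_of_nonneg_right ?_ (by positivity)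
    exact Real.rpow_le_rpow (abs_nonneg _) (ha.trans (le_abs_self _)) hα
  have h2 : 0 ≤ |A| ^ α := by positivity
  have h3 : 0 ≤ |v| ^ α := by positivity
  nlinarith

/-- Smoothness in time of a rescaled test function, with bounds of order `α`. -/
theorem RegularTest.hasDerivAt_scale (h : RegularTest α φ) (c v r : ℝ) :
    HasDerivAt (fun r => φ (Real.exp (-(c * r)) * v))
      (-c * (Real.exp (-(c * r)) * v * deriv φ (Real.exp (-(c * r)) * v))) r := by
  have he : HasDerivAt (fun r => Real.exp (-(c * r)) * v) (Real.exp (-(c * r)) * (-c) * v) r := by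
    simpa using ((((hasDerivAt_id r).const_mul c).neg).exp.mul_const v)
  refine ((hasDerivAt_of_smooth h.smooth _).comp r he).congr_deriv ?_
  ring

/-- Differentiating twice along dilations produces only `u * φ' u` and `u ^ 2 * φ'' u` at the
rescaled point, the quantities bounded in `RegularTest`. -/
theorem RegularTest.hasDerivAt_scale₂ (h : RegularTest α φ) (c v r : ℝ) :
    HasDerivAt (fun r => -c * (Real.exp (-(c * r)) * v * deriv φ (Real.exp (-(c * r)) * v)))
      (c ^ 2 * (Real.exp (-(c * r)) * v * deriv φ (Real.exp (-(c * r)) * v) +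
        (Real.exp (-(c * r)) * v) ^ 2 * deriv (deriv φ) (Real.exp (-(c * r)) * v))) r := by
  have he : HasDerivAt (fun r => Real.exp (-(c * r)) * v) (Real.exp (-(c * r)) * (-c) * v) r := by
    simpa using ((((hasDerivAt_id r).const_mul c).neg).exp.mul_const v)
  have hd := (hasDerivAt_of_smooth (contDiff_deriv_infty h.smooth) (Real.exp (-(c * r)) * v)).comp r he
  refine ((he.mul hd).const_mul (-c)).congr_deriv ?_
  simp only [Function.comp]
  ring

end Regular

/-! ### A priori properties of arbitrary kinetic solutions. -/

section Flow

variable {p q α : ℝ} {ν₀ : Measure ℝ} {ν : ℝ → Measure ℝ}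

theorem smoothTest_id (hα : 1 ≤ α) : SmoothTest α fun v => v := ⟨contDiff_id, HasGrowth.id hα⟩

theorem SmoothTest.of_bounded {φ : ℝ → ℝ} (h : ContDiff ℝ (⊤ : ℕ∞) φ) {C : ℝ}
    (hC : ∀ v, |φ v| ≤ C) : SmoothTest α φ := ⟨h, HasGrowth.of_bounded hC⟩

/-- Testing with the identity gives the closed linear equation `m' = (p + q - 1) * m`. -/
theorem IsBoltzmannFlow.mean (h : IsBoltzmannFlow p q α ν₀ ν) (hα : 1 ≤ α)
    (hm : ∫ v, v ∂ν₀ = 1) {t : ℝ} (ht : 0 < t) :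
    ∫ v, v ∂(ν t) = Real.exp ((p + q - 1) * t) := by
  have hα0 : 0 ≤ α := zero_le_one.trans hα
  have hid := smoothTest_id hα
  have hd : ∀ t, 0 < t → HasDerivAt (fun t => ∫ v, v ∂(ν t))
      ((p + q - 1) * ∫ v, v ∂(ν t)) t := by
    intro t ht
    refine (h.hasDerivAt _ hid t ht).congr_deriv ?_
    have hν := h.law t ht
    have := hν.prob
    have i1 : Integrable (fun z : ℝ × ℝ => z.1) ((ν t).prod (ν t)) :=
      hν.integrable_comp_fst hν continuous_id hid.hasGrowth
    have i2 : Integrable (fun z : ℝ × ℝ => z.2) ((ν t).prod (ν t)) :=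
      (hν.integrable continuous_id hid.hasGrowth).comp_snd _
    have e : ∀ z : ℝ × ℝ, p * z.1 + q * z.2 - z.1 = (p - 1) * z.1 + q * z.2 := fun z => by ring
    simp only [e]
    rw [integral_add (i1.const_mul _) (i2.const_mul _), integral_const_mul, integral_const_mul,
      hν.integral_fst (fun v => v), hν.integral_snd (fun v => v)]
    ring
  have hi := h.initial _ hid
  rw [hm] at hi
  refine le_antisymm ?_ ?_
  · simpa using le_exp_mul_of_hasDerivAt_le hd (fun t _ => le_rfl) hi ht
  -- The same inequality for `-m` gives the lower bound.
  · have := le_exp_mul_of_hasDerivAt_le (K := p + q - 1) (fun t ht => (hd t ht).neg)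
      (fun t _ => by simp) hi.neg ht
    simp only [Pi.neg_apply] at this
    linarith

/-- Propagation of the uniform integrability of the density. -/
theorem IsBoltzmannFlow.integral_le_of_initial (h : IsBoltzmannFlow p q α ν₀ ν) (hα : 0 ≤ α)
    (hp : 0 < p) {a b : ℝ} (ha : 0 ≤ a) (hb : 0 ≤ b)
    (h0 : ∀ φ : ℝ → ℝ, ContDiff ℝ (⊤ : ℕ∞) φ → (∀ v, 0 ≤ φ v) → (∀ v, φ v ≤ 1) → Integrable φ →
      ∫ v, φ v ∂ν₀ ≤ a + b * ∫ v, φ v) {φ : ℝ → ℝ}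
    (hφ : ContDiff ℝ (⊤ : ℕ∞) φ) (hφ0 : ∀ v, 0 ≤ φ v) (hφ1 : ∀ v, φ v ≤ 1) (hφi : Integrable φ)
    {t : ℝ} (ht : 0 < t) :
    ∫ v, φ v ∂(ν t) ≤ a + b * Real.exp ((p⁻¹ - 1) * t) * ∫ v, φ v := by
  -- The rate `p⁻¹ - 1` balances the gain, where substituting `p * v + q * w` multiplies Lebesgue
  -- integrals by `p⁻¹`, against the loss at rate one.
  set B : ℝ → ℝ := fun t => b * Real.exp ((p⁻¹ - 1) * t) with hB
  have hBd : ∀ t, HasDerivAt B ((p⁻¹ - 1) * B t) t := fun t => by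
    have := ((((hasDerivAt_id t).const_mul (p⁻¹ - 1)).exp).const_mul b)
    refine this.congr_deriv ?_
    simp only [hB, id]
    ring
  -- The gain involves translates and dilates of `φ`, so Grönwall does not close on a single test
  -- function. The bound is instead improved iteratively for all of them at once; the error starts
  -- at `1`, since `φ ≤ 1`, and each time integration turns `t ^ k / k!` into the next term.
  have key : ∀ k : ℕ, ∀ φ : ℝ → ℝ, ContDiff ℝ (⊤ : ℕ∞) φ → (∀ v, 0 ≤ φ v) → (∀ v, φ v ≤ 1) →
      Integrable φ → ∀ t, 0 < t →
      ∫ v, φ v ∂(ν t) ≤ a + B t * (∫ v, φ v) + t ^ k / (k.factorial : ℝ) := by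
    intro k
    induction k with
    | zero =>
      intro φ hφ hφ0 hφ1 hφi t ht
      have hν := h.law t ht
      have := hν.prob
      have h1 : ∫ v, φ v ∂(ν t) ≤ ∫ _, (1 : ℝ) ∂(ν t) :=
        integral_mono (hν.integrable hφ.continuous (.of_bounded (C := 1)
          fun v => abs_le.2 ⟨by linarith [hφ0 v], hφ1 v⟩)) (integrable_const _) hφ1
      have h2 : 0 ≤ B t * ∫ v, φ v := mul_nonneg (by positivity) (integral_nonneg hφ0)
      simp at h1 ⊢
      linarith
    | succ k ih =>
      intro φ hφ hφ0 hφ1 hφi t ht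
      have hbd : ∀ v, |φ v| ≤ 1 := fun v => abs_le.2 ⟨by linarith [hφ0 v], hφ1 v⟩
      have hst : SmoothTest α φ := .of_bounded hφ hbd
      set I := ∫ v, φ v with hI
      have hfac : (((k + 1).factorial : ℕ) : ℝ) = ((k : ℝ) + 1) * (k.factorial : ℝ) := by
        rw [Nat.factorial_succ]; push_cast; ring
      have hfpos : (0 : ℝ) < k.factorial := by positivity
      -- The factor `exp t` absorbs the loss term.
      let H : ℝ → ℝ := fun t => Real.exp t *
        ((∫ v, φ v ∂(ν t)) - (a + B t * I + t ^ (k + 1) / ((k + 1).factorial : ℝ)))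
      have hgain : ∀ t, 0 < t → ∫ z : ℝ × ℝ, φ (p * z.1 + q * z.2) ∂((ν t).prod (ν t)) ≤
          a + B t * (p⁻¹ * I) + t ^ k / (k.factorial : ℝ) := by
        intro t ht
        have hν := h.law t ht
        have := hν.prob
        have hint := hν.integrable_trade hα hν hst.continuous hst.hasGrowth p q
        rw [integral_prod_symm _ hint]
        -- For frozen `w` the induction hypothesis applies to `v ↦ φ (p * v + q * w)`, of integral
        -- `p⁻¹ * I`.
        have hle : ∀ w, ∫ v, φ (p * v + q * w) ∂(ν t) ≤
            a + B t * (p⁻¹ * I) + t ^ k / (k.factorial : ℝ) := by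
          intro w
          have hii : Integrable fun v => φ (p * v + q * w) :=
            (hφi.comp_add_right (q * w)).comp_mul_left' hp.ne'
          refine (ih (fun v => φ (p * v + q * w))
            (hφ.comp ((contDiff_const.mul contDiff_id).add contDiff_const)) (fun v => hφ0 _)
            (fun v => hφ1 _) hii t ht).trans_eq ?_
          rw [Measure.integral_comp_mul_left (fun v => φ (v + q * w)),
            integral_add_right_eq_self (fun v => φ v), abs_of_pos (inv_pos.2 hp), smul_eq_mul]
        calc ∫ w, ∫ v, φ (p * v + q * w) ∂(ν t) ∂(ν t)
            ≤ ∫ _, (a + B t * (p⁻¹ * I) + t ^ k / (k.factorial : ℝ)) ∂(ν t) :=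
              integral_mono hint.integral_prod_right (integrable_const _) hle
          _ = _ := by simp
      have hHd : ∀ t, 0 < t → HasDerivAt H (Real.exp t *
          ((∫ z : ℝ × ℝ, φ (p * z.1 + q * z.2) ∂((ν t).prod (ν t))) -
            (a + B t * (p⁻¹ * I) + t ^ (k + 1) / ((k + 1).factorial : ℝ)
              + t ^ k / (k.factorial : ℝ)))) t := by
        intro t ht
        have hν := h.law t ht
        have := hν.prob
        have d1 := h.hasDerivAt φ hst t ht
        rw [integral_sub (hν.integrable_trade hα hν hst.continuous hst.hasGrowth p q)
          (hν.integrable_comp_fst hν hst.continuous hst.hasGrowth), hν.integral_fst] at d1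
        have d2 : HasDerivAt (fun t : ℝ => t ^ (k + 1) / ((k + 1).factorial : ℝ))
            (t ^ k / (k.factorial : ℝ)) t := by
          refine ((hasDerivAt_pow (k + 1) t).div_const _).congr_deriv ?_
          rw [hfac, Nat.add_sub_cancel]
          push_cast
          field_simp
        refine ((Real.hasDerivAt_exp t).mul
          (d1.sub ((((hBd t).mul_const I).const_add a).add d2))).congr_deriv ?_
        simp only [Pi.sub_apply, Pi.add_apply]
        ring
      have hlim : Tendsto H (𝓝[>] 0) (𝓝 (Real.exp 0 * ((∫ v, φ v ∂ν₀) -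
          (a + B 0 * I + 0 ^ (k + 1) / ((k + 1).factorial : ℝ))))) := by
        have c1 : ContinuousAt (fun t : ℝ => a + B t * I + t ^ (k + 1) / ((k + 1).factorial : ℝ)) 0 :=
          (continuousAt_const.add ((hBd 0).continuousAt.mul continuousAt_const)).add
            ((continuousAt_id.pow _).div_const _)
        exact (Real.continuous_exp.continuousAt.tendsto.mono_left nhdsWithin_le_nhds).mul
          ((h.initial φ hst).sub (c1.tendsto.mono_left nhdsWithin_le_nhds))
      have hH := le_of_hasDerivAt_nonpos hHd (fun t ht => ?_) hlim ht
      · have h00 := h0 φ hφ hφ0 hφ1 hφi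
        have hB0 : B 0 = b := by simp [hB]
        rw [hB0, zero_pow (Nat.succ_ne_zero k), zero_div, Real.exp_zero, one_mul] at hH
        have : H t ≤ 0 := hH.trans (by linarith)
        have := nonpos_of_mul_nonpos_right this (Real.exp_pos t)
        linarith
      · refine mul_nonpos_of_nonneg_of_nonpos (Real.exp_pos t).le ?_
        have := hgain t ht
        have : 0 ≤ t ^ (k + 1) / ((k + 1).factorial : ℝ) := by positivity
        linarith
  have hlim : Tendsto (fun k : ℕ => a + B t * (∫ v, φ v) + t ^ k / (k.factorial : ℝ)) atTop
      (𝓝 (a + B t * (∫ v, φ v) + 0)) :=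
    tendsto_const_nhds.add (FloorSemiring.tendsto_pow_div_factorial_atTop t)
  rw [add_zero] at hlim
  exact ge_of_tendsto' hlim fun k => key k φ hφ hφ0 hφ1 hφi t ht

theorem IsBoltzmannFlow.continuousAt_integral (h : IsBoltzmannFlow p q α ν₀ ν) {φ : ℝ → ℝ}
    (hφ : SmoothTest α φ) {t : ℝ} (ht : 0 < t) : ContinuousAt (fun t => ∫ v, φ v ∂(ν t)) t :=
  (h.hasDerivAt φ hφ t ht).continuousAt

theorem IsBoltzmannFlow.integral_weight_le (h : IsBoltzmannFlow p q α ν₀ ν) (hα : 0 ≤ α)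
    {t : ℝ} (ht : 0 < t) :
    ∫ v, (1 + |v| ^ α) ∂(ν t) ≤ 2 * ∫ v, smoothWeight α v ∂(ν t) := by
  rw [← integral_const_mul]
  exact integral_mono (h.law t ht).integrable_weight
    (((h.law t ht).integrable contDiff_smoothWeight.continuous
      (smoothTest_smoothWeight hα).hasGrowth).const_mul 2) fun v => weight_le_smoothWeight hα v

/-- The dynamics of a test function that is rescaled in time. -/
theorem IsBoltzmannFlow.hasDerivAt_scale (h : IsBoltzmannFlow p q α ν₀ ν) (hα : 0 ≤ α) (c : ℝ)
    {φ : ℝ → ℝ} (hφ : RegularTest α φ) {t : ℝ} (ht : 0 < t) :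
    HasDerivAt (fun t => ∫ v, φ (Real.exp (-(c * t)) * v) ∂(ν t))
      (∫ z : ℝ × ℝ, (φ (Real.exp (-(c * t)) * (p * z.1 + q * z.2)) - φ (Real.exp (-(c * t)) * z.1) -
        c * (Real.exp (-(c * t)) * z.1 * deriv φ (Real.exp (-(c * t)) * z.1)))
          ∂((ν t).prod (ν t))) t := by
  set A := Real.exp (|c| * (t + 1)) with hA
  have hAle : ∀ r, |r - t| ≤ 1 → |Real.exp (-(c * r))| ≤ A := by
    intro r hr
    rw [abs_of_pos (Real.exp_pos _), hA, Real.exp_le_exp]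
    refine (le_abs_self _).trans ?_
    rw [abs_neg, abs_mul]
    refine mul_le_mul_of_nonneg_left ?_ (abs_nonneg _)
    have : |r| ≤ |r - t| + |t| := by simpa using abs_add_le (r - t) t
    rw [abs_of_pos ht] at this
    linarith
  -- `χ` is the time derivative of the moving test function at `t`. The integral at time `s` splits
  -- into the fixed test function, `s - t` times the integral of `χ`, and a remainder of second
  -- order; `d1`, `d2`, `d3` differentiate these three pieces.
  set χ : ℝ → ℝ := fun v => -c * (Real.exp (-(c * t)) * v * deriv φ (Real.exp (-(c * t)) * v))
    with hχ
  obtain ⟨C₀, hC₀, hb₀⟩ := hφ.growth.comp_mul_le hα A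
  obtain ⟨C₁, hC₁, hb₁⟩ := hφ.growth_deriv.comp_mul_le hα A
  obtain ⟨C₂, hC₂, hb₂⟩ := hφ.growth_deriv₂.comp_mul_le hα A
  have htt : |t - t| ≤ 1 := by simp
  have hlin : ContDiff ℝ (⊤ : ℕ∞) fun v : ℝ => Real.exp (-(c * t)) * v :=
    contDiff_const.mul contDiff_id
  have hψ : SmoothTest α fun v => φ (Real.exp (-(c * t)) * v) :=
    ⟨hφ.smooth.comp hlin, C₀, fun v => hb₀ _ v (hAle t htt)⟩
  have hχt : SmoothTest α χ := by
    refine ⟨contDiff_const.mul (hlin.mul ((contDiff_deriv_infty hφ.smooth).comp hlin)), ?_⟩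
    exact HasGrowth.const_mul ⟨C₁, fun v => hb₁ _ v (hAle t htt)⟩ _
  set K := c ^ 2 * (C₁ + C₂) with hK
  have hrem : ∀ s v, |s - t| ≤ 1 → |φ (Real.exp (-(c * s)) * v) - φ (Real.exp (-(c * t)) * v) -
      (s - t) * χ v| ≤ K * (1 + |v| ^ α) * (s - t) ^ 2 := by
    intro s v hs
    refine abs_taylor_one_le (hφ.hasDerivAt_scale c v) (hφ.hasDerivAt_scale₂ c v) fun r hr => ?_
    have hr' := (Set.abs_sub_left_of_mem_uIcc hr).trans hs
    rw [abs_mul, abs_of_nonneg (sq_nonneg c), hK, mul_assoc (c ^ 2) (C₁ + C₂), add_mul]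
    refine mul_le_mul_of_nonneg_left ((abs_add_le _ _).trans (add_le_add ?_ ?_)) (sq_nonneg c)
    exacts [hb₁ _ v (hAle r hr'), hb₂ _ v (hAle r hr')]
  have hν := h.law t ht
  have := hν.prob
  have d1 := h.hasDerivAt _ hψ t ht
  have hχc := h.continuousAt_integral hχt ht
  -- The factor `s - t` vanishes at `t`, so continuity of the integral of `χ` is enough.
  have d2 : HasDerivAt (fun s => (s - t) * ∫ v, χ v ∂(ν s)) (∫ v, χ v ∂(ν t)) t := by
    rw [hasDerivAt_iff_isLittleO]
    have : (fun s => (∫ v, χ v ∂(ν s)) - ∫ v, χ v ∂(ν t)) =o[𝓝 t] fun _ => (1 : ℝ) := by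
      rw [Asymptotics.isLittleO_one_iff]
      simpa using hχc.tendsto.sub_const (∫ v, χ v ∂(ν t))
    refine (((Asymptotics.isBigO_refl (fun s => s - t) (𝓝 t)).mul_isLittleO this).congr_left
      fun s => ?_).congr_right fun s => ?_
    · simp only [smul_eq_mul]; ring
    · simp
  -- The quadratic bound is integrated against the moving law; its weight is locally bounded in time
  -- because the smooth weight is an admissible test.
  have d3 : HasDerivAt (fun s => ∫ v, (φ (Real.exp (-(c * s)) * v) - φ (Real.exp (-(c * t)) * v) -
      (s - t) * χ v) ∂(ν s)) 0 t := by
    have hW := h.continuousAt_integral (smoothTest_smoothWeight hα) ht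
    have hev : ∀ᶠ s in 𝓝 t, ∫ v, smoothWeight α v ∂(ν s) < (∫ v, smoothWeight α v ∂(ν t)) + 1 :=
      hW.tendsto.eventually (gt_mem_nhds (lt_add_one _))
    have hK0 : 0 ≤ K := by positivity
    rw [hasDerivAt_iff_isLittleO]
    have hO : (fun s => ∫ v, (φ (Real.exp (-(c * s)) * v) - φ (Real.exp (-(c * t)) * v) -
      (s - t) * χ v) ∂(ν s)) =O[𝓝 t] fun s => (s - t) ^ 2 := by
      refine Asymptotics.IsBigO.of_bound
        (K * (2 * ((∫ v, smoothWeight α v ∂(ν t)) + 1))) ?_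
      filter_upwards [hev, lt_mem_nhds ht, Metric.closedBall_mem_nhds t one_pos] with s hs hs0 hs1
      have hs1 : |s - t| ≤ 1 := hs1
      refine (norm_integral_le_of_norm_le (((h.law s hs0).integrable_weight.const_mul K).mul_const
        ((s - t) ^ 2)) (Eventually.of_forall fun v => hrem s v hs1)).trans ?_
      rw [integral_mul_const, integral_const_mul, Real.norm_of_nonneg (sq_nonneg (s - t))]
      refine mul_le_mul_of_nonneg_right (mul_le_mul_of_nonneg_left ?_ hK0) (sq_nonneg _)
      exact (h.integral_weight_le hα hs0).trans (by linarith)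
    have hlo : (fun s => (s - t) ^ 2) =o[𝓝 t] fun s => s - t := by
      have := Asymptotics.isLittleO_pow_sub_sub t one_lt_two
      simpa using this
    refine (hO.trans_isLittleO hlo).congr_left fun s => ?_
    simp
  refine (((d1.add d2).add d3).congr_deriv ?_).congr_of_eventuallyEq ?_
  · have hsc := hν.integrable_trade hα hν hψ.continuous hψ.hasGrowth p q
    have hfst := hν.integrable_comp_fst hν hψ.continuous hψ.hasGrowth
    have hχi := hν.integrable_comp_fst hν hχt.continuous hχt.hasGrowth
    have hsub : Integrable (fun z : ℝ × ℝ => φ (Real.exp (-(c * t)) * (p * z.1 + q * z.2)) -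
        φ (Real.exp (-(c * t)) * z.1)) ((ν t).prod (ν t)) := hsc.sub hfst
    rw [add_zero, ← hν.integral_fst χ, ← integral_add hsub hχi]
    refine integral_congr_ae (Eventually.of_forall fun z => ?_)
    simp only [hχ]
    ring
  · filter_upwards [lt_mem_nhds ht, Metric.closedBall_mem_nhds t one_pos] with s hs0 hs1
    have hs1 : |s - t| ≤ 1 := hs1
    have hνs := h.law s hs0
    have i1 := hνs.integrable hψ.continuous hψ.hasGrowth
    have i2 := (hνs.integrable hχt.continuous hχt.hasGrowth).const_mul (s - t)
    have i3 : Integrable (fun v => φ (Real.exp (-(c * s)) * v)) (ν s) :=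
      hνs.integrable (hφ.smooth.continuous.comp (continuous_const.mul continuous_id))
        ⟨C₀, fun v => hb₀ _ v (hAle s hs1)⟩
    have i4 : Integrable (fun v => φ (Real.exp (-(c * s)) * v) - φ (Real.exp (-(c * t)) * v))
      (ν s) := i3.sub i1
    simp only [Pi.add_apply]
    rw [integral_sub i4 i2, integral_sub i3 i1, integral_const_mul (s - t) χ]
    ring

theorem IsBoltzmannFlow.tendsto_scale (h : IsBoltzmannFlow p q α ν₀ ν) (hα : 0 ≤ α) (c : ℝ)
    {φ : ℝ → ℝ} (hφ : RegularTest α φ) :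
    Tendsto (fun t => ∫ v, φ (Real.exp (-(c * t)) * v) ∂(ν t)) (𝓝[>] 0) (𝓝 (∫ v, φ v ∂ν₀)) := by
  obtain ⟨C₀, hC₀, hb₀⟩ := hφ.growth.comp_mul_le hα (Real.exp |c|)
  obtain ⟨C₁, hC₁, hb₁⟩ := hφ.growth_deriv.comp_mul_le hα (Real.exp |c|)
  have hAle : ∀ r, 0 ≤ r → r ≤ 1 → |Real.exp (-(c * r))| ≤ Real.exp |c| := by
    intro r hr0 hr
    rw [abs_of_pos (Real.exp_pos _), Real.exp_le_exp]
    refine (le_abs_self _).trans ?_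
    rw [abs_neg, abs_mul, abs_of_nonneg hr0]
    exact mul_le_of_le_one_right (abs_nonneg c) hr
  have hW := h.initial _ (smoothTest_smoothWeight hα)
  have hev : ∀ᶠ s in 𝓝[>] (0 : ℝ), ∫ v, smoothWeight α v ∂(ν s) <
      (∫ v, smoothWeight α v ∂ν₀) + 1 := hW.eventually (gt_mem_nhds (lt_add_one _))
  have hdiff : Tendsto (fun t => (∫ v, φ (Real.exp (-(c * t)) * v) ∂(ν t)) - ∫ v, φ v ∂(ν t))
      (𝓝[>] 0) (𝓝 0) := by
    have hg : Tendsto (fun t : ℝ => |c| * C₁ * |t| * (2 * ((∫ v, smoothWeight α v ∂ν₀) + 1)))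
        (𝓝[>] 0) (𝓝 0) := by
      have : ContinuousAt (fun t : ℝ => |c| * C₁ * |t| * (2 * ((∫ v, smoothWeight α v ∂ν₀) + 1))) 0 := by
        fun_prop
      simpa using this.tendsto.mono_left (nhdsWithin_le_nhds (s := Set.Ioi 0))
    refine squeeze_zero_norm' ?_ hg
    filter_upwards [hev, Ioo_mem_nhdsGT one_pos] with t ht ht01
    have hν := h.law t ht01.1
    have i1 := hν.integrable hφ.smooth.continuous hφ.growth
    have i3 : Integrable (fun v => φ (Real.exp (-(c * t)) * v)) (ν t) :=
      hν.integrable (hφ.smooth.continuous.comp (continuous_const.mul continuous_id))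
        ⟨C₀, fun v => hb₀ _ v (hAle t ht01.1.le ht01.2.le)⟩
    rw [← integral_sub i3 i1]
    have hbd : ∀ v, ‖φ (Real.exp (-(c * t)) * v) - φ v‖ ≤ |c| * C₁ * |t| * (1 + |v| ^ α) := by
      intro v
      have := abs_sub_le_of_hasDerivAt (s := t) (t := 0) (M := |c| * C₁ * (1 + |v| ^ α))
        (hφ.hasDerivAt_scale c v) fun r hr => ?_
      · simp only [mul_zero, neg_zero, Real.exp_zero, one_mul, sub_zero] at this
        rw [Real.norm_eq_abs]
        refine this.trans_eq ?_
        ring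
      · rw [Set.uIcc_of_le ht01.1.le] at hr
        rw [abs_mul, abs_neg, mul_assoc |c| C₁]
        exact mul_le_mul_of_nonneg_left (hb₁ _ v (hAle r hr.1 (hr.2.trans ht01.2.le))) (abs_nonneg c)
    refine (norm_integral_le_of_norm_le (hν.integrable_weight.const_mul _)
      (Eventually.of_forall hbd)).trans ?_
    rw [integral_const_mul]
    refine mul_le_mul_of_nonneg_left ?_ (by positivity)
    exact (h.integral_weight_le hα ht01.1).trans (by linarith)
  have := hdiff.add (h.initial φ hφ.smoothTest)
  simpa using this

end Flow

/-! ### Self-similar variables. -/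

/-- The generator of the rescaled kinetic dynamics, before averaging over the two agents. -/
noncomputable def tradeGenerator (p q : ℝ) (φ : ℝ → ℝ) (z : ℝ × ℝ) : ℝ :=
  q⁻¹ * (φ (p * z.1 + q * z.2) - φ z.1 - (p + q - 1) * (z.1 * deriv φ z.1))

/-- The dynamics of the kinetic model in self-similar variables. -/
structure IsRescaledFlow (p q α : ℝ) (ν₀ : Measure ℝ) (ρ : ℝ → Measure ℝ) : Prop where
  law : ∀ τ, 0 < τ → IsWealthLaw α (ρ τ)
  mean : ∀ τ, 0 < τ → ∫ v, v ∂(ρ τ) = 1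
  hasDerivAt : ∀ φ, RegularTest α φ → ∀ τ, 0 < τ →
    HasDerivAt (fun τ => ∫ v, φ v ∂(ρ τ)) (∫ z, tradeGenerator p q φ z ∂((ρ τ).prod (ρ τ))) τ
  initial : ∀ φ, RegularTest α φ →
    Tendsto (fun τ => ∫ v, φ v ∂(ρ τ)) (𝓝[>] 0) (𝓝 (∫ v, φ v ∂ν₀))

section Rescale

variable {p q α : ℝ} {ν₀ : Measure ℝ} {ν : ℝ → Measure ℝ}

/-- The laws of the rescaled wealth. -/
noncomputable def rescaledLaw (p q : ℝ) (ν : ℝ → Measure ℝ) (τ : ℝ) : Measure ℝ :=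
  (ν (τ / q)).map fun v => Real.exp (-((p + q - 1) * (τ / q))) * v

theorem integral_rescaledLaw (τ : ℝ) (φ : ℝ → ℝ) :
    ∫ v, φ v ∂(rescaledLaw p q ν τ) =
      ∫ v, φ (Real.exp (-((p + q - 1) * (τ / q))) * v) ∂(ν (τ / q)) := by
  have h : MeasurableEmbedding fun v : ℝ => Real.exp (-((p + q - 1) * (τ / q))) * v :=
    (Homeomorph.mulLeft₀ _ (Real.exp_pos _).ne').measurableEmbedding
  rw [rescaledLaw, h.integral_map]

theorem integral_prod_rescaledLaw (τ : ℝ) [SFinite (ν (τ / q))] {Φ : ℝ × ℝ → ℝ}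
    (hΦ : Continuous Φ) :
    ∫ z, Φ z ∂((rescaledLaw p q ν τ).prod (rescaledLaw p q ν τ)) =
      ∫ z : ℝ × ℝ, Φ (Real.exp (-((p + q - 1) * (τ / q))) * z.1,
        Real.exp (-((p + q - 1) * (τ / q))) * z.2) ∂((ν (τ / q)).prod (ν (τ / q))) := by
  rw [rescaledLaw, Measure.map_prod_map _ _ (by fun_prop) (by fun_prop),
    integral_map (by fun_prop) hΦ.aestronglyMeasurable]
  rfl

theorem IsBoltzmannFlow.isWealthLaw_rescaledLaw (h : IsBoltzmannFlow p q α ν₀ ν) (hα : 0 ≤ α)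
    (hq : 0 < q) {τ : ℝ} (hτ : 0 < τ) : IsWealthLaw α (rescaledLaw p q ν τ) := by
  have hν := h.law (τ / q) (div_pos hτ hq)
  have := hν.prob
  set c := Real.exp (-((p + q - 1) * (τ / q))) with hc
  have hc0 : 0 < c := Real.exp_pos _
  have hm : Measurable fun v : ℝ => c * v := by fun_prop
  refine ⟨Measure.isProbabilityMeasure_map hm.aemeasurable, ?_, ?_⟩
  · rw [rescaledLaw, ← hc, Measure.map_apply hm measurableSet_Iio]
    convert hν.supp using 2
    ext v
    simp [hc0]
  · have hcont : Continuous fun v : ℝ => |v| ^ α := continuous_abs.rpow_const fun _ => Or.inr hα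
    rw [rescaledLaw, ← hc, integrable_map_measure hcont.aestronglyMeasurable hm.aemeasurable]
    refine (hν.moment.const_mul (|c| ^ α)).congr (Eventually.of_forall fun v => ?_)
    simp only [Function.comp]
    rw [abs_mul, Real.mul_rpow (abs_nonneg _) (abs_nonneg _)]

theorem IsBoltzmannFlow.isRescaledFlow (h : IsBoltzmannFlow p q α ν₀ ν) (hα : 1 ≤ α)
    (hq : 0 < q) (hm : ∫ v, v ∂ν₀ = 1) : IsRescaledFlow p q α ν₀ (rescaledLaw p q ν) where
  law τ hτ := h.isWealthLaw_rescaledLaw (zero_le_one.trans hα) hq hτ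
  mean τ hτ := by
    rw [integral_rescaledLaw τ fun v => v, integral_const_mul, h.mean hα hm (div_pos hτ hq),
      ← Real.exp_add, neg_add_cancel, Real.exp_zero]
  hasDerivAt φ hφ τ hτ := by
    have hα0 := zero_le_one.trans hα
    have ht := div_pos hτ hq
    have := (h.law _ ht).prob
    simp only [integral_rescaledLaw]
    have hd := hφ.smooth.continuous
    have hd' := (contDiff_deriv_infty hφ.smooth).continuous
    rw [integral_prod_rescaledLaw τ (by unfold tradeGenerator; fun_prop)]
    -- The chain rule for `t = τ / q` supplies the factor `q⁻¹` in the generator.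
    have key := (h.hasDerivAt_scale hα0 (p + q - 1) hφ ht).comp τ ((hasDerivAt_id τ).div_const q)
    refine key.congr_deriv ?_
    rw [mul_comm, one_div, ← integral_const_mul]
    refine integral_congr_ae (Eventually.of_forall fun z => ?_)
    simp only [tradeGenerator]
    congr 4
    ring
  initial φ hφ := by
    simp only [integral_rescaledLaw]
    refine (h.tendsto_scale (zero_le_one.trans hα) (p + q - 1) hφ).comp ?_
    refine tendsto_nhdsWithin_iff.2 ⟨?_, ?_⟩
    · have : ContinuousAt (fun τ : ℝ => τ / q) 0 := by fun_prop
      simpa using this.tendsto.mono_left (nhdsWithin_le_nhds (s := Set.Ioi 0))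
    · filter_upwards [self_mem_nhdsWithin] with τ hτ using div_pos hτ hq

/-- Propagation of the uniform integrability of the density, in self-similar variables. -/
theorem IsBoltzmannFlow.integral_rescaledLaw_le (h : IsBoltzmannFlow p q α ν₀ ν) (hα : 0 ≤ α)
    (hq : 0 < q) (hp : 0 < p) {a b : ℝ} (ha : 0 ≤ a) (hb : 0 ≤ b)
    (h0 : ∀ φ : ℝ → ℝ, ContDiff ℝ (⊤ : ℕ∞) φ → (∀ v, 0 ≤ φ v) → (∀ v, φ v ≤ 1) → Integrable φ →
      ∫ v, φ v ∂ν₀ ≤ a + b * ∫ v, φ v) {φ : ℝ → ℝ}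
    (hφ : ContDiff ℝ (⊤ : ℕ∞) φ) (hφ0 : ∀ v, 0 ≤ φ v) (hφ1 : ∀ v, φ v ≤ 1) (hφi : Integrable φ)
    {τ : ℝ} (hτ : 0 < τ) :
    ∫ v, φ v ∂(rescaledLaw p q ν τ) ≤
      a + b * Real.exp (((p - 1) ^ 2 / q / p + 1) * τ) * ∫ v, φ v := by
  rw [integral_rescaledLaw]
  have hc0 : 0 < Real.exp (-((p + q - 1) * (τ / q))) := Real.exp_pos _
  refine (h.integral_le_of_initial hα hp ha hb h0
    (hφ.comp (contDiff_const.mul contDiff_id)) (fun v => hφ0 _) (fun v => hφ1 _)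
    (hφi.comp_mul_left' hc0.ne') (div_pos hτ hq)).trans_eq ?_
  simp only [Function.comp_def, id]
  rw [Measure.integral_comp_mul_left (fun v => φ v), abs_of_pos (inv_pos.2 hc0), smul_eq_mul,
    ← Real.exp_neg, mul_assoc b, ← mul_assoc (Real.exp _), ← Real.exp_add, mul_assoc b]
  -- The exponents of growth and dilation add up to `((p⁻¹ - 1) + (p + q - 1)) / q = (p - 1) ^ 2 /
  -- (q * p) + 1`, which stays bounded in the limit although each of them may blow up.
  congr 4
  field_simp
  ring

/-- The mean being an explicit exponential, the self-similar density is the density of the dilated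
law. -/
theorem IsBoltzmannSolution.integral_rescaled {f₀ : ℝ → ℝ} {f : ℝ → ℝ → ℝ}
    (hf₀ : IsDensityWithMoment α f₀) (h : IsBoltzmannSolution p q α f₀ f) (hα : 1 ≤ α)
    (hq : 0 < q) (hm : ∫ v, v * f₀ v = 1) (φ : ℝ → ℝ) {τ : ℝ} (hτ : 0 < τ) :
    ∫ v, φ v * rescaled q f τ v =
      ∫ v, φ v ∂(rescaledLaw p q (fun t => densityMeasure (f t)) τ) := by
  have ht := div_pos hτ hq
  have hd := h.density _ ht
  have hmean : meanWealth f (τ / q) = Real.exp ((p + q - 1) * (τ / q)) := by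
    rw [meanWealth, ← integral_densityMeasure hd.integrable hd.nonneg fun v => v]
    refine (h.isBoltzmannFlow hf₀).mean hα ?_ ht
    rwa [integral_densityMeasure hf₀.integrable hf₀.nonneg]
  set E := Real.exp ((p + q - 1) * (τ / q)) with hE
  have hE0 : 0 < E := Real.exp_pos _
  rw [integral_rescaledLaw, integral_densityMeasure hd.integrable hd.nonneg, Real.exp_neg, ← hE]
  have := Measure.integral_comp_mul_left (fun u => φ (E⁻¹ * u) * f (τ / q) u) E
  simp only [inv_mul_cancel_left₀ hE0.ne'] at this
  simp only [rescaled, selfSimilar, hmean]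
  rw [abs_of_pos (inv_pos.2 hE0), smul_eq_mul] at this
  have e : ∀ v, φ v * (E * f (τ / q) (E * v)) = E * (φ v * f (τ / q) (E * v)) := fun v => by ring
  simp only [e]
  rw [integral_const_mul, this, mul_inv_cancel_left₀ hE0.ne']

end Rescale

/-! ### Smooth tail weights with bounds uniform in the truncation parameter. -/

section TailWeight

variable {α R : ℝ}

/-- A smooth weight equivalent to `|v| ^ α` on `|v| ≥ √R` and small elsewhere. -/
noncomputable def tailWeight (α R v : ℝ) : ℝ := (1 + v ^ 2) ^ (α / 2 + 1) / (1 + v ^ 2 + R)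

theorem one_add_sq_pos (v : ℝ) : 0 < 1 + v ^ 2 := by positivity

theorem tailWeight_nonneg (hR : 0 ≤ R) (v : ℝ) : 0 ≤ tailWeight α R v := by
  unfold tailWeight; positivity

theorem tailWeight_eq (v : ℝ) :
    tailWeight α R v = smoothWeight α v * ((1 + v ^ 2) / (1 + v ^ 2 + R)) := by
  rw [tailWeight, smoothWeight, Real.rpow_add (one_add_sq_pos v), Real.rpow_one, mul_div_assoc]

theorem tailWeight_le (hR : 0 ≤ R) (v : ℝ) : tailWeight α R v ≤ smoothWeight α v := by
  rw [tailWeight_eq]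
  refine mul_le_of_le_one_right (smoothWeight_pos v).le ?_
  have := one_add_sq_pos v
  exact (div_le_one (by positivity)).2 (by linarith)

theorem smoothWeight_le_tailWeight (hR : 0 ≤ R) {v : ℝ} (h : R ≤ 1 + v ^ 2) :
    smoothWeight α v ≤ 2 * tailWeight α R v := by
  rw [tailWeight_eq]
  have h1 := one_add_sq_pos v
  have h2 : 1 / 2 ≤ (1 + v ^ 2) / (1 + v ^ 2 + R) := by
    rw [div_le_div_iff₀ (by norm_num) (by positivity)]
    linarith
  nlinarith [smoothWeight_pos (α := α) v]

theorem contDiff_tailWeight (hR : 0 ≤ R) : ContDiff ℝ (⊤ : ℕ∞) (tailWeight α R) := by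
  have h1 : ContDiff ℝ (⊤ : ℕ∞) fun v : ℝ => 1 + v ^ 2 := contDiff_const.add (contDiff_id.pow 2)
  refine (h1.rpow_const_of_ne fun v => (one_add_sq_pos v).ne').div (h1.add contDiff_const)
    fun v => ?_
  have := one_add_sq_pos v
  positivity

/-- The logarithmic derivative of the tail weight. -/
noncomputable def tailLogDeriv (α R v : ℝ) : ℝ :=
  2 * v / (1 + v ^ 2) * (α / 2 + 1 - (1 + v ^ 2) / (1 + v ^ 2 + R))

theorem hasDerivAt_one_add_sq (v : ℝ) : HasDerivAt (fun v : ℝ => 1 + v ^ 2) (2 * v) v := by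
  simpa using (hasDerivAt_pow 2 v).const_add 1

theorem hasDerivAt_tailWeight (hR : 0 ≤ R) (v : ℝ) :
    HasDerivAt (tailWeight α R) (tailWeight α R v * tailLogDeriv α R v) v := by
  have h0 := one_add_sq_pos v
  have h1 := (hasDerivAt_one_add_sq v).rpow_const (p := α / 2 + 1) (Or.inl h0.ne')
  have h2 := (hasDerivAt_one_add_sq v).add_const R
  refine (h1.div h2 (by positivity)).congr_deriv ?_
  rw [tailWeight, tailLogDeriv, Real.rpow_sub_one h0.ne']
  field_simp

theorem hasDerivAt_tailLogDeriv (hR : 0 ≤ R) (v : ℝ) :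
    HasDerivAt (tailLogDeriv α R)
      ((2 / (1 + v ^ 2) - 4 * v ^ 2 / (1 + v ^ 2) ^ 2) *
        (α / 2 + 1 - (1 + v ^ 2) / (1 + v ^ 2 + R)) -
        2 * v / (1 + v ^ 2) * (2 * v * R / (1 + v ^ 2 + R) ^ 2)) v := by
  have h0 := one_add_sq_pos v
  have h2 := (hasDerivAt_one_add_sq v).add_const R
  have h3 := (((hasDerivAt_id v).const_mul 2).div (hasDerivAt_one_add_sq v) h0.ne').mul
    (((hasDerivAt_one_add_sq v).div h2 (by positivity)).const_sub (α / 2 + 1))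
  refine h3.congr_deriv ?_
  simp only [id, Pi.div_apply]
  field_simp
  ring

theorem deriv_tailWeight (hR : 0 ≤ R) :
    deriv (tailWeight α R) = fun v => tailWeight α R v * tailLogDeriv α R v :=
  funext fun v => (hasDerivAt_tailWeight hR v).deriv

theorem tail_ratio_mem (hR : 0 ≤ R) (v : ℝ) :
    0 ≤ (1 + v ^ 2) / (1 + v ^ 2 + R) ∧ (1 + v ^ 2) / (1 + v ^ 2 + R) ≤ 1 := by
  have h0 := one_add_sq_pos v
  exact ⟨by positivity, (div_le_one (by positivity)).2 (by linarith)⟩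

/-- Both `v ^ 2 / (1 + v ^ 2)` and the ratio in the definition lie in `[0, 1]`. The bound is
independent of `R`, which is what makes the later Grönwall constant independent of `R`. -/
theorem abs_mul_tailLogDeriv_le (hα : 0 ≤ α) (hR : 0 ≤ R) (v : ℝ) :
    |v * tailLogDeriv α R v| ≤ α + 2 := by
  have h0 := one_add_sq_pos v
  obtain ⟨h1, h2⟩ := tail_ratio_mem hR v
  have e : v * tailLogDeriv α R v =
      2 * (v ^ 2 / (1 + v ^ 2)) * (α / 2 + 1 - (1 + v ^ 2) / (1 + v ^ 2 + R)) := by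
    rw [tailLogDeriv]; ring
  have h3 : 0 ≤ v ^ 2 / (1 + v ^ 2) := by positivity
  have h4 : v ^ 2 / (1 + v ^ 2) ≤ 1 := (div_le_one h0).2 (by linarith)
  rw [e, abs_of_nonneg (mul_nonneg (by positivity) (by linarith))]
  nlinarith

theorem abs_mul_deriv_tailWeight_le (hα : 0 ≤ α) (hR : 0 ≤ R) (v : ℝ) :
    |v * deriv (tailWeight α R) v| ≤ (α + 2) * tailWeight α R v := by
  rw [deriv_tailWeight hR]
  simp only
  rw [mul_left_comm, abs_mul, abs_of_nonneg (tailWeight_nonneg hR v), mul_comm]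
  exact mul_le_mul_of_nonneg_right (abs_mul_tailLogDeriv_le hα hR v) (tailWeight_nonneg hR v)

theorem abs_sq_mul_deriv_deriv_tailWeight_le (hα : 0 ≤ α) (hR : 0 ≤ R) (v : ℝ) :
    |v ^ 2 * deriv (deriv (tailWeight α R)) v| ≤
      ((α + 2) ^ 2 + (3 * α + 10)) * tailWeight α R v := by
  have h0 := one_add_sq_pos v
  obtain ⟨h1, h2⟩ := tail_ratio_mem hR v
  have hd := (hasDerivAt_tailWeight (α := α) hR v).mul (hasDerivAt_tailLogDeriv (α := α) hR v)
  rw [deriv_tailWeight hR, show deriv (fun v => tailWeight α R v * tailLogDeriv α R v) v = _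
    from hd.deriv]
  -- In terms of `x`, `r`, `y`, all in `[0, 1]`, the second derivative is a polynomial multiple of
  -- the weight with bounded coefficients.
  set x := v ^ 2 / (1 + v ^ 2) with hx
  set r := (1 + v ^ 2) / (1 + v ^ 2 + R) with hr
  set y := R / (1 + v ^ 2 + R) with hy
  have hx0 : 0 ≤ x := by positivity
  have hx1 : x ≤ 1 := (div_le_one h0).2 (by linarith)
  have hy0 : 0 ≤ y := by positivity
  have hy1 : y ≤ 1 := (div_le_one (by positivity)).2 (by linarith)
  have e : v ^ 2 * (tailWeight α R v * tailLogDeriv α R v * tailLogDeriv α R v +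
      tailWeight α R v * ((2 / (1 + v ^ 2) - 4 * v ^ 2 / (1 + v ^ 2) ^ 2) *
        (α / 2 + 1 - r) - 2 * v / (1 + v ^ 2) * (2 * v * R / (1 + v ^ 2 + R) ^ 2))) =
      ((v * tailLogDeriv α R v) ^ 2 + ((2 * x - 4 * x ^ 2) * (α / 2 + 1 - r) -
        4 * x ^ 2 * r * y)) * tailWeight α R v := by
    simp only [hx, hr, hy]
    field_simp
    ring
  rw [e, abs_mul, abs_of_nonneg (tailWeight_nonneg hR v)]
  refine mul_le_mul_of_nonneg_right ((abs_add_le _ _).trans (add_le_add ?_ ?_))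
    (tailWeight_nonneg hR v)
  · rw [abs_pow]
    exact pow_le_pow_left₀ (abs_nonneg _) (abs_mul_tailLogDeriv_le hα hR v) 2
  · have hx2 : x ^ 2 ≤ 1 := pow_le_one₀ hx0 hx1
    have hg0 : 0 ≤ α / 2 + 1 - r := by linarith
    have a1 : |(2 * x - 4 * x ^ 2) * (α / 2 + 1 - r)| ≤ 6 * (α / 2 + 1) := by
      rw [abs_mul, abs_of_nonneg hg0]
      refine mul_le_mul ?_ (by linarith) hg0 (by norm_num)
      rw [abs_le]
      constructor <;> nlinarith
    have a2 : |4 * x ^ 2 * r * y| ≤ 4 := by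
      rw [abs_of_nonneg (by positivity)]
      have : x ^ 2 * r ≤ 1 := mul_le_one₀ hx2 h1 h2
      have : x ^ 2 * r * y ≤ 1 := mul_le_one₀ this hy0 hy1
      linarith
    refine (abs_sub _ _).trans ?_
    linarith

theorem tailWeight_le_mul (hα : 0 ≤ α) (hR : 0 ≤ R) {x y : ℝ} (h : |x| ≤ 3 * |y|) :
    tailWeight α R x ≤ 9 ^ (α / 2 + 1) * tailWeight α R y := by
  have h0 := one_add_sq_pos x
  have h0' := one_add_sq_pos y
  have hxy : x ^ 2 ≤ 9 * y ^ 2 := by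
    rw [← sq_abs x, ← sq_abs y]
    nlinarith [abs_nonneg x, abs_nonneg y]
  have hsq := sq_nonneg y
  -- the weight is increasing in `1 + v ^ 2`
  have hr : (1 + x ^ 2) / (1 + x ^ 2 + R) ≤ 9 * ((1 + y ^ 2) / (1 + y ^ 2 + R)) := by
    rw [mul_div_assoc', div_le_div_iff₀ (by positivity) (by positivity)]
    nlinarith [mul_nonneg hR hsq, mul_pos h0 h0', mul_nonneg hR h0'.le]
  have hs : smoothWeight α x ≤ 9 ^ (α / 2) * smoothWeight α y := by
    rw [smoothWeight, smoothWeight, ← Real.mul_rpow (by norm_num) h0'.le]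
    exact Real.rpow_le_rpow h0.le (by linarith) (by linarith)
  rw [tailWeight_eq, tailWeight_eq, Real.rpow_add (by norm_num), Real.rpow_one]
  calc smoothWeight α x * ((1 + x ^ 2) / (1 + x ^ 2 + R))
      ≤ (9 ^ (α / 2) * smoothWeight α y) * (9 * ((1 + y ^ 2) / (1 + y ^ 2 + R))) :=
        mul_le_mul hs hr (tail_ratio_mem hR x).1
          (mul_nonneg (by positivity) (smoothWeight_pos y).le)
    _ = _ := by ring

/-- Controls the exchange term, where the increment is proportional to `w` and the derivative is
taken at a smaller point `u`. The bound on the derivative is monotone in `|u|` because `α ≥ 1`, so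
it may be compared with its value at `w`. -/
theorem abs_mul_deriv_tailWeight_le_of_le (hα : 1 ≤ α) (hR : 0 ≤ R) {u w : ℝ} (h : |u| ≤ |w|) :
    |w * deriv (tailWeight α R) u| ≤ (α + 2) * tailWeight α R w := by
  have hY := one_add_sq_pos u
  have hX := one_add_sq_pos w
  have hsq : u ^ 2 ≤ w ^ 2 := sq_le_sq.2 h
  obtain ⟨h1, h2⟩ := tail_ratio_mem hR u
  have hb : |deriv (tailWeight α R) u| ≤
      (α + 2) * (|u| / (1 + u ^ 2) * tailWeight α R u) := by
    rw [deriv_tailWeight hR]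
    simp only
    rw [abs_mul, abs_of_nonneg (tailWeight_nonneg hR u), tailLogDeriv, abs_mul, abs_div, abs_mul,
      abs_of_pos hY, abs_two, abs_of_nonneg (by linarith : 0 ≤ α / 2 + 1 -
        (1 + u ^ 2) / (1 + u ^ 2 + R))]
    have : 0 ≤ |u| / (1 + u ^ 2) * tailWeight α R u :=
      mul_nonneg (by positivity) (tailWeight_nonneg hR u)
    calc tailWeight α R u * (2 * |u| / (1 + u ^ 2) *
          (α / 2 + 1 - (1 + u ^ 2) / (1 + u ^ 2 + R)))
        = (2 * (α / 2 + 1 - (1 + u ^ 2) / (1 + u ^ 2 + R))) *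
          (|u| / (1 + u ^ 2) * tailWeight α R u) := by ring
      _ ≤ _ := mul_le_mul_of_nonneg_right (by linarith) this
  rw [abs_mul]
  refine (mul_le_mul_of_nonneg_left hb (abs_nonneg w)).trans ?_
  rw [mul_left_comm]
  refine mul_le_mul_of_nonneg_left ?_ (by linarith)
  -- monotonicity of `|u| (1 + u ^ 2) ^ (α / 2) / (1 + u ^ 2 + R)`
  set c := α / 2 - 1 / 2 with hc
  have hc0 : 0 ≤ c := by linarith
  -- One square root and one full power are split off; the remaining exponent `c = (α - 1) / 2` is
  -- nonnegative.
  have ew : ∀ v, tailWeight α R v = (1 + v ^ 2) ^ c * (Real.sqrt (1 + v ^ 2) *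
      (1 + v ^ 2) / (1 + v ^ 2 + R)) := fun v => by
    have := one_add_sq_pos v
    rw [tailWeight, show α / 2 + 1 = c + 1 / 2 + 1 by rw [hc]; ring, Real.rpow_add this,
      Real.rpow_add this, Real.rpow_one, ← Real.sqrt_eq_rpow]
    ring
  have hsu := Real.sqrt_pos.2 hY
  have hsw := Real.sqrt_pos.2 hX
  have hmono : (1 + u ^ 2) ^ c ≤ (1 + w ^ 2) ^ c := Real.rpow_le_rpow hY.le (by linarith) hc0
  have hwle : |w| ≤ Real.sqrt (1 + w ^ 2) := Real.abs_le_sqrt (by linarith)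
  have hsle : Real.sqrt (1 + u ^ 2) ≤ Real.sqrt (1 + w ^ 2) := Real.sqrt_le_sqrt (by linarith)
  -- The function `|u| / √(1 + u ^ 2)` increases with `|u|`.
  have hcross : |u| * Real.sqrt (1 + w ^ 2) ≤ |w| * Real.sqrt (1 + u ^ 2) := by
    rw [← Real.sqrt_sq_eq_abs, ← Real.sqrt_sq_eq_abs, ← Real.sqrt_mul (sq_nonneg _),
      ← Real.sqrt_mul (sq_nonneg _)]
    exact Real.sqrt_le_sqrt (by nlinarith)
  have hmain : |w| * (|u| * Real.sqrt (1 + u ^ 2) / (1 + u ^ 2 + R)) ≤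
      Real.sqrt (1 + w ^ 2) * (1 + w ^ 2) / (1 + w ^ 2 + R) := by
    have k1 : |u| * Real.sqrt (1 + u ^ 2) * (1 + w ^ 2) ≤
        |w| * Real.sqrt (1 + w ^ 2) * (1 + u ^ 2) := by
      have e1 := Real.mul_self_sqrt hX.le
      have e2 := Real.mul_self_sqrt hY.le
      calc |u| * Real.sqrt (1 + u ^ 2) * (1 + w ^ 2)
          = |u| * Real.sqrt (1 + w ^ 2) * (Real.sqrt (1 + u ^ 2) * Real.sqrt (1 + w ^ 2)) := by
            linear_combination (-(|u| * Real.sqrt (1 + u ^ 2))) * e1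
        _ ≤ |w| * Real.sqrt (1 + u ^ 2) * (Real.sqrt (1 + u ^ 2) * Real.sqrt (1 + w ^ 2)) :=
            mul_le_mul_of_nonneg_right hcross (by positivity)
        _ = _ := by linear_combination (|w| * Real.sqrt (1 + w ^ 2)) * e2
    have k2 : |u| * Real.sqrt (1 + u ^ 2) ≤ |w| * Real.sqrt (1 + w ^ 2) :=
      mul_le_mul h hsle hsu.le (abs_nonneg _)
    have k3 : |u| * Real.sqrt (1 + u ^ 2) / (1 + u ^ 2 + R) ≤
        |w| * Real.sqrt (1 + w ^ 2) / (1 + w ^ 2 + R) := by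
      rw [div_le_div_iff₀ (by positivity) (by positivity)]
      nlinarith [mul_le_mul_of_nonneg_right k2 hR]
    have k4 : |w| * |w| ≤ 1 + w ^ 2 := by rw [← sq, sq_abs]; linarith
    calc |w| * (|u| * Real.sqrt (1 + u ^ 2) / (1 + u ^ 2 + R))
        ≤ |w| * (|w| * Real.sqrt (1 + w ^ 2) / (1 + w ^ 2 + R)) :=
          mul_le_mul_of_nonneg_left k3 (abs_nonneg _)
      _ = (|w| * |w|) * (Real.sqrt (1 + w ^ 2) / (1 + w ^ 2 + R)) := by ring
      _ ≤ (1 + w ^ 2) * (Real.sqrt (1 + w ^ 2) / (1 + w ^ 2 + R)) :=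
          mul_le_mul_of_nonneg_right k4 (by positivity)
      _ = _ := by ring
  rw [ew u, ew w]
  calc |w| * (|u| / (1 + u ^ 2) * ((1 + u ^ 2) ^ c * (Real.sqrt (1 + u ^ 2) * (1 + u ^ 2) /
        (1 + u ^ 2 + R))))
      = (1 + u ^ 2) ^ c * (|w| * (|u| * Real.sqrt (1 + u ^ 2) / (1 + u ^ 2 + R))) := by
        field_simp
    _ ≤ (1 + w ^ 2) ^ c * (Real.sqrt (1 + w ^ 2) * (1 + w ^ 2) / (1 + w ^ 2 + R)) :=
        mul_le_mul hmono hmain (by positivity) (by positivity)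

theorem regularTest_tailWeight (hα : 0 ≤ α) (hR : 0 ≤ R) : RegularTest α (tailWeight α R) := by
  have h : HasGrowth α (tailWeight α R) := ⟨2 ^ α, fun v => by
    rw [abs_of_nonneg (tailWeight_nonneg hR v)]
    exact (tailWeight_le hR v).trans (smoothWeight_le hα v)⟩
  refine ⟨contDiff_tailWeight hR, h, ?_, ?_⟩
  · obtain ⟨C, hC⟩ := h.const_mul (α + 2)
    exact ⟨C, fun v => (abs_mul_deriv_tailWeight_le hα hR v).trans ((le_abs_self _).trans (hC v))⟩
  · obtain ⟨C, hC⟩ := h.const_mul ((α + 2) ^ 2 + (3 * α + 10))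
    exact ⟨C, fun v =>
      (abs_sq_mul_deriv_deriv_tailWeight_le hα hR v).trans ((le_abs_self _).trans (hC v))⟩

end TailWeight

/-! ### Uniform propagation of tails by the generator. -/

/-- The regime of parameters in which the estimates are uniform. -/
structure IsTradeRegime (lam p q : ℝ) : Prop where
  q_pos : 0 < q
  q_le : q ≤ 1
  le_p : 1 / 2 ≤ p
  p_le : p ≤ 2
  eq_lam : (p - 1) ^ 2 / q = lam

section Generator

variable {lam p q α R : ℝ}

theorem IsTradeRegime.sq_eq (h : IsTradeRegime lam p q) : (p - 1) ^ 2 = lam * q :=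
  (div_eq_iff h.q_pos.ne').1 h.eq_lam

theorem IsTradeRegime.lam_nonneg (h : IsTradeRegime lam p q) : 0 ≤ lam := by
  rw [← h.eq_lam]
  exact div_nonneg (sq_nonneg _) h.q_pos.le

theorem IsTradeRegime.factor_mem (h : IsTradeRegime lam p q) {r : ℝ} (hr : r ∈ Set.uIcc (0 : ℝ) 1) :
    1 / 2 ≤ 1 + r * (p - 1) ∧ 1 + r * (p - 1) ≤ 2 := by
  rw [Set.uIcc_of_le zero_le_one] at hr
  obtain ⟨h0, h1⟩ := hr
  have := h.le_p
  have := h.p_le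
  constructor <;> nlinarith

/-- The compensator splits as `p + q - 1 = (p - 1) + q`. The first part leaves a second-order
remainder of size `(p - 1) ^ 2 = lam * q`, the second gives the drift `-v * φ'`, and the exchange
increment is of order `q`; all terms are bounded after division by `q`. -/
theorem tradeGenerator_eq (φ : ℝ → ℝ) (hq : q ≠ 0) (v w : ℝ) :
    tradeGenerator p q φ (v, w) = q⁻¹ * (φ (p * v + q * w) - φ (p * v)) +
      q⁻¹ * (φ (p * v) - φ v - (p - 1) * v * deriv φ v) - v * deriv φ v := by
  simp only [tradeGenerator]
  field_simp
  ring

/-- The uniform constant in the bound of the generator on the tail weights. -/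
noncomputable def tailConst (lam α : ℝ) : ℝ :=
  (α + 2) * 9 ^ (α / 2 + 1) + lam * (4 * ((α + 2) ^ 2 + (3 * α + 10)) * 9 ^ (α / 2 + 1)) + (α + 2)

/-- The three parts of the splitting are bounded separately by the mean value inequality, the
second-order Taylor inequality and the bound on `v * χ'`, with no dependence on `R`, `p` or `q`. -/
theorem abs_tradeGenerator_tailWeight_le (h : IsTradeRegime lam p q) (hα : 1 ≤ α) (hR : 0 ≤ R)
    {v w : ℝ} (hv : 0 ≤ v) (hw : 0 ≤ w) :
    |tradeGenerator p q (tailWeight α R) (v, w)| ≤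
      tailConst lam α * (tailWeight α R v + tailWeight α R w) := by
  have hα0 := zero_le_one.trans hα
  have hq := h.q_pos
  set χ := tailWeight α R with hχ
  have hsm : ContDiff ℝ (⊤ : ℕ∞) χ := contDiff_tailWeight hR
  have hχ0 : ∀ x, 0 ≤ χ x := tailWeight_nonneg hR
  set D : ℝ := 9 ^ (α / 2 + 1) with hD
  have hD1 : 1 ≤ D := Real.one_le_rpow (by norm_num) (by linarith)
  set C₂ := (α + 2) ^ 2 + (3 * α + 10) with hC₂
  have hC₂0 : 0 ≤ C₂ := by positivity
  have b1 : |χ (p * v + q * w) - χ (p * v)| ≤ q * ((α + 2) * D * (χ v + χ w)) := by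
    have hd : ∀ r, HasDerivAt (fun r => χ (p * v + q * w * r))
        (deriv χ (p * v + q * w * r) * (q * w)) r := fun r => by
      have h1 : HasDerivAt (fun r => p * v + q * w * r) (q * w) r := by
        simpa using ((hasDerivAt_id r).const_mul (q * w)).const_add (p * v)
      exact (hasDerivAt_of_smooth hsm _).comp r h1
    have := abs_sub_le_of_hasDerivAt (s := 1) (t := 0) (M := q * ((α + 2) * D * (χ v + χ w))) hd
      fun r hr => ?_
    · simpa using this
    · rw [Set.uIcc_of_le zero_le_one] at hr
      obtain ⟨hr0, hr1⟩ := hr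
      set u := p * v + q * w * r with hu
      have hp0 : 0 ≤ p := by linarith [h.le_p]
      have hu0 : 0 ≤ u := by positivity
      rw [show deriv χ u * (q * w) = q * (w * deriv χ u) by ring, abs_mul, abs_of_pos hq]
      refine mul_le_mul_of_nonneg_left ?_ hq.le
      -- For `u ≤ w` the derivative bound at a smaller point applies; for `w ≤ u` the factor `w` is
      -- enlarged to `u`.
      rcases le_total u w with huw | huw
      · refine (abs_mul_deriv_tailWeight_le_of_le hα hR
          (by rwa [abs_of_nonneg hu0, abs_of_nonneg hw])).trans ?_
        rw [mul_assoc]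
        refine mul_le_mul_of_nonneg_left ?_ (by linarith)
        calc χ w ≤ 1 * (χ v + χ w) := by linarith [hχ0 v]
          _ ≤ D * (χ v + χ w) := mul_le_mul_of_nonneg_right hD1 (add_nonneg (hχ0 v) (hχ0 w))
      · have h1 : |w * deriv χ u| ≤ |u * deriv χ u| := by
          rw [abs_mul, abs_mul, abs_of_nonneg hw, abs_of_nonneg hu0]
          exact mul_le_mul_of_nonneg_right huw (abs_nonneg _)
        refine (h1.trans (abs_mul_deriv_tailWeight_le hα0 hR u)).trans ?_
        rw [mul_assoc]
        refine mul_le_mul_of_nonneg_left ?_ (by linarith)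
        -- Hence `u ≤ 3 * max v w`, which explains the base `9 = 3 ^ 2` in `D`.
        have hle : u ≤ 2 * v + w := by
          have h2 : p * v ≤ 2 * v := mul_le_mul_of_nonneg_right h.p_le hv
          have h3 : q * w * r ≤ 1 * w * 1 := by
            have := h.q_le
            gcongr
          linarith
        rcases le_total v w with hvw | hvw
        · have := tailWeight_le_mul hα0 hR (x := u) (y := w)
            (by rw [abs_of_nonneg hu0, abs_of_nonneg hw]; linarith)
          refine this.trans (mul_le_mul_of_nonneg_left ?_ (by positivity))
          linarith [hχ0 v]
        · have := tailWeight_le_mul hα0 hR (x := u) (y := v)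
            (by rw [abs_of_nonneg hu0, abs_of_nonneg hv]; linarith)
          refine this.trans (mul_le_mul_of_nonneg_left ?_ (by positivity))
          linarith [hχ0 w]
  have b2 : |χ (p * v) - χ v - (p - 1) * v * deriv χ v| ≤ q * (lam * (4 * C₂ * D) * χ v) := by
    have h1 : ∀ r, HasDerivAt (fun r => v * (1 + r * (p - 1))) (v * (p - 1)) r := fun r => by
      simpa using ((((hasDerivAt_id r).mul_const (p - 1)).const_add 1).const_mul v)
    have hd : ∀ r, HasDerivAt (fun r => χ (v * (1 + r * (p - 1))))
        (deriv χ (v * (1 + r * (p - 1))) * (v * (p - 1))) r := fun r =>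
      (hasDerivAt_of_smooth hsm _).comp r (h1 r)
    have hd2 : ∀ r, HasDerivAt (fun r => deriv χ (v * (1 + r * (p - 1))) * (v * (p - 1)))
        (deriv (deriv χ) (v * (1 + r * (p - 1))) * (v * (p - 1)) * (v * (p - 1))) r := fun r =>
      ((hasDerivAt_of_smooth (contDiff_deriv_infty hsm) _).comp r (h1 r)).mul_const _
    have := abs_taylor_one_le (s := 1) (t := 0) (M := q * (lam * (4 * C₂ * D) * χ v)) hd hd2
      fun r hr => ?_
    · simp only [zero_mul, add_zero, mul_one, sub_zero, one_mul, one_pow] at this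
      convert this using 2
      ring_nf
    · obtain ⟨k1, k2⟩ := h.factor_mem hr
      set k := 1 + r * (p - 1) with hk
      set ξ := v * k with hξ
      rw [show deriv (deriv χ) ξ * (v * (p - 1)) * (v * (p - 1)) =
        (p - 1) ^ 2 * (v ^ 2 * deriv (deriv χ) ξ) by ring, abs_mul, abs_of_nonneg (sq_nonneg _),
        h.sq_eq, show q * (lam * (4 * C₂ * D) * χ v) = lam * q * (4 * (C₂ * (D * χ v))) by ring]
      refine mul_le_mul_of_nonneg_left ?_ (mul_nonneg h.lam_nonneg hq.le)
      have hvξ : v ^ 2 ≤ 4 * ξ ^ 2 := by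
        have : 1 ≤ 4 * k ^ 2 := by nlinarith
        rw [hξ, mul_pow]
        nlinarith [sq_nonneg v]
      have e1 : |v ^ 2 * deriv (deriv χ) ξ| ≤ 4 * |ξ ^ 2 * deriv (deriv χ) ξ| := by
        rw [abs_mul, abs_mul, abs_of_nonneg (sq_nonneg v), abs_of_nonneg (sq_nonneg ξ), ← mul_assoc]
        exact mul_le_mul_of_nonneg_right hvξ (abs_nonneg _)
      refine e1.trans (mul_le_mul_of_nonneg_left ?_ (by norm_num))
      refine (abs_sq_mul_deriv_deriv_tailWeight_le hα0 hR ξ).trans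
        (mul_le_mul_of_nonneg_left ?_ hC₂0)
      refine tailWeight_le_mul hα0 hR ?_
      rw [hξ, abs_mul, abs_of_nonneg (by linarith : 0 ≤ k), mul_comm]
      exact mul_le_mul_of_nonneg_right (by linarith) (abs_nonneg _)
  have b3 := abs_mul_deriv_tailWeight_le hα0 hR v
  rw [tradeGenerator_eq _ hq.ne', tailConst]
  refine (abs_sub _ _).trans ((add_le_add ((abs_add_le _ _).trans
    (add_le_add (b := (α + 2) * D * (χ v + χ w)) (d := lam * (4 * C₂ * D) * χ v) ?_ ?_)) b3).trans ?_)
  · rw [abs_mul, abs_of_pos (inv_pos.2 hq), inv_mul_le_iff₀ hq]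
    exact b1
  · rw [abs_mul, abs_of_pos (inv_pos.2 hq), inv_mul_le_iff₀ hq]
    exact b2
  · have h1 : 0 ≤ lam * (4 * C₂ * D) := mul_nonneg h.lam_nonneg (by positivity)
    have h2 := mul_nonneg h1 (hχ0 w)
    have h3 : 0 ≤ (α + 2) * χ w := mul_nonneg (by linarith) (hχ0 w)
    nlinarith

variable {ν₀ : Measure ℝ} {ρ : ℝ → Measure ℝ}

theorem RegularTest.integrable_tradeGenerator (hα : 0 ≤ α) {φ : ℝ → ℝ} (hφ : RegularTest α φ)
    {μ : Measure ℝ} (hμ : IsWealthLaw α μ) : Integrable (tradeGenerator p q φ) (μ.prod μ) := by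
  have hc := hφ.smooth.continuous
  have hc' := (contDiff_deriv_infty hφ.smooth).continuous
  exact (((hμ.integrable_trade hα hμ hc hφ.growth p q).sub
    (hμ.integrable_comp_fst hμ hc hφ.growth)).sub ((hμ.integrable_comp_fst hμ
      (continuous_id.mul hc') hφ.growth_deriv).const_mul (p + q - 1))).const_mul q⁻¹

theorem IsWealthLaw.ae_prod_nonneg {μ : Measure ℝ} (hμ : IsWealthLaw α μ) :
    ∀ᵐ z ∂(μ.prod μ), 0 ≤ z.1 ∧ 0 ≤ z.2 := by
  have := hμ.prob
  filter_upwards [(Measure.quasiMeasurePreserving_fst (μ := μ) (ν := μ)).ae hμ.ae_nonneg,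
    (Measure.quasiMeasurePreserving_snd (μ := μ) (ν := μ)).ae hμ.ae_nonneg] with z h1 h2
    using ⟨h1, h2⟩

/-- Uniform propagation of the tails. -/
theorem IsRescaledFlow.integral_tailWeight_le (h : IsRescaledFlow p q α ν₀ ρ)
    (hr : IsTradeRegime lam p q) (hα : 1 ≤ α) (hR : 0 ≤ R) {τ : ℝ} (hτ : 0 < τ) :
    ∫ v, tailWeight α R v ∂(ρ τ) ≤
      Real.exp (2 * tailConst lam α * τ) * ∫ v, tailWeight α R v ∂ν₀ := by
  have hα0 := zero_le_one.trans hα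
  have hreg := regularTest_tailWeight hα0 hR
  refine le_exp_mul_of_hasDerivAt_le (fun t ht => h.hasDerivAt _ hreg t ht) (fun t ht => ?_)
    (h.initial _ hreg) hτ
  have hρ := h.law t ht
  have := hρ.prob
  have hi := hρ.integrable hreg.smooth.continuous hreg.growth
  have i1 := hρ.integrable_comp_fst hρ hreg.smooth.continuous hreg.growth
  have i2 : Integrable (fun z : ℝ × ℝ => tailWeight α R z.2) ((ρ t).prod (ρ t)) := hi.comp_snd _
  calc ∫ z, tradeGenerator p q (tailWeight α R) z ∂((ρ t).prod (ρ t))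
      ≤ ∫ z : ℝ × ℝ, tailConst lam α * (tailWeight α R z.1 + tailWeight α R z.2)
        ∂((ρ t).prod (ρ t)) := by
        refine integral_mono_ae (hreg.integrable_tradeGenerator hα0 hρ)
          ((i1.add i2).const_mul _) ?_
        filter_upwards [hρ.ae_prod_nonneg] with z hz
        exact (le_abs_self _).trans (abs_tradeGenerator_tailWeight_le hr hα hR hz.1 hz.2)
    _ = 2 * tailConst lam α * ∫ v, tailWeight α R v ∂(ρ t) := by
        rw [integral_const_mul, integral_add i1 i2, hρ.integral_fst, hρ.integral_snd]
        ring

/-- Dominated convergence with the full weight. No moment of order above `α` is used, so propagated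
tails are still small for the initial datum of exact order `α`. -/
theorem tendsto_integral_tailWeight {μ : Measure ℝ} (hα : 0 ≤ α) (hμ : IsWealthLaw α μ) :
    Tendsto (fun n : ℕ => ∫ v, tailWeight α n v ∂μ) atTop (𝓝 0) := by
  have h : Tendsto (fun n : ℕ => ∫ v, tailWeight α n v ∂μ) atTop (𝓝 (∫ _, (0 : ℝ) ∂μ)) := by
    refine tendsto_integral_of_dominated_convergence (smoothWeight α)
      (fun n => (contDiff_tailWeight n.cast_nonneg).continuous.aestronglyMeasurable)
      (hμ.integrable contDiff_smoothWeight.continuous (smoothTest_smoothWeight hα).hasGrowth)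
      (fun n => Eventually.of_forall fun v => ?_) (Eventually.of_forall fun v => ?_)
    · rw [Real.norm_of_nonneg (tailWeight_nonneg n.cast_nonneg v)]
      exact tailWeight_le n.cast_nonneg v
    · exact tendsto_const_nhds.div_atTop (tendsto_atTop_add_const_left _ _
        tendsto_natCast_atTop_atTop)
  simpa using h

theorem tailWeight_zero (v : ℝ) : tailWeight α 0 v = smoothWeight α v := by
  rw [tailWeight_eq, add_zero, div_self (one_add_sq_pos v).ne', mul_one]

theorem IsRescaledFlow.integral_weight_le (h : IsRescaledFlow p q α ν₀ ρ)
    (hr : IsTradeRegime lam p q) (hα : 1 ≤ α) {τ : ℝ} (hτ : 0 < τ) :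
    ∫ v, (1 + |v| ^ α) ∂(ρ τ) ≤
      2 * (Real.exp (2 * tailConst lam α * τ) * ∫ v, smoothWeight α v ∂ν₀) := by
  have h1 := h.integral_tailWeight_le hr hα le_rfl hτ
  simp only [tailWeight_zero] at h1
  have hα0 := zero_le_one.trans hα
  refine (integral_mono (h.law τ hτ).integrable_weight
    (((h.law τ hτ).integrable contDiff_smoothWeight.continuous
      (smoothTest_smoothWeight hα0).hasGrowth).const_mul 2)
    fun v => weight_le_smoothWeight hα0 v).trans ?_
  rw [integral_const_mul]
  linarith

end Generator

/-! ### Convergence of the generator for small trades. -/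

section Consistency

variable {lam p q α : ℝ} {φ : ℝ → ℝ}

/-- The rate of convergence of the generator in the limit of small trades. -/
noncomputable def tradeRate (α p q : ℝ) : ℝ := |p - 1| + q ^ min 1 (α - 1)

/-- The formal limit of the generator, before averaging over the second agent. -/
noncomputable def driftOp (lam : ℝ) (φ : ℝ → ℝ) (z : ℝ × ℝ) : ℝ :=
  lam / 2 * (z.1 ^ 2 * deriv (deriv φ) z.1) - z.1 * deriv φ z.1 + z.2 * deriv φ z.1

theorem tradeRate_nonneg (hq : 0 ≤ q) : 0 ≤ tradeRate α p q := by
  unfold tradeRate; positivity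

/-- Interpolates between the Lipschitz and the uniform bound of `φ'`, so that moments of order `1 +
κ` in `w` suffice where a full Taylor expansion would need second moments. -/
theorem min_two_le_rpow {x κ : ℝ} (hx : 0 ≤ x) (hκ0 : 0 ≤ κ) (hκ1 : κ ≤ 1) :
    min x 2 ≤ 2 * x ^ κ := by
  rcases le_total x 1 with h | h
  · have := Real.rpow_le_rpow_of_exponent_ge_of_imp hx h hκ1 (fun _ h => absurd h one_ne_zero)
    rw [Real.rpow_one] at this
    exact (min_le_left _ _).trans (by linarith)
  · have := Real.one_le_rpow h hκ0
    exact (min_le_right _ _).trans (by linarith)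

theorem exists_abs_tradeGenerator_sub_driftOp_le (hα : 1 < α) (hφ : ContDiff ℝ (⊤ : ℕ∞) φ)
    (hs : HasCompactSupport φ) :
    ∃ C : ℝ, 0 ≤ C ∧ ∀ p q, IsTradeRegime lam p q → ∀ v w, 0 ≤ v → 0 ≤ w →
      |tradeGenerator p q φ (v, w) - driftOp lam φ (v, w)| ≤
        C * tradeRate α p q * (1 + |w| ^ α) := by
  have hφ1 := contDiff_deriv_infty hφ
  have hφ2 := contDiff_deriv_infty hφ1
  have hφ3 := contDiff_deriv_infty hφ2
  obtain ⟨C₁, h10, h1⟩ := bounded_of_hasCompactSupport hφ1.continuous hs.deriv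
  obtain ⟨C₂, h20, h2⟩ := bounded_of_hasCompactSupport hφ2.continuous hs.deriv.deriv
  obtain ⟨C₃, h30, h3⟩ := bounded_of_hasCompactSupport hφ3.continuous hs.deriv.deriv.deriv
  obtain ⟨K, hK0, hK⟩ : ∃ K : ℝ, 0 ≤ K ∧ ∀ x, K < x → φ x = 0 ∧ deriv φ x = 0 ∧
      deriv (deriv φ) x = 0 := by
    obtain ⟨K, hK⟩ := hs.isCompact.isBounded.subset_closedBall 0
    refine ⟨|K|, abs_nonneg _, fun x hx => ?_⟩
    have hx' : x ∉ tsupport φ := fun h => by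
      have := hK h
      rw [mem_closedBall_zero_iff, Real.norm_eq_abs] at this
      linarith [le_abs_self x, le_abs_self K]
    refine ⟨image_eq_zero_of_notMem_tsupport hx', ?_, ?_⟩
    · exact image_eq_zero_of_notMem_tsupport fun h => hx' (tsupport_deriv_subset h)
    · exact image_eq_zero_of_notMem_tsupport fun h =>
        hx' (tsupport_deriv_subset (tsupport_deriv_subset h))
  set κ := min 1 (α - 1) with hκ
  have hκ0 : 0 < κ := lt_min one_pos (by linarith)
  have hκ1 : κ ≤ 1 := min_le_left _ _
  have hκα : 1 + κ ≤ α := by linarith [min_le_right 1 (α - 1)]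
  refine ⟨2 * K * C₂ + 2 * (C₁ + C₂) + |lam| * C₃ * (2 * K) ^ 3, by positivity,
    fun p q h v w hv hw => ?_⟩
  have hq := h.q_pos
  have hW : 0 ≤ |w| ^ α := by positivity
  have hr0 : 0 ≤ tradeRate α p q := tradeRate_nonneg hq.le
  have hp1 : |p - 1| ≤ tradeRate α p q := by
    have : 0 ≤ q ^ min 1 (α - 1) := by positivity
    unfold tradeRate; linarith
  have hqk : q ^ κ ≤ tradeRate α p q := by
    have := abs_nonneg (p - 1)
    unfold tradeRate; linarith
  have hle := h.le_p
  -- As `p ≥ 1 / 2`, every `v > 2 * K` is traded to a point beyond `K`, where nothing is left to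
  -- compare. Below, `v` is bounded.
  rcases lt_or_ge (2 * K) v with hvK | hvK
  · have a1 := hK v (by linarith)
    have a2 := hK (p * v + q * w) (by nlinarith [mul_nonneg hq.le hw])
    have : tradeGenerator p q φ (v, w) - driftOp lam φ (v, w) = 0 := by
      simp [tradeGenerator, driftOp, a1, a2]
    rw [this, abs_zero]
    positivity
  -- the drift term
  have b1 : |(φ (p * v + q * w) - φ (p * v)) - q * (w * deriv φ v)| ≤
      q * ((2 * K * C₂ + 2 * (C₁ + C₂)) * tradeRate α p q * (1 + |w| ^ α)) := by
    have hl : ∀ r, HasDerivAt (fun r => p * v + q * w * r) (q * w) r := fun r => by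
      simpa using ((hasDerivAt_id r).const_mul (q * w)).const_add (p * v)
    have hd : ∀ r, HasDerivAt (fun r => φ (p * v + q * w * r) - r * (q * (w * deriv φ v)))
        (q * (w * (deriv φ (p * v + q * w * r) - deriv φ v))) r := fun r => by
      refine (((hasDerivAt_of_smooth hφ _).comp r (hl r)).sub
        ((hasDerivAt_id r).mul_const _)).congr_deriv ?_
      ring
    have := abs_sub_le_of_hasDerivAt (s := 1) (t := 0)
      (M := q * ((2 * K * C₂ + 2 * (C₁ + C₂)) * tradeRate α p q * (1 + |w| ^ α))) hd
      fun r hr => ?_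
    · simp only [mul_one, mul_zero, add_zero, one_mul, zero_mul, sub_zero, abs_one] at this
      convert this using 2
      ring
    · rw [Set.uIcc_of_le zero_le_one] at hr
      obtain ⟨hr0', hr1⟩ := hr
      have hqw : 0 ≤ q * w := mul_nonneg hq.le hw
      set u := p * v + q * w * r with hu
      have c1 : |deriv φ (p * v) - deriv φ v| ≤ C₂ * (|p - 1| * (2 * K)) := by
        refine (abs_sub_le_of_hasDerivAt (fun r => hasDerivAt_of_smooth hφ1 r)
          fun r _ => h2 r).trans ?_
        rw [show p * v - v = (p - 1) * v by ring, abs_mul, abs_of_nonneg hv]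
        gcongr
      -- The two arguments of the minimum correspond to the Lipschitz and the uniform bound of `φ'`.
      have c2 : |deriv φ u - deriv φ (p * v)| ≤ (C₁ + C₂) * min (q * w) 2 := by
        rcases min_cases (q * w) 2 with ⟨h', -⟩ | ⟨h', -⟩ <;> rw [h']
        · refine (abs_sub_le_of_hasDerivAt (fun r => hasDerivAt_of_smooth hφ1 r)
            fun r _ => h2 r).trans ?_
          rw [show u - p * v = q * w * r by rw [hu]; ring, abs_of_nonneg (by positivity)]
          nlinarith [mul_nonneg h20 (mul_nonneg hqw (sub_nonneg.2 hr1)), mul_nonneg h10 hqw]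
        · refine (abs_sub _ _).trans ?_
          linarith [h1 u, h1 (p * v)]
      -- The product is at most `2 * q ^ κ * w ^ (1 + κ)`, and `1 + κ ≤ α`.
      have c3 : w * min (q * w) 2 ≤ 2 * (q ^ κ * (1 + |w| ^ α)) := by
        have := min_two_le_rpow hqw hκ0.le hκ1
        rw [Real.mul_rpow hq.le hw] at this
        have e : w * w ^ κ = w ^ (1 + κ) := by
          rw [Real.rpow_add' hw (by positivity), Real.rpow_one]
        have e' := rpow_le_one_add_rpow hw (by linarith) hκα
        rw [← e] at e'
        have hqk0 : 0 ≤ q ^ κ := by positivity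
        rw [abs_of_nonneg hw]
        calc w * min (q * w) 2 ≤ w * (2 * (q ^ κ * w ^ κ)) := mul_le_mul_of_nonneg_left this hw
          _ = 2 * (q ^ κ * (w * w ^ κ)) := by ring
          _ ≤ _ := by gcongr
      have c4 : w ≤ 1 + |w| ^ α := by
        have := rpow_le_one_add_rpow hw zero_le_one hα.le
        rw [Real.rpow_one] at this
        rwa [abs_of_nonneg hw]
      rw [abs_mul, abs_of_pos hq, abs_mul, abs_of_nonneg hw]
      refine mul_le_mul_of_nonneg_left ?_ hq.le
      calc w * |deriv φ u - deriv φ v|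
          ≤ w * ((C₁ + C₂) * min (q * w) 2 + C₂ * (|p - 1| * (2 * K))) :=
            mul_le_mul_of_nonneg_left ((abs_sub_le _ _ _).trans (add_le_add c2 c1)) hw
        _ = (C₁ + C₂) * (w * min (q * w) 2) + 2 * K * C₂ * |p - 1| * w := by ring
        _ ≤ (C₁ + C₂) * (2 * (tradeRate α p q * (1 + |w| ^ α))) +
            2 * K * C₂ * tradeRate α p q * (1 + |w| ^ α) := by
            refine add_le_add (mul_le_mul_of_nonneg_left (c3.trans ?_) (by positivity)) ?_ <;>
              gcongr
        _ = _ := by rw [abs_of_nonneg hw]; ring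
  -- the diffusion term
  have b2 : |φ (p * v) - φ v - (p - 1) * v * deriv φ v -
      q * (lam / 2 * (v ^ 2 * deriv (deriv φ) v))| ≤
      q * (|lam| * C₃ * (2 * K) ^ 3 * tradeRate α p q) := by
    have := abs_taylor_two_le (s := p * v) (t := v) (fun r => hasDerivAt_of_smooth hφ r)
      (fun r => hasDerivAt_of_smooth hφ1 r) (fun r => hasDerivAt_of_smooth hφ2 r)
      fun r _ => h3 r
    rw [show p * v - v = (p - 1) * v by ring, mul_pow, h.sq_eq] at this
    rw [show q * (lam / 2 * (v ^ 2 * deriv (deriv φ) v)) =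
      lam * q * v ^ 2 / 2 * deriv (deriv φ) v by ring]
    refine this.trans ?_
    rw [abs_mul, mul_pow, pow_succ |p - 1|, sq_abs, h.sq_eq, abs_of_nonneg hv]
    calc C₃ * (lam * q * |p - 1| * v ^ 3) ≤ C₃ * (|lam| * q * tradeRate α p q * (2 * K) ^ 3) := by
          have := le_abs_self lam
          gcongr
      _ = _ := by ring
  have e : tradeGenerator p q φ (v, w) - driftOp lam φ (v, w) =
      q⁻¹ * ((φ (p * v + q * w) - φ (p * v)) - q * (w * deriv φ v)) +
      q⁻¹ * (φ (p * v) - φ v - (p - 1) * v * deriv φ v -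
        q * (lam / 2 * (v ^ 2 * deriv (deriv φ) v))) := by
    rw [tradeGenerator_eq _ hq.ne', driftOp]
    field_simp
    ring
  rw [e]
  refine (abs_add_le _ _).trans ?_
  rw [abs_mul, abs_mul, abs_of_pos (inv_pos.2 hq)]
  have d1 := (inv_mul_le_iff₀ hq).2 b1
  have d2 := (inv_mul_le_iff₀ hq).2 b2
  have d3 : |lam| * C₃ * (2 * K) ^ 3 * tradeRate α p q ≤
      |lam| * C₃ * (2 * K) ^ 3 * tradeRate α p q * (1 + |w| ^ α) :=
    le_mul_of_one_le_right (by positivity) (by linarith)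
  linarith

/-- Unit mean in the second variable replaces `w * φ' v` by `φ' v`, which produces the drift `v -
1`. -/
theorem IsWealthLaw.integrable_driftOp {μ : Measure ℝ} (hα : 1 ≤ α) (hμ : IsWealthLaw α μ)
    (hφ : ContDiff ℝ (⊤ : ℕ∞) φ) (hs : HasCompactSupport φ) :
    Integrable (driftOp lam φ) (μ.prod μ) ∧
      (∫ v, v ∂μ = 1 → ∫ z, driftOp lam φ z ∂(μ.prod μ) = ∫ v, fokkerPlanckOp lam φ v ∂μ) := by
  have := hμ.prob
  have hr := RegularTest.of_hasCompactSupport (α := α) hφ hs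
  have hφ1 := contDiff_deriv_infty hφ
  have hφ2 := contDiff_deriv_infty hφ1
  have i1 : Integrable (fun v => lam / 2 * (v ^ 2 * deriv (deriv φ) v) - v * deriv φ v) μ :=
    hμ.integrable (by fun_prop) ((hr.growth_deriv₂.const_mul _).sub hr.growth_deriv)
  have i2 : Integrable (deriv φ) μ :=
    hμ.integrable hφ1.continuous (.of_hasCompactSupport hφ1.continuous hs.deriv)
  have i3 : Integrable (fun v : ℝ => v) μ := hμ.integrable continuous_id (HasGrowth.id hα)
  have j1 := i1.comp_fst μ
  have j2 : Integrable (fun z : ℝ × ℝ => z.2 * deriv φ z.1) (μ.prod μ) := by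
    simpa [mul_comm] using i2.mul_prod i3
  refine ⟨j1.add j2, fun hm => ?_⟩
  have e1 : ∫ z : ℝ × ℝ, z.2 * deriv φ z.1 ∂(μ.prod μ) = ∫ v, deriv φ v ∂μ := by
    have := integral_prod_mul (μ := μ) (ν := μ) (deriv φ) fun v : ℝ => v
    rw [hm, mul_one] at this
    rw [← this]
    exact integral_congr_ae (Eventually.of_forall fun z => mul_comm _ _)
  calc ∫ z, driftOp lam φ z ∂(μ.prod μ)
      = (∫ v, (lam / 2 * (v ^ 2 * deriv (deriv φ) v) - v * deriv φ v) ∂μ) + ∫ v, deriv φ v ∂μ := by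
        rw [← e1, ← hμ.integral_fst (μ := μ) fun v =>
          lam / 2 * (v ^ 2 * deriv (deriv φ) v) - v * deriv φ v]
        exact integral_add j1 j2
    _ = _ := by
        rw [← integral_add i1 i2]
        refine integral_congr_ae (Eventually.of_forall fun v => ?_)
        simp only [fokkerPlanckOp]
        ring

/-- Uniform consistency of the rescaled dynamics with the Fokker-Planck equation. -/
theorem exists_abs_integral_tradeGenerator_sub_le (lam : ℝ) (hα : 1 < α)
    (hφ : ContDiff ℝ (⊤ : ℕ∞) φ) (hs : HasCompactSupport φ) :
    ∃ C : ℝ, 0 ≤ C ∧ ∀ p q, IsTradeRegime lam p q → ∀ μ, IsWealthLaw α μ → ∫ v, v ∂μ = 1 →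
      |∫ z, tradeGenerator p q φ z ∂(μ.prod μ) - ∫ v, fokkerPlanckOp lam φ v ∂μ| ≤
        C * tradeRate α p q * ∫ v, (1 + |v| ^ α) ∂μ := by
  obtain ⟨C, hC0, hC⟩ := exists_abs_tradeGenerator_sub_driftOp_le (lam := lam) hα hφ hs
  refine ⟨C, hC0, fun p q h μ hμ hm => ?_⟩
  have := hμ.prob
  have hr := RegularTest.of_hasCompactSupport (α := α) hφ hs
  have hα0 : 0 ≤ α := by linarith
  obtain ⟨i1, h1⟩ := hμ.integrable_driftOp (lam := lam) hα.le hφ hs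
  rw [← h1 hm, ← integral_sub (hr.integrable_tradeGenerator hα0 hμ) i1,
    ← hμ.integral_snd (μ := μ) fun w => 1 + |w| ^ α, ← integral_const_mul]
  refine (abs_integral_le_integral_abs).trans (integral_mono_ae
    ((hr.integrable_tradeGenerator hα0 hμ).sub i1).abs
    ((hμ.integrable_weight.comp_snd μ).const_mul _) ?_)
  filter_upwards [hμ.ae_prod_nonneg] with z hz using hC p q h z.1 z.2 hz.1 hz.2

end Consistency

/-! ### Tightness from moments. -/

section Compactness

variable {α : ℝ}

/-- Markov's inequality for the weight, which dominates `|v|` as `α ≥ 1`, gives tightness;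
Prokhorov's theorem concludes. -/
theorem isCompact_closure_range_of_moment {ι : Type*} (hα : 1 ≤ α) {μ : ι → ProbabilityMeasure ℝ}
    {B : ℝ} (hμ : ∀ i, IsWealthLaw α (μ i : Measure ℝ))
    (hB : ∀ i, ∫ v, (1 + |v| ^ α) ∂(μ i : Measure ℝ) ≤ B) :
    IsCompact (closure (Set.range μ)) := by
  refine isCompact_closure_of_isTightMeasureSet
    (isTightMeasureSet_iff_exists_isCompact_measure_compl_le.2 fun ε hε => ?_)
  obtain ⟨e, he0, heε⟩ : ∃ e : ℝ, 0 < e ∧ ENNReal.ofReal e ≤ ε := by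
    obtain ⟨x, hx0, hx⟩ := ENNReal.lt_iff_exists_nnreal_btwn.1 hε
    exact ⟨x, by exact_mod_cast hx0, by simpa using hx.le⟩
  obtain ⟨r, hr0, hr⟩ : ∃ r : ℝ, 0 < r ∧ B ≤ e * r := by
    refine ⟨|B| / e + 1, by positivity, ?_⟩
    rw [mul_add, mul_div_cancel₀ _ he0.ne', mul_one]
    linarith [le_abs_self B]
  refine ⟨Metric.closedBall 0 r, isCompact_closedBall _ _, ?_⟩
  rintro _ ⟨_, ⟨i, rfl⟩, rfl⟩
  have h1 := mul_meas_ge_le_integral_of_nonneg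
    (Eventually.of_forall fun v => (one_add_rpow_pos (α := α) v).le) (hμ i).integrable_weight r
  have h2 : (μ i : Measure ℝ).real (Metric.closedBall 0 r)ᶜ ≤ e := by
    refine (measureReal_mono fun v hv => ?_).trans
      (le_of_mul_le_mul_left ((h1.trans (hB i)).trans (hr.trans_eq (mul_comm _ _))) hr0)
    rw [Set.mem_compl_iff, mem_closedBall_zero_iff, not_le, Real.norm_eq_abs] at hv
    have := rpow_le_one_add_rpow (abs_nonneg v) zero_le_one hα
    rw [Real.rpow_one] at this
    exact hv.le.trans this
  refine le_trans ?_ heε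
  rw [← ENNReal.ofReal_toReal (measure_ne_top (μ i : Measure ℝ) _)]
  exact ENNReal.ofReal_le_ofReal h2

end Compactness

/-! ### Equicontinuity in time and extraction of a subsequence. -/

/-- A sequence of rescaled flows in the regime of small trades. -/
structure IsGrazingSequence (lam α : ℝ) (ν₀ : Measure ℝ) (p q : ℕ → ℝ)
    (ρ : ℕ → ℝ → Measure ℝ) : Prop where
  one_lt : 1 < α
  initial : IsWealthLaw α ν₀
  regime : ∀ n, IsTradeRegime lam (p n) (q n)
  flow : ∀ n, IsRescaledFlow (p n) (q n) α ν₀ (ρ n)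
  rate : Tendsto (fun n => tradeRate α (p n) (q n)) atTop (𝓝 0)

section Grazing

variable {lam α : ℝ} {ν₀ : Measure ℝ} {p q : ℕ → ℝ} {ρ : ℕ → ℝ → Measure ℝ} {φ : ℝ → ℝ}

theorem IsTradeRegime.tradeRate_le {p q : ℝ} (h : IsTradeRegime lam p q) (hα : 1 ≤ α) :
    tradeRate α p q ≤ 2 := by
  have h1 : |p - 1| ≤ 1 := abs_le.2 ⟨by linarith [h.le_p], by linarith [h.p_le]⟩
  have h2 : q ^ min 1 (α - 1) ≤ 1 :=
    Real.rpow_le_one h.q_pos.le h.q_le (le_min zero_le_one (by linarith))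
  unfold tradeRate
  linarith

theorem IsGrazingSequence.comp (h : IsGrazingSequence lam α ν₀ p q ρ) {k : ℕ → ℕ}
    (hk : StrictMono k) :
    IsGrazingSequence lam α ν₀ (p ∘ k) (q ∘ k) (ρ ∘ k) :=
  ⟨h.one_lt, h.initial, fun _ => h.regime _, fun _ => h.flow _, h.rate.comp hk.tendsto_atTop⟩

theorem tailConst_nonneg (hlam : 0 ≤ lam) (hα : 0 ≤ α) : 0 ≤ tailConst lam α := by
  unfold tailConst; positivity

theorem IsGrazingSequence.integral_tailWeight_le (h : IsGrazingSequence lam α ν₀ p q ρ) (n : ℕ)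
    {R : ℝ} (hR : 0 ≤ R) {A τ : ℝ} (hτ : 0 < τ) (hA : τ ≤ A) :
    ∫ v, tailWeight α R v ∂(ρ n τ) ≤
      Real.exp (2 * tailConst lam α * A) * ∫ v, tailWeight α R v ∂ν₀ := by
  refine ((h.flow n).integral_tailWeight_le (h.regime n) h.one_lt.le hR hτ).trans
    (mul_le_mul_of_nonneg_right (Real.exp_le_exp.2 ?_)
      (integral_nonneg fun v => tailWeight_nonneg hR v))
  have := tailConst_nonneg (h.regime n).lam_nonneg (zero_le_one.trans h.one_lt.le)
  gcongr

theorem IsGrazingSequence.integral_weight_le (h : IsGrazingSequence lam α ν₀ p q ρ) (A : ℝ) :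
    ∃ B : ℝ, 0 ≤ B ∧ ∀ n τ, 0 < τ → τ ≤ A → ∫ v, (1 + |v| ^ α) ∂(ρ n τ) ≤ B := by
  refine ⟨2 * (Real.exp (2 * tailConst lam α * A) * ∫ v, smoothWeight α v ∂ν₀),
    mul_nonneg zero_le_two (mul_nonneg (Real.exp_pos _).le
      (integral_nonneg fun v => (smoothWeight_pos v).le)), fun n τ hτ hA => ?_⟩
  refine ((h.flow n).integral_weight_le (h.regime n) h.one_lt.le hτ).trans ?_
  have := tailConst_nonneg (h.regime n).lam_nonneg (zero_le_one.trans h.one_lt.le)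
  have h0 : 0 ≤ ∫ v, smoothWeight α v ∂ν₀ := integral_nonneg fun v => (smoothWeight_pos v).le
  gcongr

theorem contDiff_fokkerPlanckOp (hφ : ContDiff ℝ (⊤ : ℕ∞) φ) :
    ContDiff ℝ (⊤ : ℕ∞) (fokkerPlanckOp lam φ) := by
  have h1 := contDiff_deriv_infty hφ
  have h2 := contDiff_deriv_infty h1
  unfold fokkerPlanckOp
  fun_prop

theorem hasCompactSupport_fokkerPlanckOp (hs : HasCompactSupport φ) :
    HasCompactSupport (fokkerPlanckOp lam φ) :=
  ((hs.deriv.deriv.mul_left (f := fun v => v ^ 2)).mul_left (f := fun _ => lam / 2)).sub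
    (hs.deriv.mul_left (f := fun v => v - 1))

/-- Consistency of the rescaled flows with the Fokker-Planck equation. -/
theorem IsGrazingSequence.consistency (h : IsGrazingSequence lam α ν₀ p q ρ)
    (hφ : ContDiff ℝ (⊤ : ℕ∞) φ) (hs : HasCompactSupport φ) (A : ℝ) :
    ∃ C : ℝ, 0 ≤ C ∧ ∀ n τ, 0 < τ → τ ≤ A →
      |∫ z, tradeGenerator (p n) (q n) φ z ∂((ρ n τ).prod (ρ n τ)) -
        ∫ v, fokkerPlanckOp lam φ v ∂(ρ n τ)| ≤ C * tradeRate α (p n) (q n) := by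
  obtain ⟨C, hC0, hC⟩ := exists_abs_integral_tradeGenerator_sub_le lam h.one_lt hφ hs
  obtain ⟨B, hB0, hB⟩ := h.integral_weight_le A
  refine ⟨C * B, by positivity, fun n τ hτ hA => ?_⟩
  refine (hC _ _ (h.regime n) _ ((h.flow n).law τ hτ) ((h.flow n).mean τ hτ)).trans ?_
  have := tradeRate_nonneg (α := α) (p := p n) (h.regime n).q_pos.le
  rw [mul_right_comm C B]
  exact mul_le_mul_of_nonneg_left (hB n τ hτ hA) (by positivity)

theorem abs_integral_le_of_bounded {μ : Measure ℝ} [IsProbabilityMeasure μ] {ψ : ℝ → ℝ} {M : ℝ}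
    (hM : ∀ v, |ψ v| ≤ M) : |∫ v, ψ v ∂μ| ≤ M := by
  simpa using norm_integral_le_of_norm_le_const (μ := μ) (f := ψ) (Eventually.of_forall hM)

/-- Uniform Lipschitz continuity in time. -/
theorem IsGrazingSequence.lipschitz (h : IsGrazingSequence lam α ν₀ p q ρ)
    (hφ : ContDiff ℝ (⊤ : ℕ∞) φ) (hs : HasCompactSupport φ) (A : ℝ) :
    ∃ M : ℝ, 0 ≤ M ∧ ∀ n, ∀ s ∈ Set.Ioc 0 A, ∀ t ∈ Set.Ioc 0 A,
      |∫ v, φ v ∂(ρ n t) - ∫ v, φ v ∂(ρ n s)| ≤ M * |t - s| := by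
  obtain ⟨C, hC0, hC⟩ := h.consistency hφ hs A
  obtain ⟨K, hK0, hK⟩ := bounded_of_hasCompactSupport
    (contDiff_fokkerPlanckOp (lam := lam) hφ).continuous (hasCompactSupport_fokkerPlanckOp hs)
  refine ⟨C * 2 + K, by positivity, fun n s hs' t ht => ?_⟩
  refine (convex_Ioc (0 : ℝ) A).norm_image_sub_le_of_norm_hasDerivWithin_le
    (fun r hr => ((h.flow n).hasDerivAt φ (.of_hasCompactSupport hφ hs) r
      hr.1).hasDerivWithinAt) (fun r hr => ?_) hs' ht
  have := ((h.flow n).law r hr.1).prob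
  have h1 := hC n r hr.1 hr.2
  have h2 := abs_integral_le_of_bounded (μ := ρ n r) hK
  have h3 := mul_le_mul_of_nonneg_left ((h.regime n).tradeRate_le h.one_lt.le) hC0
  rw [Real.norm_eq_abs]
  have h4 := abs_sub_abs_le_abs_sub (∫ z, tradeGenerator (p n) (q n) φ z ∂((ρ n r).prod (ρ n r)))
    (∫ v, fokkerPlanckOp lam φ v ∂(ρ n r))
  linarith

/-- A countable product of compact sets gives one subsequence converging at all positive rational
times. Lipschitz continuity, uniform in `n`, makes the integrals Cauchy at every real time, and
tightness there identifies their limits as integrals against a probability measure. -/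
theorem IsGrazingSequence.exists_subseq (h : IsGrazingSequence lam α ν₀ p q ρ) :
    ∃ k : ℕ → ℕ, StrictMono k ∧ ∃ μ : ℝ → Measure ℝ, ∀ τ, 0 < τ →
      IsProbabilityMeasure (μ τ) ∧ ∀ φ : ℝ → ℝ, ContDiff ℝ (⊤ : ℕ∞) φ → HasCompactSupport φ →
        Tendsto (fun j => ∫ v, φ v ∂(ρ (k j) τ)) atTop (𝓝 (∫ v, φ v ∂(μ τ))) := by
  let P : ∀ τ : {τ : ℝ // 0 < τ}, ℕ → ProbabilityMeasure ℝ :=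
    fun τ n => ⟨ρ n τ, ((h.flow n).law τ τ.2).prob⟩
  have hcpt : ∀ τ : {τ : ℝ // 0 < τ}, IsCompact (closure (Set.range (P τ))) := fun τ => by
    obtain ⟨B, -, hB⟩ := h.integral_weight_le τ
    exact isCompact_closure_range_of_moment h.one_lt.le (fun n => (h.flow n).law τ τ.2)
      fun n => hB n τ τ.2 le_rfl
  have htest : ∀ {u : ℕ → ProbabilityMeasure ℝ} {m : ProbabilityMeasure ℝ},
      Tendsto u atTop (𝓝 m) → ∀ φ : ℝ → ℝ, ContDiff ℝ (⊤ : ℕ∞) φ → HasCompactSupport φ →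
      Tendsto (fun j => ∫ v, φ v ∂(u j : Measure ℝ)) atTop (𝓝 (∫ v, φ v ∂(m : Measure ℝ))) :=
    fun hu φ hφ hs => by
      obtain ⟨C, -, hC⟩ := bounded_of_hasCompactSupport hφ.continuous hs
      exact ProbabilityMeasure.tendsto_iff_forall_integral_tendsto.1 hu
        (BoundedContinuousFunction.ofNormedAddCommGroup φ hφ.continuous C hC)
  let r : {r : ℚ // 0 < r} → {τ : ℝ // 0 < τ} := fun r => ⟨r, by exact_mod_cast r.2⟩
  obtain ⟨m, -, k, hk, hm⟩ := (isCompact_univ_pi fun i => hcpt (r i)).isSeqCompact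
    (x := fun n i => P (r i) n) fun n i _ => subset_closure ⟨n, rfl⟩
  rw [tendsto_pi_nhds] at hm
  have hcauchy : ∀ τ, 0 < τ → ∀ φ : ℝ → ℝ, ContDiff ℝ (⊤ : ℕ∞) φ → HasCompactSupport φ →
      CauchySeq fun j => ∫ v, φ v ∂(ρ (k j) τ) := fun τ hτ φ hφ hs => by
    obtain ⟨M, hM0, hM⟩ := h.lipschitz hφ hs (τ + 1)
    refine Metric.cauchySeq_iff'.2 fun ε hε => ?_
    -- The rational is so close that each of the two Lipschitz errors is at most `ε / 4`; the
    -- remaining `ε / 2` comes from convergence at that rational.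
    obtain ⟨i, hi1, hi2⟩ := exists_rat_btwn
      (show τ < τ + min 1 (ε / (4 * (M + 1))) by
        have : 0 < min 1 (ε / (4 * (M + 1))) := lt_min one_pos (by positivity)
        linarith)
    have hi0 : (0 : ℝ) < i := hτ.trans hi1
    have hi3 : (i : ℝ) ≤ τ + 1 := hi2.le.trans (by linarith [min_le_left 1 (ε / (4 * (M + 1)))])
    have hd : M * |(i : ℝ) - τ| ≤ ε / 4 := by
      rw [abs_of_pos (by linarith)]
      have h1 : (i : ℝ) - τ ≤ ε / (4 * (M + 1)) := by
        linarith [min_le_right 1 (ε / (4 * (M + 1)))]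
      calc M * ((i : ℝ) - τ) ≤ (M + 1) * (ε / (4 * (M + 1))) :=
            mul_le_mul (by linarith) h1 (by linarith) (by linarith)
        _ = ε / 4 := by field_simp
    obtain ⟨N, hN⟩ := Metric.cauchySeq_iff'.1
      (htest (hm ⟨i, by exact_mod_cast hi0⟩) φ hφ hs).cauchySeq (ε / 2) (half_pos hε)
    refine ⟨N, fun n hn => ?_⟩
    have h1 := hN n hn
    have h2 := (hM (k n) τ ⟨hτ, by linarith⟩ i ⟨hi0, hi3⟩).trans hd
    have h3 := (hM (k N) τ ⟨hτ, by linarith⟩ i ⟨hi0, hi3⟩).trans hd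
    rw [Real.dist_eq] at h1 ⊢
    simp only [Function.comp, P, r, ProbabilityMeasure.coe_mk] at h1
    rw [abs_le] at h2 h3
    rw [abs_lt] at h1 ⊢
    constructor <;> linarith [h1.1, h1.2, h2.1, h2.2, h3.1, h3.2]
  have hex : ∀ τ : {τ : ℝ // 0 < τ}, ∃ m : ProbabilityMeasure ℝ, ∀ φ : ℝ → ℝ,
      ContDiff ℝ (⊤ : ℕ∞) φ → HasCompactSupport φ →
      Tendsto (fun j => ∫ v, φ v ∂(ρ (k j) τ)) atTop (𝓝 (∫ v, φ v ∂(m : Measure ℝ))) := fun τ => by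
    -- A further extraction depending on `τ` is harmless: the whole sequence of integrals is already
    -- Cauchy.
    obtain ⟨m', -, k', hk', hm'⟩ := (hcpt τ).isSeqCompact (x := fun j => P τ (k j))
      fun j => subset_closure ⟨_, rfl⟩
    exact ⟨m', fun φ hφ hs => tendsto_nhds_of_cauchySeq_of_subseq (hcauchy τ τ.2 φ hφ hs)
      hk'.tendsto_atTop (htest hm' φ hφ hs)⟩
  choose μ hμ using hex
  refine ⟨k, hk, fun τ => if hτ : 0 < τ then (μ ⟨τ, hτ⟩ : Measure ℝ) else 0, fun τ hτ => ?_⟩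
  simp only [dif_pos hτ]
  exact ⟨inferInstance, hμ ⟨τ, hτ⟩⟩

end Grazing

/-! ### Smooth cutoffs. -/

section Cutoff

/-- A smooth bump, equal to `1` on `[-1, 1]` and supported in `[-2, 2]`. -/
noncomputable def cutoffBump : ContDiffBump (0 : ℝ) := ⟨1, 2, one_pos, one_lt_two⟩

/-- A smooth cutoff at scale `n + 1`. -/
noncomputable def cutoff (n : ℕ) (v : ℝ) : ℝ := cutoffBump (((n : ℝ) + 1)⁻¹ * v)

theorem contDiff_cutoff (n : ℕ) : ContDiff ℝ (⊤ : ℕ∞) (cutoff n) :=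
  cutoffBump.contDiff.comp (contDiff_const.mul contDiff_id)

theorem cutoff_nonneg (n : ℕ) (v : ℝ) : 0 ≤ cutoff n v := cutoffBump.nonneg

theorem cutoff_le_one (n : ℕ) (v : ℝ) : cutoff n v ≤ 1 := cutoffBump.le_one

theorem cutoff_eq_one {n : ℕ} {v : ℝ} (h : |v| ≤ n + 1) : cutoff n v = 1 := by
  refine cutoffBump.one_of_mem_closedBall ?_
  have hn : (0 : ℝ) < n + 1 := by positivity
  rw [mem_closedBall_zero_iff, Real.norm_eq_abs, abs_mul, abs_of_pos (inv_pos.2 hn),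
    inv_mul_le_iff₀ hn]
  simpa [cutoffBump] using h

theorem cutoff_eq_zero {n : ℕ} {v : ℝ} (h : 2 * ((n : ℝ) + 1) ≤ |v|) : cutoff n v = 0 := by
  refine cutoffBump.zero_of_le_dist ?_
  have hn : (0 : ℝ) < n + 1 := by positivity
  rw [dist_zero_right, Real.norm_eq_abs, abs_mul, abs_of_pos (inv_pos.2 hn),
    le_inv_mul_iff₀ hn]
  simpa [cutoffBump, mul_comm] using h

theorem hasCompactSupport_cutoff (n : ℕ) : HasCompactSupport (cutoff n) := by
  refine HasCompactSupport.intro (isCompact_closedBall (0 : ℝ) (2 * ((n : ℝ) + 1))) fun v hv => ?_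
  rw [mem_closedBall_zero_iff, not_le, Real.norm_eq_abs] at hv
  exact cutoff_eq_zero hv.le

end Cutoff

/-! ### From vague convergence to convergence with weight `α`. -/

section Approximation

variable {α : ℝ} {ψ : ℝ → ℝ}

theorem weight_le_tailWeight (hα : 0 ≤ α) {n : ℕ} {v : ℝ} (h : (n : ℝ) + 1 ≤ |v|) :
    1 + |v| ^ α ≤ 4 * tailWeight α n v := by
  have hn : (0 : ℝ) ≤ n := n.cast_nonneg
  have h1 := smoothWeight_le_tailWeight (α := α) (R := n) (v := v) hn
    (by rw [← sq_abs]; nlinarith)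
  linarith [weight_le_smoothWeight hα v]

/-- Continuous functions of growth `α` are approximated by test functions. -/
theorem HasGrowth.exists_approx (hα : 0 ≤ α) (hψ : Continuous ψ) (hg : HasGrowth α ψ) :
    ∃ K : ℝ, 0 ≤ K ∧ ∀ n : ℕ, ∃ φ : ℝ → ℝ, ContDiff ℝ (⊤ : ℕ∞) φ ∧ HasCompactSupport φ ∧
      ∀ v, |ψ v - φ v| ≤ 1 / ((n : ℝ) + 1) + K * tailWeight α n v := by
  obtain ⟨C, hC0, hC⟩ := hg.exists_nonneg
  refine ⟨4 * C, by positivity, fun n => ?_⟩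
  have hn : (0 : ℝ) < 1 / ((n : ℝ) + 1) := by positivity
  obtain ⟨φ, hφ, hd, hs⟩ := (hψ.mul (contDiff_cutoff n).continuous).exists_contDiff_approx ⊤
    (continuous_const (y := 1 / ((n : ℝ) + 1))) fun _ => hn
  refine ⟨φ, hφ, ((hasCompactSupport_cutoff n).mul_left (f := ψ)).mono hs, fun v => ?_⟩
  have h1 : |ψ v - ψ v * cutoff n v| ≤ 4 * C * tailWeight α n v := by
    rcases le_total |v| (n + 1) with h | h
    · rw [cutoff_eq_one h, mul_one, sub_self, abs_zero]
      exact mul_nonneg (by positivity) (tailWeight_nonneg n.cast_nonneg v)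
    · rw [show ψ v - ψ v * cutoff n v = ψ v * (1 - cutoff n v) by ring, abs_mul,
        abs_of_nonneg (sub_nonneg.2 (cutoff_le_one n v))]
      calc |ψ v| * (1 - cutoff n v) ≤ |ψ v| :=
            mul_le_of_le_one_right (abs_nonneg _) (by linarith [cutoff_nonneg n v])
        _ ≤ C * (1 + |v| ^ α) := hC v
        _ ≤ C * (4 * tailWeight α n v) :=
            mul_le_mul_of_nonneg_left (weight_le_tailWeight hα h) hC0
        _ = _ := by ring
  have h2 := (hd v).le
  rw [Real.dist_eq, abs_sub_comm, Pi.mul_apply] at h2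
  have := abs_sub_le (ψ v) (ψ v * cutoff n v) (φ v)
  linarith

theorem integrable_of_hasGrowth {μ : Measure ℝ} [IsFiniteMeasure μ]
    (hm : Integrable (fun v => |v| ^ α) μ) (hψ : Continuous ψ) (hg : HasGrowth α ψ) :
    Integrable ψ μ := by
  obtain ⟨C, hC⟩ := hg
  exact (((integrable_const 1).add hm).const_mul C).mono' hψ.aestronglyMeasurable
    (Eventually.of_forall hC)

theorem abs_integral_sub_le_of_tail (hα : 0 ≤ α) {μ : Measure ℝ} [IsProbabilityMeasure μ]
    (hm : Integrable (fun v => |v| ^ α) μ) {φ : ℝ → ℝ} (hψ : Continuous ψ) (hg : HasGrowth α ψ)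
    (hφ : Continuous φ) (hg' : HasGrowth α φ) {ε K T : ℝ} (hK : 0 ≤ K) {n : ℕ}
    (hT : ∫ v, tailWeight α n v ∂μ ≤ T) (h : ∀ v, |ψ v - φ v| ≤ ε + K * tailWeight α n v) :
    |∫ v, ψ v ∂μ - ∫ v, φ v ∂μ| ≤ ε + K * T := by
  have i1 := integrable_of_hasGrowth hm hψ hg
  have i2 := integrable_of_hasGrowth hm hφ hg'
  have ht := regularTest_tailWeight hα (n.cast_nonneg (α := ℝ))
  have i3 := (integrable_of_hasGrowth hm ht.smooth.continuous ht.growth).const_mul K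
  rw [← integral_sub i1 i2]
  refine abs_integral_le_integral_abs.trans
    ((integral_mono (i1.sub i2).abs ((integrable_const ε).add i3) h).trans ?_)
  have e : ∫ v, (ε + K * tailWeight α n v) ∂μ = ε + K * ∫ v, tailWeight α n v ∂μ := by
    rw [integral_add (integrable_const ε) i3, integral_const_mul]
    simp
  exact e.le.trans (by gcongr)

theorem tendsto_approx_error {T : ℕ → ℝ} (hT : Tendsto T atTop (𝓝 0)) (K : ℝ) :
    Tendsto (fun n : ℕ => 1 / ((n : ℝ) + 1) + K * T n) atTop (𝓝 0) := by
  simpa using tendsto_one_div_add_atTop_nhds_zero_nat.add (hT.const_mul K)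

/-- Vague convergence and uniform tails imply the convergence of the integrals of all continuous
functions of growth `α`. -/
theorem tendsto_integral_of_vague_limit {ι : Type*} {l : Filter ι} {ρ : ι → Measure ℝ}
    {μ : Measure ℝ} [IsProbabilityMeasure μ] (hα : 0 ≤ α) (hm : Integrable (fun v => |v| ^ α) μ)
    {T : ℕ → ℝ} (hT : Tendsto T atTop (𝓝 0)) (hμ : ∀ n : ℕ, ∫ v, tailWeight α n v ∂μ ≤ T n)
    (hρ : ∀ᶠ i in l, IsWealthLaw α (ρ i) ∧ ∀ n : ℕ, ∫ v, tailWeight α n v ∂(ρ i) ≤ T n)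
    (hconv : ∀ φ : ℝ → ℝ, ContDiff ℝ (⊤ : ℕ∞) φ → HasCompactSupport φ →
      Tendsto (fun i => ∫ v, φ v ∂(ρ i)) l (𝓝 (∫ v, φ v ∂μ)))
    (hψ : Continuous ψ) (hg : HasGrowth α ψ) :
    Tendsto (fun i => ∫ v, ψ v ∂(ρ i)) l (𝓝 (∫ v, ψ v ∂μ)) := by
  obtain ⟨K, hK0, hK⟩ := hg.exists_approx hα hψ
  choose φ hφ hs hd using hK
  refine Metric.tendsto_nhds.2 fun ε hε => ?_
  -- The approximant is fixed first, with error below `ε / 3` for all laws simultaneously, before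
  -- the limit in `i` is taken.
  obtain ⟨n, hn⟩ := ((tendsto_approx_error hT K).eventually_lt_const
    (show 0 < ε / 3 by positivity)).exists
  filter_upwards [hρ, Metric.tendsto_nhds.1 (hconv _ (hφ n) (hs n)) (ε / 3) (by positivity)]
    with i hi d3
  have := hi.1.prob
  have g1 := HasGrowth.of_hasCompactSupport (α := α) (hφ n).continuous (hs n)
  have d1 := abs_integral_sub_le_of_tail hα hi.1.moment hψ hg (hφ n).continuous g1 hK0 (hi.2 n)
    (hd n)
  have d2 := abs_integral_sub_le_of_tail hα hm hψ hg (hφ n).continuous g1 hK0 (hμ n) (hd n)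
  rw [Real.dist_eq] at d3 ⊢
  rw [abs_lt] at d3 ⊢
  rw [abs_le] at d1 d2
  constructor <;> linarith [d1.1, d1.2, d2.1, d2.2, d3.1, d3.2]

variable {ρ : ℕ → Measure ℝ} {μ : Measure ℝ}

/-- Lower semicontinuity of the integrals of nonnegative functions under vague convergence. -/
theorem integral_le_of_vague_limit [IsFiniteMeasure μ]
    (hconv : ∀ φ : ℝ → ℝ, ContDiff ℝ (⊤ : ℕ∞) φ → HasCompactSupport φ →
      Tendsto (fun j => ∫ v, φ v ∂(ρ j)) atTop (𝓝 (∫ v, φ v ∂μ)))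
    {χ : ℝ → ℝ} (hχ : ContDiff ℝ (⊤ : ℕ∞) χ) (h0 : ∀ v, 0 ≤ χ v)
    (hi : ∀ j, Integrable χ (ρ j)) {b : ℝ} (hb : ∀ j, ∫ v, χ v ∂(ρ j) ≤ b) :
    Integrable χ μ ∧ ∫ v, χ v ∂μ ≤ b := by
  have hb0 : 0 ≤ b := (integral_nonneg h0).trans (hb 0)
  have hsm : ∀ n, ContDiff ℝ (⊤ : ℕ∞) fun v => χ v * cutoff n v :=
    fun n => hχ.mul (contDiff_cutoff n)
  have hs : ∀ n, HasCompactSupport fun v => χ v * cutoff n v :=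
    fun n => (hasCompactSupport_cutoff n).mul_left
  have hnn : ∀ n v, 0 ≤ χ v * cutoff n v := fun n v => mul_nonneg (h0 v) (cutoff_nonneg n v)
  have hle : ∀ n v, χ v * cutoff n v ≤ χ v := fun n v =>
    mul_le_of_le_one_right (h0 v) (cutoff_le_one n v)
  have h1 : ∀ n, ∫ v, χ v * cutoff n v ∂μ ≤ b := fun n => by
    refine le_of_tendsto' (hconv _ (hsm n) (hs n)) fun j => ?_
    refine (integral_mono_of_nonneg (Eventually.of_forall (hnn n)) (hi j)
      (Eventually.of_forall (hle n))).trans (hb j)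
  -- Fatou's lemma as the cutoffs increase to the whole line; integrability in the limit is part of
  -- the conclusion.
  have h2 : ∫⁻ v, ENNReal.ofReal (χ v) ∂μ ≤ ENNReal.ofReal b := by
    have e : ∀ v, liminf (fun n => ENNReal.ofReal (χ v * cutoff n v)) atTop =
        ENNReal.ofReal (χ v) := fun v => by
      refine (tendsto_const_nhds.congr' ?_).liminf_eq
      filter_upwards [eventually_ge_atTop ⌈|v|⌉₊] with n hn
      have : |v| ≤ n := Nat.ceil_le.1 hn
      rw [cutoff_eq_one (by linarith), mul_one]
    simp only [← e]
    refine (lintegral_liminf_le fun n =>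
      ((hsm n).continuous.measurable.ennreal_ofReal)).trans ?_
    refine liminf_le_of_le (by isBoundedDefault) fun c hc => ?_
    obtain ⟨n, hn⟩ := hc.exists
    refine hn.trans ?_
    rw [← ofReal_integral_eq_lintegral_ofReal
      ((hsm n).continuous.integrable_of_hasCompactSupport (hs n)) (Eventually.of_forall (hnn n))]
    exact ENNReal.ofReal_le_ofReal (h1 n)
  have hint : Integrable χ μ := by
    refine ⟨hχ.continuous.aestronglyMeasurable, ?_⟩
    rw [hasFiniteIntegral_iff_ofReal (Eventually.of_forall h0)]
    exact h2.trans_lt ENNReal.ofReal_lt_top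
  refine ⟨hint, ?_⟩
  rw [← ofReal_integral_eq_lintegral_ofReal hint (Eventually.of_forall h0)] at h2
  exact (ENNReal.ofReal_le_ofReal_iff hb0).1 h2

/-- Tail bounds pass to the limit by lower semicontinuity; the case `R = 0` gives the moment, and
uniform tails then give convergence against all functions of growth `α`. -/
theorem isWealthLaw_of_vague_limit [IsProbabilityMeasure μ] (hα : 1 ≤ α)
    (hρ : ∀ j, IsWealthLaw α (ρ j))
    {T : ℕ → ℝ} (hT : Tendsto T atTop (𝓝 0))
    (htail : ∀ j (n : ℕ), ∫ v, tailWeight α n v ∂(ρ j) ≤ T n)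
    (hconv : ∀ φ : ℝ → ℝ, ContDiff ℝ (⊤ : ℕ∞) φ → HasCompactSupport φ →
      Tendsto (fun j => ∫ v, φ v ∂(ρ j)) atTop (𝓝 (∫ v, φ v ∂μ))) :
    IsWealthLaw α μ ∧ (∀ n : ℕ, ∫ v, tailWeight α n v ∂μ ≤ T n) ∧
      ∀ ψ : ℝ → ℝ, Continuous ψ → HasGrowth α ψ →
        Tendsto (fun j => ∫ v, ψ v ∂(ρ j)) atTop (𝓝 (∫ v, ψ v ∂μ)) := by
  have hα0 := zero_le_one.trans hα
  have key : ∀ n : ℕ, Integrable (tailWeight α n) μ ∧ ∫ v, tailWeight α n v ∂μ ≤ T n := fun n => by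
    have hr := regularTest_tailWeight hα0 (n.cast_nonneg (α := ℝ))
    exact integral_le_of_vague_limit hconv hr.smooth (tailWeight_nonneg n.cast_nonneg)
      (fun j => (hρ j).integrable hr.smooth.continuous hr.growth) fun j => htail j n
  have hmom : Integrable (fun v => |v| ^ α) μ := by
    have hc : Continuous fun v : ℝ => |v| ^ α := continuous_abs.rpow_const fun _ => Or.inr hα0
    have h0 := (key 0).1
    rw [Nat.cast_zero] at h0
    refine (h0.const_mul 2).mono' hc.aestronglyMeasurable (Eventually.of_forall fun v => ?_)
    rw [Real.norm_of_nonneg (by positivity), tailWeight_zero]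
    linarith [weight_le_smoothWeight hα0 v]
  have hconv' : ∀ ψ : ℝ → ℝ, Continuous ψ → HasGrowth α ψ →
      Tendsto (fun j => ∫ v, ψ v ∂(ρ j)) atTop (𝓝 (∫ v, ψ v ∂μ)) := fun ψ hψ hg =>
    tendsto_integral_of_vague_limit hα0 hmom hT (fun n => (key n).2)
      (Eventually.of_forall fun j => ⟨hρ j, htail j⟩) hconv hψ hg
  refine ⟨⟨inferInstance, ?_, hmom⟩, fun n => (key n).2, hconv'⟩
  -- The negative part has zero integral along the sequence, hence in the limit, which places the
  -- limit on the half-line.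
  have hψ : Continuous fun v : ℝ => max (-v) 0 := by fun_prop
  have hg : HasGrowth α fun v : ℝ => max (-v) 0 := by
    obtain ⟨C, hC0, hC⟩ := (HasGrowth.id hα).exists_nonneg
    refine ⟨C, fun v => le_trans ?_ (hC v)⟩
    rw [abs_of_nonneg (le_max_right _ _)]
    exact max_le (neg_le_abs v) (abs_nonneg v)
  have hi := integrable_of_hasGrowth hmom hψ hg
  have ht := hconv' _ hψ hg
  have hz : ∀ j, ∫ v, max (-v) 0 ∂(ρ j) = 0 := fun j => by
    rw [integral_eq_zero_of_ae]
    filter_upwards [(hρ j).ae_nonneg] with v hv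
    exact max_eq_right (by linarith)
  simp only [hz] at ht
  have h0 := tendsto_nhds_unique ht tendsto_const_nhds
  have hnn : 0 ≤ fun v : ℝ => max (-v) 0 := fun v => le_max_right _ _
  rw [integral_eq_zero_iff_of_nonneg hnn hi] at h0
  refine measure_mono_null (fun v hv => ?_) (ae_iff.1 h0)
  have hv' : v < 0 := hv
  simp only [Set.mem_ofPred_eq, Pi.zero_apply]
  rw [max_eq_left (by linarith)]
  linarith

end Approximation

/-! ### Limits of rescaled flows solve the Fokker-Planck equation. -/

/-- The measure-valued form of the Fokker-Planck equation, with uniformly integrable moments of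
order `α`. -/
structure IsFokkerPlanckFlow (lam α : ℝ) (ν₀ : Measure ℝ) (μ : ℝ → Measure ℝ) : Prop where
  law : ∀ τ, 0 < τ → IsWealthLaw α (μ τ)
  tail : ∀ A : ℝ, ∃ T : ℕ → ℝ, Tendsto T atTop (𝓝 0) ∧ (∀ n : ℕ, ∫ v, tailWeight α n v ∂ν₀ ≤ T n) ∧
    ∀ τ, 0 < τ → τ ≤ A → ∀ n : ℕ, ∫ v, tailWeight α n v ∂(μ τ) ≤ T n
  hasDerivAt : ∀ φ : ℝ → ℝ, ContDiff ℝ (⊤ : ℕ∞) φ → HasCompactSupport φ → ∀ τ, 0 < τ →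
    HasDerivAt (fun τ => ∫ v, φ v ∂(μ τ)) (∫ v, fokkerPlanckOp lam φ v ∂(μ τ)) τ
  initial : ∀ φ : ℝ → ℝ, ContDiff ℝ (⊤ : ℕ∞) φ → HasCompactSupport φ →
    Tendsto (fun τ => ∫ v, φ v ∂(μ τ)) (𝓝[>] 0) (𝓝 (∫ v, φ v ∂ν₀))

section Limit

variable {lam α : ℝ} {ν₀ : Measure ℝ} {p q : ℕ → ℝ} {ρ : ℕ → ℝ → Measure ℝ} {μ : ℝ → Measure ℝ}

theorem hasDerivAt_of_quadratic {H : ℝ → ℝ} {k M s : ℝ}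
    (h : ∀ᶠ t in 𝓝 s, |H t - H s - (t - s) * k| ≤ M * |t - s| ^ 2) : HasDerivAt H k s := by
  have h1 : HasDerivAt (fun t => H t - H s - (t - s) * k) 0 s := by
    have : (fun t => H t - H s - (t - s) * k) =O[𝓝 s] fun t => ‖t - s‖ ^ 2 := by
      refine Asymptotics.IsBigO.of_bound M ?_
      filter_upwards [h] with t ht
      rwa [norm_pow, norm_norm]
    have := (this.hasFDerivAt (𝕜 := ℝ) one_lt_two).hasDerivAt
    simpa using this
  have h2 := (h1.add_const (H s)).add (((hasDerivAt_id s).sub_const s).mul_const k)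
  refine (h2.congr_deriv (by simp)).congr_of_eventuallyEq (Eventually.of_forall fun t => ?_)
  simp only [Pi.add_apply, id]
  ring

/-- Second-order expansion in time, uniformly along the sequence. -/
theorem IsGrazingSequence.expansion (h : IsGrazingSequence lam α ν₀ p q ρ) {φ : ℝ → ℝ}
    (hφ : ContDiff ℝ (⊤ : ℕ∞) φ) (hs : HasCompactSupport φ) (A : ℝ) :
    ∃ C M : ℝ, ∀ n, ∀ s ∈ Set.Ioc 0 A, ∀ t ∈ Set.Ioc 0 A,
      |∫ v, φ v ∂(ρ n t) - ∫ v, φ v ∂(ρ n s) -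
        (t - s) * ∫ v, fokkerPlanckOp lam φ v ∂(ρ n s)| ≤
        (C * tradeRate α (p n) (q n) + M * |t - s|) * |t - s| := by
  obtain ⟨C, hC0, hC⟩ := h.consistency hφ hs A
  obtain ⟨M, hM0, hM⟩ := h.lipschitz (contDiff_fokkerPlanckOp (lam := lam) hφ)
    (hasCompactSupport_fokkerPlanckOp hs) A
  refine ⟨C, M, fun n s hs' t ht => ?_⟩
  have hsub : Set.uIcc s t ⊆ Set.Ioc 0 A := Set.OrdConnected.uIcc_subset Set.ordConnected_Ioc hs' ht
  have key := (convex_uIcc s t).norm_image_sub_le_of_norm_hasDerivWithin_le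
    (f := fun r => ∫ v, φ v ∂(ρ n r) - r * ∫ v, fokkerPlanckOp lam φ v ∂(ρ n s))
    (f' := fun r => ∫ z, tradeGenerator (p n) (q n) φ z ∂((ρ n r).prod (ρ n r)) -
      1 * ∫ v, fokkerPlanckOp lam φ v ∂(ρ n s))
    (C := C * tradeRate α (p n) (q n) + M * |t - s|)
    (fun r hr => (((h.flow n).hasDerivAt φ (.of_hasCompactSupport hφ hs) r (hsub hr).1).sub
      ((hasDerivAt_id r).mul_const _)).hasDerivWithinAt) (fun r hr => ?_)
    Set.left_mem_uIcc Set.right_mem_uIcc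
  · rw [Real.norm_eq_abs, Real.norm_eq_abs] at key
    refine le_trans (le_of_eq ?_) key
    congr 1
    ring
  · rw [Real.norm_eq_abs, one_mul]
    refine (abs_sub_le _ (∫ v, fokkerPlanckOp lam φ v ∂(ρ n r)) _).trans
      (add_le_add (hC n r (hsub hr).1 (hsub hr).2)
        ((hM n s hs' r (hsub hr)).trans (mul_le_mul_of_nonneg_left ?_ hM0)))
    exact Set.abs_sub_left_of_mem_uIcc hr

/-- The limit of a sequence of rescaled flows solves the Fokker-Planck equation. -/
theorem IsGrazingSequence.isFokkerPlanckFlow (h : IsGrazingSequence lam α ν₀ p q ρ)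
    (hμ : ∀ τ, 0 < τ → IsProbabilityMeasure (μ τ) ∧ ∀ φ : ℝ → ℝ, ContDiff ℝ (⊤ : ℕ∞) φ →
      HasCompactSupport φ →
        Tendsto (fun j => ∫ v, φ v ∂(ρ j τ)) atTop (𝓝 (∫ v, φ v ∂(μ τ)))) :
    IsFokkerPlanckFlow lam α ν₀ μ ∧ ∀ τ, 0 < τ → ∀ ψ : ℝ → ℝ, Continuous ψ → HasGrowth α ψ →
      Tendsto (fun j => ∫ v, ψ v ∂(ρ j τ)) atTop (𝓝 (∫ v, ψ v ∂(μ τ))) := by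
  have hα0 := zero_le_one.trans h.one_lt.le
  let T : ℝ → ℕ → ℝ := fun A n =>
    Real.exp (2 * tailConst lam α * A) * ∫ v, tailWeight α n v ∂ν₀
  have hT : ∀ A, Tendsto (T A) atTop (𝓝 0) := fun A => by
    simpa using (tendsto_integral_tailWeight hα0 h.initial).const_mul
      (Real.exp (2 * tailConst lam α * A))
  have hlim := fun (τ : ℝ) (hτ : 0 < τ) (A : ℝ) (hA : τ ≤ A) =>
    have := (hμ τ hτ).1
    isWealthLaw_of_vague_limit (T := T A) h.one_lt.le (fun j => (h.flow j).law τ hτ) (hT A)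
      (fun j n => h.integral_tailWeight_le j n.cast_nonneg hτ hA) (hμ τ hτ).2
  refine ⟨⟨fun τ hτ => (hlim τ hτ τ le_rfl).1, fun A => ⟨T (max A 0), hT _, fun n => ?_,
    fun τ hτ hA => (hlim τ hτ _ (hA.trans (le_max_left _ _))).2.1⟩, fun φ hφ hs τ hτ => ?_,
    fun φ hφ hs => ?_⟩, fun τ hτ => (hlim τ hτ τ le_rfl).2.2⟩
  -- Using `max A 0` makes the exponential factor at least one, so the same tail bound covers the
  -- initial law.
  · refine le_mul_of_one_le_left (integral_nonneg fun v => tailWeight_nonneg n.cast_nonneg v)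
      (Real.one_le_exp ?_)
    have := tailConst_nonneg (h.regime 0).lam_nonneg hα0
    have := le_max_right A 0
    positivity
  · obtain ⟨C, M, hCM⟩ := h.expansion hφ hs (τ + 1)
    refine hasDerivAt_of_quadratic (M := M) ?_
    filter_upwards [Ioo_mem_nhds hτ (lt_add_one τ)] with t ht
    -- The time expansion passes to the limit at fixed `t`: the consistency error disappears and a
    -- quadratic remainder survives, which identifies the derivative.
    have h1 := (((hμ t ht.1).2 φ hφ hs).sub ((hμ τ hτ).2 φ hφ hs)).sub
      (((hμ τ hτ).2 _ (contDiff_fokkerPlanckOp (lam := lam) hφ)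
        (hasCompactSupport_fokkerPlanckOp hs)).const_mul (t - τ))
    have h2 : Tendsto (fun n => (C * tradeRate α (p n) (q n) + M * |t - τ|) * |t - τ|) atTop
        (𝓝 ((C * 0 + M * |t - τ|) * |t - τ|)) :=
      ((h.rate.const_mul C).add_const _).mul_const _
    have := le_of_tendsto_of_tendsto' h1.abs h2 fun n =>
      hCM n τ ⟨hτ, by linarith⟩ t ⟨ht.1, ht.2.le⟩
    calc _ ≤ _ := this
      _ = _ := by ring
  · obtain ⟨M, hM0, hM⟩ := h.lipschitz hφ hs 1
    -- For fixed `n` the earlier time tends to zero, then `n` tends to infinity; the uniform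
    -- Lipschitz constant justifies this exchange of limits.
    have hb : ∀ t ∈ Set.Ioc (0 : ℝ) 1, |∫ v, φ v ∂(μ t) - ∫ v, φ v ∂ν₀| ≤ M * t := fun t ht => by
      refine le_of_tendsto' (((hμ t ht.1).2 φ hφ hs).sub_const _).abs fun n => ?_
      have h1 := ((((h.flow n).initial φ (.of_hasCompactSupport hφ hs)).const_sub
        (∫ v, φ v ∂(ρ n t)))).abs
      refine le_of_tendsto h1 ?_
      filter_upwards [Ioo_mem_nhdsGT ht.1] with s hs'
      refine (hM n s ⟨hs'.1, hs'.2.le.trans ht.2⟩ t ht).trans (mul_le_mul_of_nonneg_left ?_ hM0)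
      rw [abs_of_pos (by linarith [hs'.2])]
      linarith [hs'.1]
    rw [tendsto_iff_norm_sub_tendsto_zero]
    refine squeeze_zero' (g := fun t => M * t) (Eventually.of_forall fun t => norm_nonneg _) ?_ ?_
    · filter_upwards [Ioo_mem_nhdsGT one_pos] with t ht using hb t ⟨ht.1, ht.2.le⟩
    · have : ContinuousAt (fun t : ℝ => M * t) 0 := by fun_prop
      simpa using this.tendsto.mono_left (nhdsWithin_le_nhds (s := Set.Ioi 0))

end Limit

/-! ### Absolute continuity through uniform integrability. -/

section AbsolutelyContinuous

/-- Truncation at height `n`: where `0 ≤ φ ≤ 1`, one has `φ * f ≤ max (f - n) 0 + n * φ`, and the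
integral of the first term tends to zero. -/
theorem exists_integral_densityMeasure_le {f : ℝ → ℝ} (hf : Integrable f) (h0 : ∀ v, 0 ≤ f v)
    {ε : ℝ} (hε : 0 < ε) :
    ∃ b : ℝ, 0 ≤ b ∧ ∀ φ : ℝ → ℝ, Continuous φ → (∀ v, 0 ≤ φ v) → (∀ v, φ v ≤ 1) → Integrable φ →
      ∫ v, φ v ∂(densityMeasure f) ≤ ε + b * ∫ v, φ v := by
  have hg : ∀ b : ℝ, 0 ≤ b → Integrable fun v => max (f v - b) 0 := fun b hb => by
    refine hf.mono' ((hf.aestronglyMeasurable.sub aestronglyMeasurable_const).sup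
      aestronglyMeasurable_const) (Eventually.of_forall fun v => ?_)
    rw [Real.norm_of_nonneg (le_max_right _ _)]
    exact max_le (by linarith) (h0 v)
  have hlim : Tendsto (fun n : ℕ => ∫ v, max (f v - n) 0) atTop (𝓝 (∫ _ : ℝ, (0 : ℝ))) := by
    refine tendsto_integral_of_dominated_convergence f
      (fun n => (hg n n.cast_nonneg).aestronglyMeasurable) hf
      (fun n => Eventually.of_forall fun v => ?_) (Eventually.of_forall fun v => ?_)
    · rw [Real.norm_of_nonneg (le_max_right _ _)]
      exact max_le (by linarith [n.cast_nonneg (α := ℝ)]) (h0 v)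
    · refine tendsto_const_nhds.congr' ?_
      filter_upwards [eventually_ge_atTop ⌈f v⌉₊] with n hn
      exact (max_eq_right (by linarith [Nat.ceil_le.1 hn])).symm
  rw [integral_zero] at hlim
  obtain ⟨n, hn⟩ := (hlim.eventually_lt_const hε).exists
  refine ⟨n, n.cast_nonneg, fun φ hφ hφ0 hφ1 hφi => ?_⟩
  rw [integral_densityMeasure hf h0, ← integral_const_mul]
  refine le_trans ?_ (add_le_add_left hn.le _)
  rw [← integral_add (hg n n.cast_nonneg) (hφi.const_mul _)]
  refine integral_mono_of_nonneg (Eventually.of_forall fun v => mul_nonneg (hφ0 v) (h0 v))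
    ((hg n n.cast_nonneg).add (hφi.const_mul _)) (Eventually.of_forall fun v => ?_)
  have h1 := le_max_left (f v - n) 0
  have h2 := le_max_right (f v - n) 0
  have h3 := hφ0 v
  have h4 := hφ1 v
  simp only
  nlinarith

-- Absolute continuity is not closed under weak limits, but these inequalities are. A null set is
-- enclosed in an open set of measure below `ε / (b + 1)`; smooth functions between its compact
-- subsets and that set give it `μ`-measure at most `2 * ε`.
open scoped Manifold in
theorem absolutelyContinuous_of_integral_le {μ : Measure ℝ} [IsFiniteMeasure μ]
    (h : ∀ ε : ℝ, 0 < ε → ∃ b : ℝ, 0 ≤ b ∧ ∀ φ : ℝ → ℝ, ContDiff ℝ (⊤ : ℕ∞) φ → (∀ v, 0 ≤ φ v) →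
      (∀ v, φ v ≤ 1) → Integrable φ → ∫ v, φ v ∂μ ≤ ε + b * ∫ v, φ v) : μ ≪ volume := by
  intro s hs
  have key : ∀ ε : ℝ, 0 < ε → μ s ≤ ENNReal.ofReal (2 * ε) := fun ε hε => by
    obtain ⟨b, hb0, hb⟩ := h ε hε
    obtain ⟨U, hsU, hU, hUε⟩ := s.exists_isOpen_lt_of_lt (μ := volume)
      (ENNReal.ofReal (ε / (b + 1))) (by rw [hs]; exact ENNReal.ofReal_pos.2 (by positivity))
    refine (measure_mono hsU).trans ?_
    rw [hU.measure_eq_iSup_isCompact]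
    refine iSup₂_le fun K hKU => iSup_le fun hK => ?_
    obtain ⟨φ, hφU, hφK, hφ01⟩ := exists_contMDiffMap_zero_one_of_isClosed 𝓘(ℝ) (n := ⊤)
      hU.isClosed_compl hK.isClosed (Set.disjoint_left.2 fun x hx hx' => hx (hKU hx'))
    have hφ : ContDiff ℝ (⊤ : ℕ∞) φ := φ.contMDiff.contDiff
    have hle : ∀ v, φ v ≤ U.indicator (fun _ => (1 : ℝ)) v := fun v => by
      by_cases hv : v ∈ U
      · rw [Set.indicator_of_mem hv]
        exact (hφ01 v).2
      · rw [Set.indicator_of_notMem hv]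
        exact (hφU hv).le
    have hUi : Integrable (U.indicator fun _ => (1 : ℝ)) :=
      (integrable_indicator_iff hU.measurableSet).2
        (integrableOn_const (hUε.trans ENNReal.ofReal_lt_top).ne)
    have hφi : Integrable φ := hUi.mono' hφ.continuous.aestronglyMeasurable
      (Eventually.of_forall fun v => by
        rw [Real.norm_of_nonneg (hφ01 v).1]; exact hle v)
    have h1 : ∫ v, φ v ≤ ε / (b + 1) := by
      refine (integral_mono hφi hUi hle).trans ?_
      rw [integral_indicator_const _ hU.measurableSet, smul_eq_mul, mul_one]
      exact ENNReal.toReal_le_of_le_ofReal (by positivity) hUε.le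
    have h2 := hb φ hφ (fun v => (hφ01 v).1) (fun v => (hφ01 v).2) hφi
    have h3 : μ.real K ≤ ∫ v, φ v ∂μ := by
      rw [← mul_one (μ.real K), ← smul_eq_mul, ← integral_indicator_const _ hK.measurableSet]
      refine integral_mono_of_nonneg (Eventually.of_forall fun v =>
        Set.indicator_nonneg (fun _ _ => zero_le_one) v) ?_ (Eventually.of_forall fun v => ?_)
      · refine (integrable_const 1).mono' hφ.continuous.aestronglyMeasurable
          (Eventually.of_forall fun v => ?_)
        rw [Real.norm_of_nonneg (hφ01 v).1]
        exact (hφ01 v).2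
      · by_cases hv : v ∈ K
        · rw [Set.indicator_of_mem hv]
          exact (hφK hv).ge
        · rw [Set.indicator_of_notMem hv]
          exact (hφ01 v).1
    rw [← ENNReal.ofReal_toReal (measure_ne_top μ K)]
    refine ENNReal.ofReal_le_ofReal ?_
    have h4 : b * (ε / (b + 1)) ≤ ε := by
      rw [mul_div_assoc', div_le_iff₀ (by positivity)]
      nlinarith
    have h5 := mul_le_mul_of_nonneg_left h1 hb0
    exact h3.trans (h2.trans (by linarith))
  refine le_antisymm (ENNReal.le_of_forall_pos_le_add fun ε hε _ => ?_) zero_le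
  have := key (ε / 2) (by positivity)
  rw [mul_div_cancel₀ _ two_ne_zero, ENNReal.ofReal_coe_nnreal] at this
  rwa [zero_add]

end AbsolutelyContinuous

/-! ### Growth of functions in the Hölder classes. -/

section Holder

theorem HasGrowth.of_deriv {s : ℝ} (hs : 0 ≤ s) {φ : ℝ → ℝ} (hφ : Differentiable ℝ φ)
    (h : HasGrowth s (deriv φ)) : HasGrowth (s + 1) φ := by
  obtain ⟨C, hC0, hC⟩ := h.exists_nonneg
  refine ⟨|φ 0| + 2 * C, fun v => ?_⟩
  have h1 : |φ v - φ 0| ≤ C * (1 + |v| ^ s) * |v - 0| := by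
    refine abs_sub_le_of_hasDerivAt (fun r => (hφ r).hasDerivAt) fun r hr => (hC r).trans ?_
    have : |r| ≤ |v| := by
      have := Set.abs_sub_left_of_mem_uIcc hr
      simpa using this
    gcongr
  have h2 := abs_sub_abs_le_abs_sub (φ v) (φ 0)
  have h3 : |v| ^ s * |v| = |v| ^ (s + 1) := by
    rw [Real.rpow_add' (abs_nonneg v) (by positivity), Real.rpow_one]
  have h4 := rpow_le_one_add_rpow (abs_nonneg v) zero_le_one (show 1 ≤ s + 1 by linarith)
  rw [Real.rpow_one] at h4
  have h5 : 0 ≤ |v| ^ (s + 1) := by positivity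
  rw [sub_zero, mul_assoc, add_mul, one_mul, h3] at h1
  have h6 := mul_nonneg (abs_nonneg (φ 0)) h5
  nlinarith

theorem HolderClass.deriv {s : ℝ} (hs : 1 < s) {φ : ℝ → ℝ} (h : HolderClass s φ) :
    ContDiff ℝ 1 φ ∧ HolderClass (s - 1) (deriv φ) := by
  obtain ⟨m, β, hβ0, hβ1, hm, hφ, C, hC⟩ := h
  rcases m with _ | m
  · norm_num at hm
    linarith
  · push_cast at hm hφ
    refine ⟨hφ.of_le (by simp), m, β, hβ0, hβ1, by linarith, ?_, C, ?_⟩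
    · exact (contDiff_succ_iff_deriv.1 hφ).2.2
    · simpa only [iteratedDeriv_succ'] using hC

theorem HolderClass.continuous {s : ℝ} {φ : ℝ → ℝ} (h : HolderClass s φ) : Continuous φ := by
  obtain ⟨m, β, -, -, -, hφ, -⟩ := h
  exact hφ.continuous

/-- The top derivative grows at most with power `β`, and each integration raises the exponent by
one. -/
theorem HolderClass.hasGrowth {s : ℝ} {φ : ℝ → ℝ} (h : HolderClass s φ) : HasGrowth s φ := by
  obtain ⟨m, β, hβ0, hβ1, rfl, hφ, C, hC⟩ := h
  induction m generalizing φ with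
  | zero =>
    refine ⟨|φ 0| + |C|, fun v => ?_⟩
    have h1 := hC v 0
    simp only [iteratedDeriv_zero, sub_zero] at h1
    have h2 := abs_sub_abs_le_abs_sub (φ v) (φ 0)
    have h3 : 0 ≤ |v| ^ β := by positivity
    have h4 := mul_le_mul_of_nonneg_right (le_abs_self C) h3
    have h5 := mul_nonneg (abs_nonneg (φ 0)) h3
    have h6 := abs_nonneg C
    simp only [Nat.cast_zero, zero_add]
    nlinarith
  | succ m ih =>
    push_cast at hφ
    have h1 := contDiff_succ_iff_deriv.1 hφ
    have h2 := ih h1.2.2 (by simpa only [iteratedDeriv_succ'] using hC)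
    have h3 := HasGrowth.of_deriv (by positivity) h1.1 h2
    convert h3 using 1
    push_cast
    ring

end Holder

/-! ### Approximation of test functions together with their image under the operator. -/

section TestFunctions

theorem deriv_cutoff (n : ℕ) (v : ℝ) :
    deriv (cutoff n) v = ((n : ℝ) + 1)⁻¹ * deriv cutoffBump (((n : ℝ) + 1)⁻¹ * v) :=
  deriv_comp_mul_left (((n : ℝ) + 1)⁻¹) (cutoffBump : ℝ → ℝ) v

theorem deriv_deriv_cutoff (n : ℕ) (v : ℝ) :
    deriv (deriv (cutoff n)) v =
      ((n : ℝ) + 1)⁻¹ ^ 2 * deriv (deriv cutoffBump) (((n : ℝ) + 1)⁻¹ * v) := by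
  rw [funext (deriv_cutoff n), deriv_const_mul_field,
    deriv_comp_mul_left (((n : ℝ) + 1)⁻¹) (deriv (cutoffBump : ℝ → ℝ)) v, smul_eq_mul]
  ring

/-- The operators `v ∂_v` and `v ^ 2 ∂_v ^ 2` commute with dilations, so one bump controls all
scales. -/
theorem exists_cutoff_deriv_le : ∃ B : ℝ, 0 ≤ B ∧ ∀ (n : ℕ) (v : ℝ),
    |v * deriv (cutoff n) v| ≤ B ∧ |v ^ 2 * deriv (deriv (cutoff n)) v| ≤ B := by
  have h0 : ContDiff ℝ (⊤ : ℕ∞) (cutoffBump : ℝ → ℝ) := cutoffBump.contDiff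
  have h1 := contDiff_deriv_infty h0
  have h2 := contDiff_deriv_infty h1
  have hs := cutoffBump.hasCompactSupport
  obtain ⟨B₁, -, hB₁⟩ := bounded_of_hasCompactSupport (continuous_id.mul h1.continuous)
    (hs.deriv.mul_left (f := id))
  obtain ⟨B₂, -, hB₂⟩ := bounded_of_hasCompactSupport ((continuous_pow 2).mul h2.continuous)
    (hs.deriv.deriv.mul_left (f := fun v : ℝ => v ^ 2))
  refine ⟨max |B₁| |B₂|, (abs_nonneg _).trans (le_max_left _ _), fun n v => ⟨?_, ?_⟩⟩
  · refine le_trans (le_of_eq ?_) ((hB₁ (((n : ℝ) + 1)⁻¹ * v)).trans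
      ((le_abs_self _).trans (le_max_left _ _)))
    rw [deriv_cutoff]
    simp only [Pi.mul_apply, id]
    ring_nf
  · refine le_trans (le_of_eq ?_) ((hB₂ (((n : ℝ) + 1)⁻¹ * v)).trans
      ((le_abs_self _).trans (le_max_right _ _)))
    rw [deriv_deriv_cutoff]
    simp only [Pi.mul_apply]
    ring_nf

theorem abs_deriv_mul_cutoff_le {ψ : ℝ → ℝ} (hψ : ContDiff ℝ (⊤ : ℕ∞) ψ) {n : ℕ}
    {v B A₀ A₁ A₂ : ℝ}
    (hB : |v * deriv (cutoff n) v| ≤ B ∧ |v ^ 2 * deriv (deriv (cutoff n)) v| ≤ B)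
    (p0 : |ψ v| ≤ A₀) (p1 : |v * deriv ψ v| ≤ A₁) (p2 : |v ^ 2 * deriv (deriv ψ) v| ≤ A₂) :
    |ψ v * cutoff n v| ≤ A₀ ∧ |v * deriv (fun v => ψ v * cutoff n v) v| ≤ A₁ + A₀ * B ∧
      |v ^ 2 * deriv (deriv fun v => ψ v * cutoff n v) v| ≤ A₂ + 2 * (A₁ * B) + A₀ * B := by
  have hc := contDiff_cutoff n
  have hψ1 := contDiff_deriv_infty hψ
  have hc1 := contDiff_deriv_infty hc
  have c0 : |cutoff n v| ≤ 1 := by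
    rw [abs_of_nonneg (cutoff_nonneg n v)]
    exact cutoff_le_one n v
  have hdv : ∀ u, HasDerivAt (fun v => ψ v * cutoff n v)
      (deriv ψ u * cutoff n u + ψ u * deriv (cutoff n) u) u := fun u =>
    (hasDerivAt_of_smooth hψ u).mul (hasDerivAt_of_smooth hc u)
  have hdv2 : HasDerivAt (deriv fun v => ψ v * cutoff n v)
      (deriv (deriv ψ) v * cutoff n v + deriv ψ v * deriv (cutoff n) v +
        (deriv ψ v * deriv (cutoff n) v + ψ v * deriv (deriv (cutoff n)) v)) v := by
    rw [funext fun u => (hdv u).deriv]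
    exact ((hasDerivAt_of_smooth hψ1 v).mul (hasDerivAt_of_smooth hc v)).add
      ((hasDerivAt_of_smooth hψ v).mul (hasDerivAt_of_smooth hc1 v))
  have hmul : ∀ {a b A B : ℝ}, |a| ≤ A → |b| ≤ B → |a * b| ≤ A * B := fun ha hb => by
    rw [abs_mul]
    exact mul_le_mul ha hb (abs_nonneg _) ((abs_nonneg _).trans ha)
  refine ⟨(hmul p0 c0).trans_eq (mul_one _), ?_, ?_⟩
  · rw [(hdv v).deriv, show v * (deriv ψ v * cutoff n v + ψ v * deriv (cutoff n) v) =
      v * deriv ψ v * cutoff n v + ψ v * (v * deriv (cutoff n) v) by ring]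
    exact (abs_add_le _ _).trans
      (add_le_add ((hmul p1 c0).trans_eq (mul_one _)) (hmul p0 hB.1))
  · rw [hdv2.deriv, show v ^ 2 * (deriv (deriv ψ) v * cutoff n v + deriv ψ v * deriv (cutoff n) v +
        (deriv ψ v * deriv (cutoff n) v + ψ v * deriv (deriv (cutoff n)) v)) =
      v ^ 2 * deriv (deriv ψ) v * cutoff n v + 2 * (v * deriv ψ v * (v * deriv (cutoff n) v)) +
        ψ v * (v ^ 2 * deriv (deriv (cutoff n)) v) by ring]
    refine (abs_add_three _ _ _).trans ?_
    rw [abs_mul 2, abs_two]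
    exact add_le_add (add_le_add ((hmul p2 c0).trans_eq (mul_one _))
      (mul_le_mul_of_nonneg_left (hmul p1 hB.1) zero_le_two)) (hmul p0 hB.2)

theorem fokkerPlanckOp_congr {lam : ℝ} {φ ψ : ℝ → ℝ} {v : ℝ} (h : φ =ᶠ[𝓝 v] ψ) :
    fokkerPlanckOp lam φ v = fokkerPlanckOp lam ψ v := by
  rw [fokkerPlanckOp, fokkerPlanckOp, h.deriv_eq, h.deriv.deriv_eq]

theorem exists_smooth_primitive {g : ℝ → ℝ} (hg : ContDiff ℝ (⊤ : ℕ∞) g) (c : ℝ) :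
    ∃ G : ℝ → ℝ, ContDiff ℝ (⊤ : ℕ∞) G ∧ deriv G = g ∧ G 0 = c := by
  have hd : ∀ v, HasDerivAt (fun v => c + ∫ x in (0 : ℝ)..v, g x) (g v) v := fun v =>
    (intervalIntegral.integral_hasDerivAt_right (hg.continuous.intervalIntegrable _ _)
      (hg.continuous.stronglyMeasurableAtFilter _ _) hg.continuous.continuousAt).const_add c
  have he : deriv (fun v => c + ∫ x in (0 : ℝ)..v, g x) = g := funext fun v => (hd v).deriv
  exact ⟨_, contDiff_infty_iff_deriv.2 ⟨fun v => (hd v).differentiableAt, by rwa [he]⟩, he, by simp⟩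

/-- A `C²` function is approximated by smooth functions together with its two derivatives. -/
theorem exists_smooth_approx {φ : ℝ → ℝ} (hφ : ContDiff ℝ 2 φ) {ε : ℝ} (hε : 0 < ε) :
    ∃ ψ : ℝ → ℝ, ContDiff ℝ (⊤ : ℕ∞) ψ ∧ ∀ v, |ψ v - φ v| ≤ ε * v ^ 2 ∧
      |deriv ψ v - deriv φ v| ≤ ε * |v| ∧ |deriv (deriv ψ) v - deriv (deriv φ) v| ≤ ε := by
  have h1 : ContDiff ℝ 1 (deriv φ) := (contDiff_succ_iff_deriv (n := 1).1 hφ).2.2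
  have d0 : Differentiable ℝ φ := hφ.differentiable two_ne_zero
  have d1 : Differentiable ℝ (deriv φ) := h1.differentiable one_ne_zero
  have h2 : Continuous (deriv (deriv φ)) := h1.continuous_deriv le_rfl
  -- Only the second derivative is approximated; integrating twice with matching data at `0` gives
  -- the other two bounds.
  obtain ⟨g, hg, hgd, -⟩ := h2.exists_contDiff_approx ⊤ (continuous_const (y := ε)) fun _ => hε
  obtain ⟨G, hG, hG', hG0⟩ := exists_smooth_primitive hg (deriv φ 0)
  obtain ⟨ψ, hψ, hψ', hψ0⟩ := exists_smooth_primitive hG (φ 0)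
  have b2 : ∀ v, |deriv (deriv ψ) v - deriv (deriv φ) v| ≤ ε := fun v => by
    rw [hψ', hG']
    exact (hgd v).le
  have b1 : ∀ v, |deriv ψ v - deriv φ v| ≤ ε * |v| := fun v => by
    have := abs_sub_le_of_hasDerivAt (g := fun v => deriv ψ v - deriv φ v) (s := v) (t := 0)
      (fun r => (hasDerivAt_of_smooth (contDiff_deriv_infty hψ) r).sub (d1 r).hasDerivAt)
      fun r _ => b2 r
    simpa [hψ', hG0] using this
  refine ⟨ψ, hψ, fun v => ⟨?_, b1 v, b2 v⟩⟩
  have := abs_sub_le_of_hasDerivAt (g := fun v => ψ v - φ v) (s := v) (t := 0) (M := ε * |v|)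
    (fun r => (hasDerivAt_of_smooth hψ r).sub (d0 r).hasDerivAt) fun r hr => (b1 r).trans ?_
  · simp only [hψ0, sub_self, sub_zero] at this
    rwa [mul_assoc, ← sq, sq_abs] at this
  · have := Set.abs_sub_left_of_mem_uIcc hr
    simp only [sub_zero] at this
    exact mul_le_mul_of_nonneg_left this hε.le

variable {lam α : ℝ} {φ : ℝ → ℝ}

theorem abs_fokkerPlanckOp_le (lam : ℝ) (χ : ℝ → ℝ) {v : ℝ} (hv : 1 ≤ |v|) :
    |fokkerPlanckOp lam χ v| ≤
      |lam| / 2 * |v ^ 2 * deriv (deriv χ) v| + 2 * |v * deriv χ v| := by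
  have e : fokkerPlanckOp lam χ v = lam / 2 * (v ^ 2 * deriv (deriv χ) v) -
      (v * deriv χ v - deriv χ v) := by
    rw [fokkerPlanckOp]; ring
  have h3 : |deriv χ v| ≤ |v * deriv χ v| := by
    rw [abs_mul]
    exact le_mul_of_one_le_left (abs_nonneg _) hv
  rw [e]
  refine (abs_sub _ _).trans (add_le_add (le_of_eq ?_) ((abs_sub _ _).trans (by linarith)))
  rw [abs_mul, abs_div, abs_two]

theorem abs_fokkerPlanckOp_sub_le (lam : ℝ) {ψ : ℝ → ℝ} {v ε N : ℝ} (hε : 0 ≤ ε) (hN : 1 ≤ N)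
    (hv : |v| ≤ N) (b1 : |deriv ψ v - deriv φ v| ≤ ε * |v|)
    (b2 : |deriv (deriv ψ) v - deriv (deriv φ) v| ≤ ε) :
    |fokkerPlanckOp lam φ v - fokkerPlanckOp lam ψ v| ≤ N ^ 2 * ε * (|lam| / 2 + 2) := by
  have e : fokkerPlanckOp lam φ v - fokkerPlanckOp lam ψ v =
      -(lam / 2 * v ^ 2) * (deriv (deriv ψ) v - deriv (deriv φ) v) +
        (v - 1) * (deriv ψ v - deriv φ v) := by
    simp only [fokkerPlanckOp]; ring
  have hv2 : v ^ 2 ≤ N ^ 2 := by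
    rw [← sq_abs]
    exact pow_le_pow_left₀ (abs_nonneg v) hv 2
  have k1 : |-(lam / 2 * v ^ 2)| ≤ |lam| / 2 * N ^ 2 := by
    rw [abs_neg, abs_mul, abs_div, abs_two, abs_of_nonneg (sq_nonneg v)]
    exact mul_le_mul_of_nonneg_left hv2 (by positivity)
  have k2 : |v - 1| * |v| ≤ 2 * N * N :=
    mul_le_mul ((abs_sub _ _).trans (by rw [abs_one]; linarith)) hv (abs_nonneg v) (by linarith)
  rw [e]
  refine (abs_add_le _ _).trans ?_
  rw [abs_mul, abs_mul]
  calc |-(lam / 2 * v ^ 2)| * |deriv (deriv ψ) v - deriv (deriv φ) v| +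
        |v - 1| * |deriv ψ v - deriv φ v|
      ≤ |lam| / 2 * N ^ 2 * ε + |v - 1| * (ε * |v|) :=
        add_le_add (mul_le_mul k1 b2 (abs_nonneg _) (by positivity))
          (mul_le_mul_of_nonneg_left b1 (abs_nonneg _))
    _ = |lam| / 2 * N ^ 2 * ε + |v - 1| * |v| * ε := by ring
    _ ≤ |lam| / 2 * N ^ 2 * ε + 2 * N * N * ε :=
        add_le_add_right (mul_le_mul_of_nonneg_right k2 hε) _
    _ = _ := by ring

/-- On the support of the cutoff `|v| ≤ 2 * (n + 1)`, hence `ε * v ^ 2 ≤ 4`; this is the added `4`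
in each constant. The smoothed, truncated function thus keeps growth bounds independent of `n`. -/
theorem abs_cutoff_approx_le {ψ : ℝ → ℝ} (hψ : ContDiff ℝ (⊤ : ℕ∞) ψ) {n : ℕ}
    {v ε B W C₀ C₁ C₂ : ℝ} (hε : 0 ≤ ε) (hεn : ((n : ℝ) + 1) ^ 2 * ε ≤ 1) (hW : 1 ≤ W)
    (hB : |v * deriv (cutoff n) v| ≤ B ∧ |v ^ 2 * deriv (deriv (cutoff n)) v| ≤ B)
    (b0 : |ψ v - φ v| ≤ ε * v ^ 2) (b1 : |deriv ψ v - deriv φ v| ≤ ε * |v|)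
    (b2 : |deriv (deriv ψ) v - deriv (deriv φ) v| ≤ ε) (h0 : |φ v| ≤ C₀ * W)
    (h1 : |v * deriv φ v| ≤ C₁ * W) (h2 : |v ^ 2 * deriv (deriv φ) v| ≤ C₂ * W) :
    |ψ v * cutoff n v| ≤ (C₀ + 4) * W ∧
      |v * deriv (fun v => ψ v * cutoff n v) v| ≤ (C₁ + 4 + (C₀ + 4) * B) * W ∧
      |v ^ 2 * deriv (deriv fun v => ψ v * cutoff n v) v| ≤
        (C₂ + 4 + 2 * (C₁ + 4) * B + (C₀ + 4) * B) * W := by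
  have hB0 : 0 ≤ B := (abs_nonneg _).trans hB.1
  have n0 : 0 ≤ (C₀ + 4) * W := by linarith [abs_nonneg (φ v)]
  have n1 : 0 ≤ (C₁ + 4) * W := by linarith [abs_nonneg (v * deriv φ v)]
  have n2 : 0 ≤ (C₂ + 4) * W := by linarith [abs_nonneg (v ^ 2 * deriv (deriv φ) v)]
  have n0' := mul_nonneg n0 hB0
  have n1' := mul_nonneg n1 hB0
  rcases lt_or_ge (2 * ((n : ℝ) + 1)) |v| with hv | hv
  · have he : (fun v => ψ v * cutoff n v) =ᶠ[𝓝 v] fun _ => 0 := by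
      filter_upwards [continuous_abs.continuousAt.eventually_const_lt hv] with u hu
      rw [cutoff_eq_zero hu.le, mul_zero]
    rw [he.deriv.deriv_eq, he.deriv_eq, show ψ v * cutoff n v = 0 from he.eq_of_nhds]
    have : deriv (deriv fun _ : ℝ => (0 : ℝ)) v = 0 := by simp
    rw [this]
    simp only [deriv_const, mul_zero, abs_zero]
    exact ⟨n0, by linarith, by linarith⟩
  · have hv2 : ε * v ^ 2 ≤ 4 := by
      have h3 : v ^ 2 ≤ (2 * ((n : ℝ) + 1)) ^ 2 := by
        rw [← sq_abs]
        exact pow_le_pow_left₀ (abs_nonneg v) hv 2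
      calc ε * v ^ 2 ≤ ε * (2 * ((n : ℝ) + 1)) ^ 2 := mul_le_mul_of_nonneg_left h3 hε
        _ = 4 * (((n : ℝ) + 1) ^ 2 * ε) := by ring
        _ ≤ 4 := by linarith
    have p0 : |ψ v| ≤ (C₀ + 4) * W := by
      have := abs_sub_abs_le_abs_sub (ψ v) (φ v)
      linarith
    have p1 : |v * deriv ψ v| ≤ (C₁ + 4) * W := by
      have k1 := abs_sub_abs_le_abs_sub (v * deriv ψ v) (v * deriv φ v)
      rw [← mul_sub, abs_mul v (deriv ψ v - deriv φ v)] at k1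
      have k2 := mul_le_mul_of_nonneg_left b1 (abs_nonneg v)
      have k3 : |v| * (ε * |v|) = ε * v ^ 2 := by rw [← sq_abs]; ring
      linarith
    have p2 : |v ^ 2 * deriv (deriv ψ) v| ≤ (C₂ + 4) * W := by
      have k1 := abs_sub_abs_le_abs_sub (v ^ 2 * deriv (deriv ψ) v) (v ^ 2 * deriv (deriv φ) v)
      rw [← mul_sub, abs_mul (v ^ 2) (deriv (deriv ψ) v - deriv (deriv φ) v),
        abs_of_nonneg (sq_nonneg v)] at k1
      have k2 := mul_le_mul_of_nonneg_left b2 (sq_nonneg v)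
      linarith
    obtain ⟨q0, q1, q2⟩ := abs_deriv_mul_cutoff_le hψ hB p0 p1 p2
    exact ⟨q0, q1.trans_eq (by ring), q2.trans_eq (by ring)⟩

/-- A `C²` function for which the Fokker-Planck operator is controlled by the moment of order `α`
is approximated by test functions, uniformly up to the tails. -/
theorem exists_fokkerPlanckOp_approx (lam : ℝ) (hα : 0 ≤ α) (hφ : ContDiff ℝ 2 φ)
    (h0 : HasGrowth α φ) (h1 : HasGrowth α fun v => v * deriv φ v)
    (h2 : HasGrowth α fun v => v ^ 2 * deriv (deriv φ) v) :
    ∃ K : ℝ, 0 ≤ K ∧ ∀ n : ℕ, ∃ φ' : ℝ → ℝ, ContDiff ℝ (⊤ : ℕ∞) φ' ∧ HasCompactSupport φ' ∧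
      ∀ v, |φ v - φ' v| ≤ 1 / ((n : ℝ) + 1) + K * tailWeight α n v ∧
        |fokkerPlanckOp lam φ v - fokkerPlanckOp lam φ' v| ≤
          1 / ((n : ℝ) + 1) + K * tailWeight α n v := by
  obtain ⟨C₀, hC₀, h0⟩ := h0.exists_nonneg
  obtain ⟨C₁, hC₁, h1⟩ := h1.exists_nonneg
  obtain ⟨C₂, hC₂, h2⟩ := h2.exists_nonneg
  obtain ⟨B, hB0, hB⟩ := exists_cutoff_deriv_le
  obtain ⟨L, hL⟩ : ∃ L, L = |lam| / 2 := ⟨_, rfl⟩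
  have hL0 : 0 ≤ L := by rw [hL]; positivity
  obtain ⟨D₀, hD₀⟩ : ∃ D, D = C₀ + 4 := ⟨_, rfl⟩
  obtain ⟨D₁, hD₁⟩ : ∃ D, D = C₁ + 4 + (C₀ + 4) * B := ⟨_, rfl⟩
  obtain ⟨D₂, hD₂⟩ : ∃ D, D = C₂ + 4 + 2 * (C₁ + 4) * B + (C₀ + 4) * B := ⟨_, rfl⟩
  have n0 : 0 ≤ C₀ + D₀ := by rw [hD₀]; positivity
  have n1 : 0 ≤ L * (C₂ + D₂) + 2 * (C₁ + D₁) := by rw [hD₁, hD₂]; positivity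
  refine ⟨4 * (C₀ + D₀ + (L * (C₂ + D₂) + 2 * (C₁ + D₁))), by linarith, fun n => ?_⟩
  obtain ⟨N, hN⟩ : ∃ N : ℝ, N = n + 1 := ⟨_, rfl⟩
  have hn : 1 ≤ N := by rw [hN]; linarith [n.cast_nonneg (α := ℝ)]
  -- Chosen so that `N ^ 2 * ε * (L + 2) = 1 / N`, the error of the operator on the ball of radius
  -- `N`.
  obtain ⟨ε, hε⟩ : ∃ ε, ε = 1 / (N ^ 3 * (L + 2)) := ⟨_, rfl⟩
  have hε0 : 0 < ε := by rw [hε]; positivity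
  have hεN : N ^ 2 * ε * (L + 2) = 1 / N := by
    rw [hε]; field_simp
  have hNε : 0 ≤ N ^ 2 * ε := by positivity
  have hεN' : N ^ 2 * ε ≤ 1 / N := by
    rw [← hεN]
    exact le_mul_of_one_le_right hNε (by linarith)
  have hε1 : N ^ 2 * ε ≤ 1 := hεN'.trans ((div_le_one (by linarith)).2 hn)
  obtain ⟨ψ, hψ, hd⟩ := exists_smooth_approx hφ hε0
  refine ⟨fun v => ψ v * cutoff n v, hψ.mul (contDiff_cutoff n),
    (hasCompactSupport_cutoff n).mul_left, fun v => ?_⟩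
  have hT := tailWeight_nonneg (α := α) (R := n) n.cast_nonneg v
  obtain ⟨b0, b1, b2⟩ := hd v
  rw [← hN]
  -- Inside the ball the cutoff is one and only smoothing contributes; outside, both functions are
  -- bounded by the weight, hence by the tail weight.
  rcases lt_or_ge |v| N with hv | hv
  · have he : (fun v => ψ v * cutoff n v) =ᶠ[𝓝 v] ψ := by
      filter_upwards [continuous_abs.continuousAt.eventually_lt_const hv] with u hu
      rw [cutoff_eq_one (hu.le.trans_eq hN), mul_one]
    beta_reduce
    rw [fokkerPlanckOp_congr he, show ψ v * cutoff n v = ψ v from he.eq_of_nhds]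
    rw [abs_sub_comm] at b0
    have hv2 : v ^ 2 ≤ N ^ 2 := by
      rw [← sq_abs]
      exact pow_le_pow_left₀ (abs_nonneg v) hv.le 2
    have hK : 0 ≤ 4 * (C₀ + D₀ + (L * (C₂ + D₂) + 2 * (C₁ + D₁))) * tailWeight α n v :=
      mul_nonneg (by linarith) hT
    refine ⟨le_add_of_le_of_nonneg (b0.trans ?_) hK, le_add_of_le_of_nonneg ?_ hK⟩
    · rw [mul_comm]
      exact (mul_le_mul_of_nonneg_right hv2 hε0.le).trans hεN'
    · rw [← hεN, hL]
      exact abs_fokkerPlanckOp_sub_le lam hε0.le hn hv.le b1 b2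
  · have hv1 : 1 ≤ |v| := hn.trans hv
    have hW1 : 1 ≤ 1 + |v| ^ α := by
      have : 0 ≤ |v| ^ α := by positivity
      linarith
    have hWT : 1 + |v| ^ α ≤ 4 * tailWeight α n v := weight_le_tailWeight hα (hN ▸ hv)
    obtain ⟨g0, g1, g2⟩ := abs_cutoff_approx_le hψ hε0.le (hN ▸ hε1) hW1 (hB n v) b0 b1 b2
      (h0 v) (h1 v) (h2 v)
    rw [← hD₀] at g0
    rw [← hD₁] at g1
    rw [← hD₂] at g2
    have h0v := h0 v
    have h1v := h1 v
    have h2v := h2 v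
    generalize 1 + |v| ^ α = W at *
    have hN0 : 0 ≤ 1 / N := by positivity
    have hfin := mul_le_mul_of_nonneg_left hWT (add_nonneg n0 n1)
    have m0 := mul_nonneg n0 (zero_le_one.trans hW1)
    have m1 := mul_nonneg n1 (zero_le_one.trans hW1)
    refine ⟨(abs_sub _ _).trans ?_, (abs_sub _ _).trans
      ((add_le_add (abs_fokkerPlanckOp_le lam φ hv1) (abs_fokkerPlanckOp_le lam _ hv1)).trans ?_)⟩
    · linarith
    · rw [← hL]
      have h4 := mul_le_mul_of_nonneg_left h2v hL0
      have h5 := mul_le_mul_of_nonneg_left g2 hL0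
      linarith

end TestFunctions

/-! ### Extension of the Fokker-Planck equation to the full test class. -/

section FokkerPlanckFlow

variable {lam α : ℝ} {ν₀ : Measure ℝ} {μ : ℝ → Measure ℝ} {φ ψ : ℝ → ℝ}

theorem IsFokkerPlanckFlow.tendsto_initial (h : IsFokkerPlanckFlow lam α ν₀ μ) (hα : 0 ≤ α)
    (hν₀ : IsWealthLaw α ν₀) (hψ : Continuous ψ) (hg : HasGrowth α ψ) :
    Tendsto (fun τ => ∫ v, ψ v ∂(μ τ)) (𝓝[>] 0) (𝓝 (∫ v, ψ v ∂ν₀)) := by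
  obtain ⟨T, hT, hT₀, hTτ⟩ := h.tail 1
  have := hν₀.prob
  refine tendsto_integral_of_vague_limit hα hν₀.moment hT hT₀ ?_ h.initial hψ hg
  filter_upwards [Ioo_mem_nhdsGT one_pos] with τ hτ using ⟨h.law τ hτ.1, hTτ τ hτ.1 hτ.2.le⟩

theorem IsFokkerPlanckFlow.continuousAt (h : IsFokkerPlanckFlow lam α ν₀ μ) (hα : 0 ≤ α)
    (hψ : Continuous ψ) (hg : HasGrowth α ψ) {τ : ℝ} (hτ : 0 < τ) :
    ContinuousAt (fun τ => ∫ v, ψ v ∂(μ τ)) τ := by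
  obtain ⟨T, hT, -, hTτ⟩ := h.tail (τ + 1)
  have := (h.law τ hτ).prob
  refine tendsto_integral_of_vague_limit hα (h.law τ hτ).moment hT (hTτ τ hτ (by linarith)) ?_
    (fun φ hφ hs => (h.hasDerivAt φ hφ hs τ hτ).continuousAt) hψ hg
  filter_upwards [Ioo_mem_nhds hτ (lt_add_one τ)] with t ht
    using ⟨h.law t ht.1, hTτ t ht.1 ht.2.le⟩

theorem hasGrowth_fokkerPlanckOp (h1 : HasGrowth α fun v => v * deriv φ v)
    (h1' : HasGrowth α (deriv φ)) (h2 : HasGrowth α fun v => v ^ 2 * deriv (deriv φ) v) :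
    HasGrowth α (fokkerPlanckOp lam φ) := by
  have h := (h2.const_mul (lam / 2)).sub (h1.sub h1')
  convert h using 2 with v
  rw [fokkerPlanckOp]
  ring

/-- The Fokker-Planck equation holds for all test functions controlled by the moment of
order `α`. -/
theorem IsFokkerPlanckFlow.hasDerivAt_of_growth (h : IsFokkerPlanckFlow lam α ν₀ μ) (hα : 0 ≤ α)
    (hφ : ContDiff ℝ 2 φ) (h0 : HasGrowth α φ) (h1 : HasGrowth α fun v => v * deriv φ v)
    (h1' : HasGrowth α (deriv φ)) (h2 : HasGrowth α fun v => v ^ 2 * deriv (deriv φ) v)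
    {τ : ℝ} (hτ : 0 < τ) :
    HasDerivAt (fun τ => ∫ v, φ v ∂(μ τ)) (∫ v, fokkerPlanckOp lam φ v ∂(μ τ)) τ := by
  obtain ⟨K, hK0, hK⟩ := exists_fokkerPlanckOp_approx lam hα hφ h0 h1 h2
  choose χ hχ hs hd using hK
  obtain ⟨T, hT, -, hTτ⟩ := h.tail (τ + 1)
  have herr := tendsto_approx_error hT K
  have hb : ∀ n, ∀ t ∈ Set.Ioo 0 (τ + 1),
      |∫ v, φ v ∂(μ t) - ∫ v, χ n v ∂(μ t)| ≤ 1 / ((n : ℝ) + 1) + K * T n ∧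
      |∫ v, fokkerPlanckOp lam φ v ∂(μ t) - ∫ v, fokkerPlanckOp lam (χ n) v ∂(μ t)| ≤
        1 / ((n : ℝ) + 1) + K * T n := fun n t ht => by
    have hl := h.law t ht.1
    have := hl.prob
    have hc := (contDiff_fokkerPlanckOp (lam := lam) (hχ n)).continuous
    exact ⟨abs_integral_sub_le_of_tail hα hl.moment hφ.continuous h0 (hχ n).continuous
        (.of_hasCompactSupport (hχ n).continuous (hs n)) hK0 (hTτ t ht.1 ht.2.le n)
        fun v => (hd n v).1,
      abs_integral_sub_le_of_tail hα hl.moment (continuous_fokkerPlanckOp hφ)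
        (hasGrowth_fokkerPlanckOp h1 h1' h2) hc
        (.of_hasCompactSupport hc (hasCompactSupport_fokkerPlanckOp (hs n))) hK0
        (hTτ t ht.1 ht.2.le n) fun v => (hd n v).2⟩
  -- Uniform tails make the derivatives of the approximants converge uniformly near `τ`, so the
  -- limit may be differentiated.
  refine hasDerivAt_of_tendstoUniformlyOn (l := atTop) (s := Set.Ioo 0 (τ + 1)) isOpen_Ioo
    (f := fun n t => ∫ v, χ n v ∂(μ t)) (f' := fun n t => ∫ v, fokkerPlanckOp lam (χ n) v ∂(μ t))
    (g := fun t => ∫ v, φ v ∂(μ t)) (g' := fun t => ∫ v, fokkerPlanckOp lam φ v ∂(μ t))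
    ?_ (Eventually.of_forall fun n t ht => h.hasDerivAt _ (hχ n) (hs n) t ht.1)
    (fun t ht => ?_) ⟨hτ, lt_add_one τ⟩
  · refine Metric.tendstoUniformlyOn_iff.2 fun ε hε => ?_
    filter_upwards [herr.eventually_lt_const hε] with n hn t ht
    rw [Real.dist_eq]
    exact (hb n t ht).2.trans_lt hn
  · rw [tendsto_iff_norm_sub_tendsto_zero]
    refine squeeze_zero (fun n => norm_nonneg _) (fun n => ?_) herr
    rw [norm_sub_rev]
    exact (hb n t ht).1

/-- As `α > 1`, the derivative belongs to the class of order `α - 1` and so grows at most with that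
power; the second-order bound is part of the hypothesis. -/
theorem FokkerPlanckTest.growth (hα : 1 < α) (h : FokkerPlanckTest α φ) :
    HasGrowth α φ ∧ HasGrowth α (fun v => v * deriv φ v) ∧ HasGrowth α (deriv φ) ∧
      HasGrowth α fun v => v ^ 2 * deriv (deriv φ) v := by
  obtain ⟨hH, -, h2⟩ := h
  have h1 := (hH.deriv hα).2.hasGrowth
  refine ⟨hH.hasGrowth, ?_, h1.mono (by linarith) (by linarith), ?_⟩
  · obtain ⟨C, hC0, hC⟩ := h1.exists_nonneg
    refine ⟨2 * C, fun v => ?_⟩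
    have h3 : |v| * |v| ^ (α - 1) = |v| ^ α := by
      rw [mul_comm, ← Real.rpow_add_one' (abs_nonneg v) (by linarith)]
      congr 1
      ring
    have h4 := rpow_le_one_add_rpow (abs_nonneg v) zero_le_one hα.le
    rw [Real.rpow_one] at h4
    rw [abs_mul]
    calc |v| * |deriv φ v| ≤ |v| * (C * (1 + |v| ^ (α - 1))) :=
          mul_le_mul_of_nonneg_left (hC v) (abs_nonneg v)
      _ = C * (|v| + |v| * |v| ^ (α - 1)) := by ring
      _ ≤ C * (2 * (1 + |v| ^ α)) := by
          rw [h3]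
          exact mul_le_mul_of_nonneg_left (by linarith) hC0
      _ = _ := by ring
  · rwa [iteratedDeriv_two] at h2

theorem fokkerPlanck_eq_integral_densityMeasure (hα : 1 < α) (hφ : FokkerPlanckTest α φ)
    {f : ℝ → ℝ} (hf : IsDensityWithMoment α f) :
    fokkerPlanck lam φ f = ∫ v, fokkerPlanckOp lam φ v ∂(densityMeasure f) := by
  obtain ⟨-, h1, h1', h2⟩ := hφ.growth hα
  have hl := hf.isWealthLaw
  have c1 : ContDiff ℝ 1 (deriv φ) := (contDiff_succ_iff_deriv (n := 1).1 hφ.2.1).2.2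
  have c2 : Continuous (deriv (deriv φ)) := c1.continuous_deriv le_rfl
  have i2 := hl.integrable ((continuous_pow 2).mul c2) h2
  have i1 : Integrable (fun v => (v - 1) * deriv φ v) (densityMeasure f) := by
    refine hl.integrable ((continuous_id.sub continuous_const).mul c1.continuous) ?_
    convert h1.sub h1' using 2
    ring
  rw [fokkerPlanck, iteratedDeriv_two,
    ← integral_densityMeasure hf.integrable hf.nonneg fun v => v ^ 2 * deriv (deriv φ) v,
    ← integral_densityMeasure hf.integrable hf.nonneg fun v => (v - 1) * deriv φ v,
    ← integral_const_mul]
  exact (integral_sub (i2.const_mul (lam / 2)) i1).symm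

theorem IsFokkerPlanckFlow.isFokkerPlanckSolution {f₀ : ℝ → ℝ} {f : ℝ → ℝ → ℝ} (hα : 1 < α)
    (hf₀ : IsDensityWithMoment α f₀) (hf : ∀ τ, 0 < τ → IsDensityWithMoment α (f τ))
    (h : IsFokkerPlanckFlow lam α (densityMeasure f₀) fun τ => densityMeasure (f τ)) :
    IsFokkerPlanckSolution lam α f₀ f := by
  have hα0 : 0 ≤ α := by linarith
  have hint : ∀ (φ : ℝ → ℝ) τ, 0 < τ → ∫ v, φ v ∂(densityMeasure (f τ)) = ∫ v, φ v * f τ v :=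
    fun φ τ hτ => integral_densityMeasure (hf τ hτ).integrable (hf τ hτ).nonneg φ
  have hder : ∀ φ, FokkerPlanckTest α φ → ∀ τ, 0 < τ →
      HasDerivAt (fun τ => ∫ v, φ v * f τ v)
        (∫ v, fokkerPlanckOp lam φ v ∂(densityMeasure (f τ))) τ := fun φ hφ τ hτ => by
    obtain ⟨h0, h1, h1', h2⟩ := hφ.growth hα
    refine (h.hasDerivAt_of_growth hα0 hφ.2.1 h0 h1 h1' h2 hτ).congr_of_eventuallyEq ?_
    filter_upwards [lt_mem_nhds hτ] with t ht using (hint φ t ht).symm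
  refine ⟨hf, fun φ hφ => ?_, fun φ hφ τ hτ => ?_, fun φ hφ => ?_⟩
  · obtain ⟨h0, h1, h1', h2⟩ := hφ.growth hα
    rw [show (1 : WithTop ℕ∞) = 0 + 1 from (zero_add 1).symm,
      contDiffOn_succ_iff_deriv_of_isOpen isOpen_Ioi]
    refine ⟨fun τ hτ => (hder φ hφ τ hτ).differentiableAt.differentiableWithinAt, by simp,
      contDiffOn_zero.2 fun τ hτ => ?_⟩
    refine ((h.continuousAt hα0 (continuous_fokkerPlanckOp (lam := lam) hφ.2.1)
      (hasGrowth_fokkerPlanckOp h1 h1' h2) hτ).congr ?_).continuousWithinAt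
    filter_upwards [lt_mem_nhds hτ] with t ht using (hder φ hφ t ht).deriv.symm
  · rw [fokkerPlanck_eq_integral_densityMeasure hα hφ (hf τ hτ)]
    exact hder φ hφ τ hτ
  · obtain ⟨h0, -⟩ := hφ.growth hα
    have := h.tendsto_initial hα0 hf₀.isWealthLaw hφ.2.1.continuous h0
    rw [integral_densityMeasure hf₀.integrable hf₀.nonneg] at this
    refine this.congr' ?_
    filter_upwards [self_mem_nhdsWithin] with t ht using hint φ t ht

end FokkerPlanckFlow

/-! ### The limit of small trades. -/

section GrazingLimit

variable {lam α : ℝ} {f₀ : ℝ → ℝ} {p q : ℕ → ℝ} {f : ℕ → ℝ → ℝ → ℝ}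

theorem eventually_isTradeRegime (hpq : ∀ n, 0 < q n ∧ q n < p n ∧ (p n - 1) ^ 2 / q n = lam)
    (hq : Tendsto q atTop (𝓝 0)) : Tendsto p atTop (𝓝 1) ∧
      ∀ᶠ n in atTop, IsTradeRegime lam (p n) (q n) := by
  have hp : Tendsto p atTop (𝓝 1) := by
    have h1 : Tendsto (fun n => (p n - 1) ^ 2) atTop (𝓝 0) := by
      have := hq.const_mul lam
      rw [mul_zero] at this
      exact this.congr fun n => ((div_eq_iff (hpq n).1.ne').1 (hpq n).2.2).symm
    have h2 : Tendsto (fun n => |p n - 1|) atTop (𝓝 0) := by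
      have := (Real.continuous_sqrt.tendsto 0).comp h1
      simpa [Function.comp_def, Real.sqrt_sq_eq_abs] using this
    rw [tendsto_iff_norm_sub_tendsto_zero]
    exact h2
  refine ⟨hp, ?_⟩
  filter_upwards [hq.eventually_lt_const one_pos,
    hp.eventually_const_lt (show (1 / 2 : ℝ) < 1 by norm_num),
    hp.eventually_lt_const one_lt_two] with n h1 h2 h3
  exact ⟨(hpq n).1, h1.le, h2.le, h3.le, (hpq n).2.2⟩

theorem tendsto_tradeRate (hα : 1 < α) (hp : Tendsto p atTop (𝓝 1))
    (hq : Tendsto q atTop (𝓝 0)) : Tendsto (fun n => tradeRate α (p n) (q n)) atTop (𝓝 0) := by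
  have hκ : 0 < min 1 (α - 1) := lt_min one_pos (by linarith)
  have h := ((hp.sub_const 1).abs).add (hq.rpow_const (p := min 1 (α - 1)) (Or.inr hκ.le))
  simpa [Real.zero_rpow hκ.ne', tradeRate] using h

/-- The limit of small trades: subsequences of rescaled solutions of the kinetic wealth model
converge to solutions of the Fokker-Planck equation. -/
theorem exists_fokkerPlanck_limit (hα : 1 < α) (hf₀ : IsDensityWithMoment α f₀)
    (hm : ∫ v, v * f₀ v = 1)
    (hpq : ∀ n, 0 < q n ∧ q n < p n ∧ (p n - 1) ^ 2 / q n = lam)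
    (hq : Tendsto q atTop (𝓝 0)) (hf : ∀ n, IsBoltzmannSolution (p n) (q n) α f₀ (f n)) :
    ∃ (k : ℕ → ℕ) (h : ℝ → ℝ → ℝ), StrictMono k ∧
      (∀ φ : ℝ → ℝ, Continuous φ → HasGrowth α φ → ∀ τ : ℝ, 0 < τ →
        Tendsto (fun j => ∫ v, φ v * rescaled (q (k j)) (f (k j)) τ v) atTop
          (𝓝 (∫ v, φ v * h τ v))) ∧
      IsFokkerPlanckSolution lam α f₀ h := by
  have hα0 : 0 ≤ α := by linarith
  obtain ⟨hp, hev⟩ := eventually_isTradeRegime hpq hq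
  obtain ⟨N, hN⟩ := eventually_atTop.1 hev
  let ρ : ℕ → ℝ → Measure ℝ := fun n =>
    rescaledLaw (p n) (q n) fun t => densityMeasure (f n t)
  have hflow := fun n => (hf n).isBoltzmannFlow hf₀
  have hm' : ∫ v, v ∂(densityMeasure f₀) = 1 := by
    rwa [integral_densityMeasure hf₀.integrable hf₀.nonneg]
  -- The parameters enter the uniform regime only from index `N` on, so the sequence is shifted and
  -- the final subsequence is `k j + N`.
  have hshift : StrictMono fun n : ℕ => n + N := fun a b hab => Nat.add_lt_add_right hab N
  have hseq : IsGrazingSequence lam α (densityMeasure f₀) (fun n => p (n + N))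
      (fun n => q (n + N)) fun n => ρ (n + N) :=
    ⟨hα, hf₀.isWealthLaw, fun n => hN _ (Nat.le_add_left _ _),
      fun n => (hflow _).isRescaledFlow hα.le (hpq _).1 hm',
      (tendsto_tradeRate hα hp hq).comp hshift.tendsto_atTop⟩
  obtain ⟨k, hk, μ, hμ⟩ := hseq.exists_subseq
  obtain ⟨hFP, hconv⟩ := (hseq.comp hk).isFokkerPlanckFlow hμ
  have hac : ∀ τ, 0 < τ → μ τ ≪ volume := fun τ hτ => by
    have := (hμ τ hτ).1
    refine absolutelyContinuous_of_integral_le fun ε hε => ?_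
    obtain ⟨b, hb0, hb⟩ := exists_integral_densityMeasure_le hf₀.integrable hf₀.nonneg hε
    -- The propagated exponent is `lam / p + 1`, and `p ≥ 1 / 2`.
    refine ⟨b * Real.exp ((2 * lam + 1) * τ), by positivity, fun φ hφ hφ0 hφ1 hφi => ?_⟩
    refine le_of_tendsto' (hconv τ hτ φ hφ.continuous (.of_bounded (C := 1) fun v => by
      rw [abs_of_nonneg (hφ0 v)]; exact hφ1 v)) fun j => ?_
    have hr := hseq.regime (k j)
    have hp0 : 0 < p (k j + N) := by linarith [hr.le_p]
    refine ((hflow (k j + N)).integral_rescaledLaw_le hα0 hr.q_pos hp0 hε.le hb0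
      (fun χ hχ => hb χ hχ.continuous) hφ hφ0 hφ1 hφi hτ).trans ?_
    have h1 : lam / p (k j + N) ≤ 2 * lam := by
      rw [div_le_iff₀ hp0]
      nlinarith [hr.lam_nonneg, hr.le_p]
    rw [hr.eq_lam]
    have h2 : 0 ≤ ∫ v, φ v := integral_nonneg hφ0
    gcongr
  have hex : ∀ τ : ℝ, ∃ g : ℝ → ℝ, 0 < τ → IsDensityWithMoment α g ∧ densityMeasure g = μ τ := by
    intro τ
    by_cases hτ : 0 < τ
    · obtain ⟨g, hg⟩ := (hFP.law τ hτ).exists_density (hac τ hτ)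
      exact ⟨g, fun _ => hg⟩
    · exact ⟨0, fun h => absurd h hτ⟩
  choose h hh using hex
  have heq : ∀ τ, 0 < τ → densityMeasure (h τ) = μ τ := fun τ hτ => (hh τ hτ).2
  refine ⟨fun j => k j + N, h, hshift.comp hk, fun φ hφ hg τ hτ => ?_,
    IsFokkerPlanckFlow.isFokkerPlanckSolution hα hf₀ (fun τ hτ => (hh τ hτ).1)
      ⟨fun τ hτ => by rw [heq τ hτ]; exact hFP.law τ hτ, fun A => ?_, fun φ hφ hs τ hτ => ?_,
        fun φ hφ hs => ?_⟩⟩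
  · have e := hconv τ hτ φ hφ hg
    rw [← heq τ hτ, integral_densityMeasure (hh τ hτ).1.integrable (hh τ hτ).1.nonneg] at e
    exact e.congr fun j => ((hf _).integral_rescaled hf₀ hα.le (hpq _).1 hm φ hτ).symm
  · obtain ⟨T, h1, h2, h3⟩ := hFP.tail A
    exact ⟨T, h1, h2, fun τ hτ => by rw [heq τ hτ]; exact h3 τ hτ⟩
  · rw [heq τ hτ]
    refine (hFP.hasDerivAt φ hφ hs τ hτ).congr_of_eventuallyEq ?_
    filter_upwards [lt_mem_nhds hτ] with t ht
    rw [heq t ht]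
  · refine (hFP.initial φ hφ hs).congr' ?_
    filter_upwards [self_mem_nhdsWithin] with t ht
    rw [heq t ht]

end GrazingLimit

end WealthModel

/-! ### The three assertions combined. -/

theorem mainTheorem7 (lam δ : ℝ) (hlam : 0 < lam) (hδ : 0 < δ) (f₀ : ℝ → ℝ)
    (hf₀ : WealthModel.IsDensityWithMoment (1 + δ) f₀) (hmean : ∫ v, v * f₀ v = 1) :
    -- weak solutions of the kinetic model exist
    (∀ p q : ℝ, 0 < q → q < p → (p - 1) ^ 2 / q = lam →
      ∃ f : ℝ → ℝ → ℝ, WealthModel.IsBoltzmannSolution p q (1 + δ) f₀ f) ∧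
    -- and, rescaled, they converge as `q → 0`, up to a subsequence
    (∀ (p q : ℕ → ℝ) (f : ℕ → ℝ → ℝ → ℝ),
      (∀ n, 0 < q n ∧ q n < p n ∧ (p n - 1) ^ 2 / q n = lam) →
      Tendsto q atTop (𝓝 0) →
      (∀ n, WealthModel.IsBoltzmannSolution (p n) (q n) (1 + δ) f₀ (f n)) →
      ∃ (k : ℕ → ℕ) (h : ℝ → ℝ → ℝ), StrictMono k ∧
        (∀ φ : ℝ → ℝ, WealthModel.HolderClass (1 + δ) φ → ∀ τ : ℝ, 0 < τ →
          Tendsto (fun j => ∫ v, φ v * WealthModel.rescaled (q (k j)) (f (k j)) τ v) atTop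
            (𝓝 (∫ v, φ v * h τ v))) ∧
        WealthModel.IsFokkerPlanckSolution lam (1 + δ) f₀ h) ∧
    -- the limit equation has a unique stationary state of unit mass, with a Pareto tail
    (WealthModel.IsStationaryState lam (WealthModel.equilibrium lam) ∧
      (∀ M : ℝ → ℝ, WealthModel.IsStationaryState lam M →
        M =ᵐ[volume] WealthModel.equilibrium lam) ∧
      0 < (WealthModel.paretoExponent lam - 1) ^ WealthModel.paretoExponent lam /
        Real.Gamma (WealthModel.paretoExponent lam) ∧
      Tendsto (fun v : ℝ =>
          v ^ (1 + WealthModel.paretoExponent lam) * WealthModel.equilibrium lam v) atTop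
        (𝓝 ((WealthModel.paretoExponent lam - 1) ^ WealthModel.paretoExponent lam /
          Real.Gamma (WealthModel.paretoExponent lam)))) := by
  refine ⟨fun p q hq hqp _ =>
    WealthModel.exists_isBoltzmannSolution (by linarith) (hq.trans hqp) hq.le hf₀,
    fun p q f hpq hq hf => ?_, ⟨WealthModel.isProbDensity_equilibrium hlam,
      fun φ h hs => WealthModel.fokkerPlanck_equilibrium hlam h hs⟩,
    fun M hM => hM.ae_eq_equilibrium hlam, ?_,
    WealthModel.tendsto_rpow_mul_equilibrium⟩
  · obtain ⟨k, h, hk, hconv, hFP⟩ := WealthModel.exists_fokkerPlanck_limit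
      (by linarith : 1 < 1 + δ) hf₀ hmean hpq hq hf
    exact ⟨k, h, hk, fun φ hφ => hconv φ hφ.continuous hφ.hasGrowth, hFP⟩
  · simp only [WealthModel.paretoExponent, add_sub_cancel_left]
    exact WealthModel.equilibrium_const_pos hlam
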